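/- Setting. Let $b\ge 1$, $s\ge 1$, $s_0,s_1\ge 0$ be integers with $s_0+bs_1\le s+1$, and let $\mathcal V=(V_1,\dots,V_b)$ be a random vector with $V_i\ge 0$ and $\sum_i V_i\le 1$ a.s., such that $\mathbb P(\max_i V_i=1)<1$, $\mathbb P(\min_i V_i>0)>0$ and $\sum_i\mathbb P(V_i>0)>1$. (If $\sum_i V_i=1$ a.s. this is an ordinary split tree.) The fractional split tree $T_n$ with $n$ balls is constructed on the nodes of the infinite $b$-ary tree, i.e. the finite words $v$ over $\{1,\dots,b\}$, from independent copies $\mathcal V^{(v)}$ of $\mathcal V$. The root has $n_\varepsilon=n$ balls in its subtree. If $n_v>s$, then, given $n_v$ and $\mathcal V^{(v)}=(V_1,\dots,V_b)$, the vector $(n_{v1},\dots,n_{vb})$ of numbers of balls in the subtrees of the children of $v$ is distributed as the first $b$ entries of $$\mathrm{Mult}\Bigl(n_v-s_0-bs_1;\,V_1,\dots,V_b,1-\sum_i V_i\Bigr)+(s_1,\dots,s_1,0),$$ independently for different nodes; if $n_v\le s$, then $n_{vi}=0$ for all $i$. The nodes of $T_n$ are the words $v$ with $n_v>0$, and $T_n^v$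 denotes the fringe subtree at $v$ (the node $v$ and all its descendants, with their balls). Let $\beta\in(0,1]$ be the Malthusian parameter, given by $\mathbb E\sum_i V_i^\beta=1$. We are in the lattice case if there is $d>0$ such that a.s. $\ln V_i\in d\mathbb Z$ for every $i$ with $V_i>0$; then $d$ denotes the largest such number. Otherwise we are in the nonlattice case and $d:=0$. A toll function $\phi$ is a real function of trees with balls such that $\phi(T_n)$ is integrable for all $n\ge 1$; put $\phi_n:=\mathbb E[\phi(T_n)]$ and $X_n(\phi):=\sum_{v\in T_n}\phi(T_n^v)$. For $k\ge1$ let $\delta_k$ be the toll function that is $1$ on trees with exactly $k$ balls and $0$ on all other trees. Statement. Let $\phi$ be a toll function with $\phi_n=O(n^{\beta-\delta})$ for some $\delta>0$. The tree $T_n$ is a.s. finite for every $n$. For $\psi=\phi$, and for $\psi=\delta_k$ with any $k\ge 1$, all $X_n(\psi)$ are integrable and there is a unique bounded, continuous, $d$-periodic function $\varpi[\psi]:\mathbb R\to\mathbb R$ (constant in the nonlattice case) with $$\mathbb E[X_n(\psi)]=\varpi[\psi](\ln n)\,n^\beta+o(n^\beta),\qquad n\to\infty.$$ These functions satisfy $$\varpi[\phi]=\sum_{k=1}^\infty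 \varpi[\delta_k]\,\phi_k ,$$ where the partial sums of the series converge pointwise, and in the lattice case uniformly on $\mathbb R$. -/

import Mathlib

open MeasureTheory Filter Topology Asymptotics

noncomputable section

namespace FractionalSplit

/-- Nodes of the infinite `b`-ary tree: finite words over `Fin b`. The empty word is the root, and
the children of `v` are the words `v ++ [i]`. -/
abbrev Node (b : ℕ) := List (Fin b)

/-- A tree with balls, described by the number `t u` of balls in the subtree rooted at each node
`u`. The tree itself consists of the nodes `u` with `0 < t u`. -/
abbrev BallTree (b : ℕ) := Node b → ℕ

/-- The set of nodes of a tree with balls. -/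
def BallTree.nodes {b : ℕ} (t : BallTree b) : Set (Node b) := {u | 0 < t u}

/-- The fringe subtree rooted at `v`: the node `v` with all its descendants. -/
def BallTree.fringe {b : ℕ} (t : BallTree b) (v : Node b) : BallTree b := fun u => t (v ++ u)

open Classical in
/-- The additive functional of a toll function `φ`: the sum of `φ` over all fringe subtrees of
`t`. -/
def BallTree.additive {b : ℕ} (φ : BallTree b → ℝ) (t : BallTree b) : ℝ :=
  ∑' v : Node b, if v ∈ t.nodes then φ (t.fringe v) else 0

/-- The toll function indicating that a tree has exactly `k` balls in total. -/
def sizeToll (b k : ℕ) : BallTree b → ℝ := fun t => if t [] = k then 1 else 0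

/-- The parameters of a fractional split tree of arity `b`: the capacity `s` of a leaf, the number
`s₀` of balls retained in an internal node, the number `s₁` of balls given to every child in
advance, and the law of the split vector `(V_1, …, V_b)`. Ordinary split trees are those for which
the split vector sums up to `1` almost surely. -/
structure Model (b : ℕ) where
  s : ℕ
  s₀ : ℕ
  s₁ : ℕ
  law : Measure (Fin b → ℝ)
  isProbabilityMeasure_law : IsProbabilityMeasure law
  one_le_s : 1 ≤ s
  retained_le : s₀ + b * s₁ ≤ s + 1
  nonneg : ∀ᵐ v ∂law, ∀ i, 0 ≤ v i
  sum_le_one : ∀ᵐ v ∂law, ∑ i, v i ≤ 1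
  /-- The largest splitter is not almost surely equal to `1`. -/
  max_ne_one : law {v | ∃ i, v i = 1} < 1
  /-- The smallest splitter is positive with positive probability. -/
  min_pos : 0 < law {v | ∀ i, 0 < v i}
  /-- The expected number of positive splitters exceeds `1` (automatic for ordinary split trees). -/
  supercritical : 1 < ∑ i, law {v | 0 < v i}

attribute [instance] Model.isProbabilityMeasure_law

/-- The randomness used at one node: a split vector and a sequence of numbers in `[0, 1]`, the
`j`-th of which directs the `j`-th ball that is thrown at random to the children. -/
abbrev NodeSource (b : ℕ) := (Fin b → ℝ) × (ℕ → unitInterval)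

/-- The randomness used in the construction of the whole tree. -/
abbrev Source (b : ℕ) := Node b → NodeSource b

/-- A ball directed by the number `x` goes to child `i` if `x` lies in the `i`-th of the
consecutive half-open intervals of lengths `v 0, v 1, …` that start at `0`. If `x` lies in none of
them, then the ball disappears. -/
def GoesTo {b : ℕ} (v : Fin b → ℝ) (x : ℝ) (i : Fin b) : Prop :=
  ∑ j ∈ Finset.Iio i, v j ≤ x ∧ x < ∑ j ∈ Finset.Iic i, v j

open Classical in
/-- The number of balls among the first `m` ones that go to child `i`. If the directing numbers are
independent and uniform on `[0, 1]`, then these counts, together with the number of balls that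
disappear, have the distribution `Mult (m; v_1, …, v_b, 1 - ∑ v_i)`. -/
def multCount {b : ℕ} (x : NodeSource b) (m : ℕ) (i : Fin b) : ℕ :=
  ((Finset.range m).filter fun j => GoesTo x.1 (x.2 j) i).card

namespace Model

variable {b : ℕ} (M : Model b)

/-- The number of balls in the subtree of the `i`-th child of a node with `n` balls in its subtree
and with local randomness `x`. A node with at most `s` balls is not split. -/
def childSize (x : NodeSource b) (n : ℕ) (i : Fin b) : ℕ :=
  if M.s < n then multCount x (n - M.s₀ - b * M.s₁) i + M.s₁ else 0

/-- The tree `T_n` with `n` balls built from the randomness `ω`. The subtree at the `i`-th child of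
the root is built in the same way from the randomness at the descendants of that child. -/
def tree : ℕ → Source b → BallTree b
  | n, _, [] => n
  | n, ω, i :: u => tree (M.childSize (ω []) n i) (fun w => ω (i :: w)) u

/-- The law of the randomness at one node: the split vector is distributed according to the given
law and independent of the directing numbers, which are independent and uniform on `[0, 1]`. -/
def nodeLaw : Measure (NodeSource b) :=
  M.law.prod (Measure.infinitePi fun _ : ℕ => (volume : Measure unitInterval))

/-- The randomness at different nodes is independent. -/
def sourceLaw : Measure (Source b) := Measure.infinitePi fun _ : Node b => M.nodeLaw

/-- `φ_n = E[φ(T_n)]`. -/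
def meanToll (φ : BallTree b → ℝ) (n : ℕ) : ℝ := ∫ ω, φ (M.tree n ω) ∂M.sourceLaw

/-- `X_n(φ)`, the sum of the toll function `φ` over all fringe subtrees of `T_n`. -/
def X (φ : BallTree b → ℝ) (n : ℕ) (ω : Source b) : ℝ := (M.tree n ω).additive φ

/-- `β` is the Malthusian parameter: `β ∈ (0, 1]` and `E[∑ V_i ^ β] = 1`. -/
def IsMalthusian (β : ℝ) : Prop :=
  0 < β ∧ β ≤ 1 ∧ ∫ v, ∑ i, v i ^ β ∂M.law = 1

/-- The numbers `d > 0` such that the logarithm of every positive splitter is almost surely an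
integer multiple of `d`. -/
def spans : Set ℝ :=
  {d | 0 < d ∧ ∀ᵐ v ∂M.law, ∀ i, 0 < v i → ∃ k : ℤ, Real.log (v i) = k * d}

/-- The lattice case. -/
def IsLattice : Prop := M.spans.Nonempty

/-- The span `d`: the largest element of `M.spans` in the lattice case, and `0` otherwise. -/
def span : ℝ := sSup M.spans

/-- `w` is a limit function of the toll function `φ`: it is bounded, continuous, `d`-periodic, and
constant in the nonlattice case, all `X_n(φ)` are integrable, and
`E[X_n(φ)] = w(ln n) n ^ β + o(n ^ β)`. -/
structure IsLimitFunction (β : ℝ) (φ : BallTree b → ℝ) (w : ℝ → ℝ) : Prop where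
  bounded : ∃ C, ∀ t, |w t| ≤ C
  continuous : Continuous w
  periodic : Function.Periodic w M.span
  constant : ¬ M.IsLattice → ∃ c, ∀ t, w t = c
  integrable : ∀ n, Integrable (M.X φ n) M.sourceLaw
  mean : (fun n : ℕ => ∫ ω, M.X φ n ω ∂M.sourceLaw - w (Real.log n) * (n : ℝ) ^ β)
    =o[atTop] fun n : ℕ => (n : ℝ) ^ β

open Classical in
/-- The limit function `ϖ[φ]` of the toll function `φ` (and `0` if there is none). -/
def limitFunction (β : ℝ) (φ : BallTree b → ℝ) : ℝ → ℝ :=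
  if h : ∃ w, M.IsLimitFunction β φ w then h.choose else 0

end Model

end FractionalSplit

end

noncomputable section

namespace FractionalSplit

/-! By linearity, `E[X_n(φ)]` is the finite sum of `φ_k * u_k(n)` over `k ≤ n`, where `u_k(n)`
(`meanCount`) is the expected number of nodes with `k` balls (`integral_X_eq_sum`). Two facts then
suffice: each `u_k(n) / n ^ β` approaches a continuous periodic function of `log n`, and the terms
with `k > K` contribute at most `ε K * n ^ β` with `ε K → 0`, uniformly in `n`.

The tail. Let `T` be the one-step operator of the branching process of ball counts. It multiplies `n
^ γ` by `E ∑ V_i ^ γ` up to `O(n ^ (γ / 2))`; this factor is `1` at `γ = β` and exceeds `1` below.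
So for `β / 2 < γ < β` a combination `2 B n ^ β - B n ^ γ` is a supersolution for the toll `n ^ γ`,
whose functional is thus `O(n ^ β)` (`R_powFun_le`). Comparing `φ_k` with `k ^ γ` gives
`exists_tail_bound`.

A single `k`. Run `n` and `n + D` balls with the same randomness. Jensen's inequality and the
Malthusian equation show that the extra balls satisfy `E ∑ D_i ^ β ≤ D ^ β`, so `u_k` is `β`-Hölder
(`abs_R_unit_sub_le`). This permits replacing the child sizes by `n V_i` in `u_k = T u_k`, and `f(t)
= e ^ (-β t) u_k(⌊e ^ t⌋)` solves a renewal equation with error `O(e ^ (-β t / 2))`, its step being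
`-log V` biased by `V ^ β` (`isRenewal_rescale`).

The renewal theorem uses a maximum principle. Where `f` is close to its limsup `S`, it is also close
to `S` after stepping back by any point of the support of the step law, hence by any element of the
semigroup generated by the support. Far out, this semigroup is dense enough to make `f` nearly `S`
on a whole long window, and a barrier carries this lower bound to all later times (`propagation`).
The argument is applied on all of `ℝ` in the nonlattice case and on each coset of `d ℤ` in the
lattice case. -/

theorem abs_rpow_sub_rpow_le {a b p : ℝ} (ha : 0 ≤ a) (hb : 0 ≤ b) (hp : 0 ≤ p) (hp1 : p ≤ 1) :
    |a ^ p - b ^ p| ≤ |a - b| ^ p := by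
  wlog h : b ≤ a generalizing a b
  · rw [abs_sub_comm, abs_sub_comm a b]
    exact this hb ha (le_of_not_ge h)
  have h1 : b ^ p ≤ a ^ p := Real.rpow_le_rpow hb h hp
  rw [abs_of_nonneg (sub_nonneg.2 h1), abs_of_nonneg (sub_nonneg.2 h)]
  have := Real.rpow_add_le_add_rpow (sub_nonneg.2 h) hb hp hp1
  rw [sub_add_cancel] at this
  linarith

theorem integral_rpow_le_rpow_integral {Ω : Type*} [MeasurableSpace Ω] {P : Measure Ω}
    [IsProbabilityMeasure P] {Y : Ω → ℝ} {p : ℝ} (hp : 0 ≤ p) (hp1 : p ≤ 1)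
    (hY : ∀ᵐ x ∂P, 0 ≤ Y x) (hi : Integrable Y P) (hip : Integrable (fun x => Y x ^ p) P) :
    ∫ x, Y x ^ p ∂P ≤ (∫ x, Y x ∂P) ^ p :=
  (Real.concaveOn_rpow hp hp1).le_map_integral
    (continuousOn_id.rpow_const fun _ _ => Or.inr hp) isClosed_Ici hY hi hip

/-- The law of the directing numbers at one node. -/
def dirLaw : Measure (ℕ → unitInterval) :=
  Measure.infinitePi fun _ : ℕ => (volume : Measure unitInterval)

instance : IsProbabilityMeasure dirLaw := by unfold dirLaw; infer_instance

open Classical in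
/-- The indicator that the ball directed by `y` goes to child `i`. -/
def ballInd {b : ℕ} (v : Fin b → ℝ) (i : Fin b) (y : unitInterval) : ℝ :=
  if GoesTo v y i then 1 else 0

/-! ### Multinomial counts for a fixed split vector. -/

section Ball

variable {b : ℕ} {v : Fin b → ℝ} {i : Fin b}

theorem measurableSet_goesTo (v : Fin b → ℝ) (i : Fin b) :
    MeasurableSet {y : unitInterval | GoesTo v y i} := by
  unfold GoesTo
  exact (measurableSet_le measurable_const measurable_subtype_coe).inter
    (measurableSet_lt measurable_subtype_coe measurable_const)

theorem measurable_ballInd (v : Fin b → ℝ) (i : Fin b) : Measurable (ballInd v i) :=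
  Measurable.ite (measurableSet_goesTo v i) measurable_const measurable_const

theorem ballInd_nonneg (v : Fin b → ℝ) (i : Fin b) (y : unitInterval) : 0 ≤ ballInd v i y := by
  unfold ballInd; split_ifs <;> norm_num

theorem ballInd_le_one (v : Fin b → ℝ) (i : Fin b) (y : unitInterval) : ballInd v i y ≤ 1 := by
  unfold ballInd; split_ifs <;> norm_num

theorem volume_goesTo (hv : ∀ i, 0 ≤ v i) (hs : ∑ i, v i ≤ 1) (i : Fin b) :
    (volume : Measure unitInterval) {y | GoesTo v y i} = ENNReal.ofReal (v i) := by
  have h0 : 0 ≤ ∑ j ∈ Finset.Iio i, v j := Finset.sum_nonneg fun _ _ => hv _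
  have h1 : ∑ j ∈ Finset.Iic i, v j ≤ 1 :=
    (Finset.sum_le_sum_of_subset_of_nonneg (Finset.subset_univ _) fun _ _ _ => hv _).trans hs
  have h2 : ∑ j ∈ Finset.Iic i, v j = ∑ j ∈ Finset.Iio i, v j + v i := by
    rw [← Finset.Iio_insert, Finset.sum_insert (by simp), add_comm]
  have : (Subtype.val '' {y : unitInterval | GoesTo v y i}) =
      Set.Ico (∑ j ∈ Finset.Iio i, v j) (∑ j ∈ Finset.Iic i, v j) := by
    ext z
    simp only [Set.mem_image, Set.mem_ofPred_eq, Set.mem_Ico, GoesTo]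
    constructor
    · rintro ⟨y, hy, rfl⟩; exact hy
    · intro hz
      exact ⟨⟨z, h0.trans hz.1, hz.2.le.trans h1⟩, hz, rfl⟩
  rw [unitInterval.volume_apply, this, Real.volume_Ico, h2, add_sub_cancel_left]

theorem integral_ballInd (hv : ∀ i, 0 ≤ v i) (hs : ∑ i, v i ≤ 1) (i : Fin b) :
    ∫ y, ballInd v i y = v i := by
  have : ballInd v i = Set.indicator {y : unitInterval | GoesTo v y i} 1 := by
    classical
    ext y; simp [ballInd, Set.indicator]
  rw [this, integral_indicator_one (measurableSet_goesTo v i), Measure.real,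
    volume_goesTo hv hs, ENNReal.toReal_ofReal (hv i)]

theorem multCount_eq_sum (x : NodeSource b) (m : ℕ) (i : Fin b) :
    (multCount x m i : ℝ) = ∑ j ∈ Finset.range m, ballInd x.1 i (x.2 j) := by
  simp [multCount, ballInd]

theorem integrable_ballInd_eval (v : Fin b → ℝ) (i : Fin b) (j : ℕ) :
    Integrable (fun y : ℕ → unitInterval => ballInd v i (y j)) dirLaw := by
  refine Integrable.of_bound (C := 1)
    ((measurable_ballInd v i).comp (measurable_pi_apply j)).aestronglyMeasurable ?_
  refine ae_of_all _ fun y => ?_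
  rw [Real.norm_eq_abs, abs_of_nonneg (ballInd_nonneg _ _ _)]
  exact ballInd_le_one _ _ _

theorem integral_ballInd_eval (hv : ∀ i, 0 ≤ v i) (hs : ∑ i, v i ≤ 1) (i : Fin b) (j : ℕ) :
    ∫ y : ℕ → unitInterval, ballInd v i (y j) ∂dirLaw = v i := by
  rw [← integral_ballInd hv hs i]
  have hj := measurePreserving_eval_infinitePi
    (fun _ : ℕ => (volume : Measure unitInterval)) j
  rw [← hj.map_eq, integral_map hj.measurable.aemeasurable
    (measurable_ballInd v i).aestronglyMeasurable]
  rfl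

theorem integral_sum_ballInd (hv : ∀ i, 0 ≤ v i) (hs : ∑ i, v i ≤ 1) (i : Fin b) (s : Finset ℕ) :
    ∫ y : ℕ → unitInterval, ∑ j ∈ s, ballInd v i (y j) ∂dirLaw = s.card * v i := by
  rw [integral_finsetSum _ fun j _ => integrable_ballInd_eval v i j]
  simp [integral_ballInd_eval hv hs]

/-- The count is a sum of `m` independent indicators, each of variance at most `1`. -/
theorem integral_sq_multCount_sub_le (hv : ∀ i, 0 ≤ v i) (hs : ∑ i, v i ≤ 1) (i : Fin b) (m : ℕ) :
    ∫ y : ℕ → unitInterval, ((multCount (v, y) m i : ℝ) - m * v i) ^ 2 ∂dirLaw ≤ m := by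
  have hmem : ∀ j, MemLp (fun y : ℕ → unitInterval => ballInd v i (y j)) 2 dirLaw := fun j => by
    refine MemLp.of_bound
      ((measurable_ballInd v i).comp (measurable_pi_apply j)).aestronglyMeasurable 1 ?_
    refine ae_of_all _ fun y => ?_
    rw [Real.norm_eq_abs, abs_of_nonneg (ballInd_nonneg _ _ _)]
    exact ballInd_le_one _ _ _
  have hind := ProbabilityTheory.iIndepFun_infinitePi
    (P := fun _ : ℕ => (volume : Measure unitInterval)) (X := fun _ => ballInd v i)
    fun _ => measurable_ballInd v i
  have hvar := ProbabilityTheory.IndepFun.variance_sum (μ := dirLaw) (s := Finset.range m)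
    (X := fun j y => ballInd v i (y j)) (fun j _ => hmem j)
    (fun j _ k _ hjk => hind.indepFun hjk)
  have hm : Measurable (∑ j ∈ Finset.range m, fun y : ℕ → unitInterval => ballInd v i (y j)) :=
    Finset.sum_induction _ Measurable (fun _ _ h h' => h.add h') measurable_zero
      fun j _ => (measurable_ballInd v i).comp (measurable_pi_apply j)
  rw [ProbabilityTheory.variance_eq_integral hm.aemeasurable] at hvar
  have hsum : ∀ y : ℕ → unitInterval,
      (∑ j ∈ Finset.range m, fun y : ℕ → unitInterval => ballInd v i (y j)) y =
        (multCount (v, y) m i : ℝ) := fun y => by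
    rw [multCount_eq_sum, Finset.sum_apply]
  have hmean : ∫ y, (∑ j ∈ Finset.range m, fun y : ℕ → unitInterval => ballInd v i (y j)) y
      ∂dirLaw = m * v i := by
    simp only [Finset.sum_apply]
    rw [integral_sum_ballInd hv hs, Finset.card_range]
  rw [hmean] at hvar
  simp only [hsum] at hvar
  rw [hvar]
  calc ∑ j ∈ Finset.range m, ProbabilityTheory.variance (fun y => ballInd v i (y j)) dirLaw
      ≤ ∑ j ∈ Finset.range m, (1 : ℝ) := by
        refine Finset.sum_le_sum fun j _ => ?_
        refine (ProbabilityTheory.variance_le_expectation_sq (hmem j).1).trans ?_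
        calc ∫ y, ((fun y : ℕ → unitInterval => ballInd v i (y j)) ^ 2) y ∂dirLaw
            ≤ ∫ _, (1 : ℝ) ∂dirLaw := by
              refine integral_mono_of_nonneg (ae_of_all _ fun y => ?_) (integrable_const _)
                (ae_of_all _ fun y => ?_)
              · exact sq_nonneg _
              · exact pow_le_one₀ (ballInd_nonneg _ _ _) (ballInd_le_one _ _ _)
          _ = 1 := by simp
    _ = m := by simp

/-- Already the first two balls must go to child `i`. Two are needed because `∑ v_i` may equal `1`,
whereas `∑ v_i ^ 2` is below `1` with positive probability. -/
theorem dirLaw_two_balls_le (hv : ∀ i, 0 ≤ v i) (hs : ∑ i, v i ≤ 1) (i : Fin b) {m : ℕ}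
    (hm : 2 ≤ m) :
    dirLaw.real {y | multCount (v, y) m i = m} ≤ v i ^ 2 := by
  have hsub : {y : ℕ → unitInterval | multCount (v, y) m i = m} ⊆
      (↑(Finset.range 2) : Set ℕ).pi fun _ => {y : unitInterval | GoesTo v y i} := by
    intro y hy j hj
    classical
    have hy' : ((Finset.range m).filter fun j => GoesTo v (y j) i).card = (Finset.range m).card := by
      simpa [multCount] using hy
    have := Finset.card_filter_eq_iff.1 hy' j (by
      simp only [Finset.coe_range, Set.mem_Iio] at hj; simp; omega)
    exact this
  have h1 : dirLaw ((↑(Finset.range 2) : Set ℕ).pi fun _ => {y : unitInterval | GoesTo v y i})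
      = ENNReal.ofReal (v i) ^ 2 := by
    unfold dirLaw
    rw [Measure.infinitePi_pi _ fun _ _ => measurableSet_goesTo v i]
    simp [volume_goesTo hv hs]
  calc dirLaw.real {y | multCount (v, y) m i = m}
      ≤ dirLaw.real
        ((↑(Finset.range 2) : Set ℕ).pi fun _ => {y : unitInterval | GoesTo v y i}) :=
        measureReal_mono hsub
    _ = v i ^ 2 := by
      rw [Measure.real, h1, ENNReal.toReal_pow, ENNReal.toReal_ofReal (hv i)]

theorem multCount_le (x : NodeSource b) (m : ℕ) (i : Fin b) : multCount x m i ≤ m := by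
  classical
  exact (Finset.card_filter_le _ _).trans (Finset.card_range m).le

theorem multCount_add_sub (x : NodeSource b) (m D : ℕ) (i : Fin b) :
    (multCount x (m + D) i : ℝ) - multCount x m i =
      ∑ j ∈ Finset.Ico m (m + D), ballInd x.1 i (x.2 j) := by
  rw [multCount_eq_sum, multCount_eq_sum, Finset.sum_Ico_eq_sub _ (by omega)]

theorem measurable_multCount (m : ℕ) (i : Fin b) :
    Measurable fun x : NodeSource b => multCount x m i := by
  classical
  have : (fun x : NodeSource b => multCount x m i) = fun x =>
      ∑ j ∈ Finset.range m, if GoesTo x.1 (x.2 j) i then 1 else 0 := by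
    ext x; simp [multCount]
  rw [this]
  refine Finset.measurable_sum _ fun j _ => ?_
  refine Measurable.ite ?_ measurable_const measurable_const
  have h1 : Measurable fun x : NodeSource b => ((x.2 j : unitInterval) : ℝ) :=
    measurable_subtype_coe.comp ((measurable_pi_apply j).comp measurable_snd)
  have h2 : ∀ s : Finset (Fin b), Measurable fun x : NodeSource b => ∑ l ∈ s, x.1 l := fun s =>
    Finset.measurable_sum _ fun l _ => (measurable_pi_apply l).comp measurable_fst
  exact (measurableSet_le (h2 _) h1).inter (measurableSet_lt h1 (h2 _))

end Ball

section FiniteRange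

variable {Ω : Type*} [MeasurableSpace Ω] {P : Measure Ω} [IsProbabilityMeasure P]

theorem integrable_comp_of_le {N : Ω → ℕ} (hN : Measurable N) {n : ℕ} (hn : ∀ x, N x ≤ n)
    (g : ℕ → ℝ) : Integrable (fun x => g (N x)) P := by
  refine Integrable.of_bound (C := ∑ k ∈ Finset.range (n + 1), |g k|)
    (measurable_from_nat.comp hN).aestronglyMeasurable (ae_of_all _ fun x => ?_)
  exact Finset.single_le_sum (f := fun k => |g k|) (fun _ _ => abs_nonneg _)
    (Finset.mem_range.2 (Nat.lt_succ_of_le (hn x)))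

theorem integral_comp_of_le {N : Ω → ℕ} (hN : Measurable N) {n : ℕ} (hn : ∀ x, N x ≤ n)
    (g : ℕ → ℝ) : ∫ x, g (N x) ∂P =
      ∑ k ∈ Finset.range (n + 1), P.real {x | N x = k} * g k := by
  have h : ∀ x, g (N x) = ∑ k ∈ Finset.range (n + 1), Set.indicator {x | N x = k} (fun _ => g k) x := by
    intro x
    classical
    simp only [Set.indicator_apply, Set.mem_ofPred_eq]
    rw [Finset.sum_ite_eq, if_pos (Finset.mem_range.2 (Nat.lt_succ_of_le (hn x)))]
  have hm : ∀ k, MeasurableSet {x | N x = k} := fun k => hN (measurableSet_singleton k)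
  simp_rw [h]
  rw [integral_finsetSum _ fun k _ => (integrable_const _).indicator (hm k)]
  refine Finset.sum_congr rfl fun k _ => ?_
  rw [integral_indicator_const _ (hm k), smul_eq_mul]

end FiniteRange

/-! ### Child sizes and the one-step transition operator. -/

namespace Model

variable {b : ℕ} (M : Model b)

theorem nodeLaw_eq : M.nodeLaw = M.law.prod dirLaw := rfl

instance : IsProbabilityMeasure M.nodeLaw := by rw [nodeLaw_eq]; infer_instance

theorem two_le_arity (M : Model b) : 2 ≤ b := by
  by_contra hb
  have h := M.supercritical
  have : ∑ i, M.law {v | 0 < v i} ≤ ∑ _i : Fin b, 1 := Finset.sum_le_sum fun i _ => prob_le_one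
  simp only [Finset.sum_const, Finset.card_univ, Fintype.card_fin, nsmul_eq_mul, mul_one] at this
  have h1 : ((1 : ℕ) : ENNReal) < b := by simpa using h.trans_le this
  rw [Nat.cast_lt] at h1
  omega

theorem ae_law_good : ∀ᵐ v ∂M.law, (∀ i, 0 ≤ v i) ∧ ∑ i, v i ≤ 1 :=
  M.nonneg.and M.sum_le_one

theorem ae_nodeLaw_of_ae_law {p : (Fin b → ℝ) → Prop} (h : ∀ᵐ v ∂M.law, p v) :
    ∀ᵐ x ∂M.nodeLaw, p x.1 :=
  Measure.quasiMeasurePreserving_fst.ae h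

theorem ae_nodeLaw_good : ∀ᵐ x ∂M.nodeLaw, (∀ i, 0 ≤ x.1 i) ∧ ∑ i, x.1 i ≤ 1 :=
  M.ae_nodeLaw_of_ae_law M.ae_law_good

theorem integral_fst_nodeLaw (g : (Fin b → ℝ) → ℝ) :
    ∫ x, g x.1 ∂M.nodeLaw = ∫ v, g v ∂M.law := by
  rw [nodeLaw_eq, integral_fun_fst]; simp

/-- The number of balls that an internal node with `n` balls throws at random. -/
def thrown (n : ℕ) : ℕ := n - M.s₀ - b * M.s₁

theorem childSize_of_lt {n : ℕ} (h : M.s < n) (x : NodeSource b) (i : Fin b) :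
    M.childSize x n i = multCount x (M.thrown n) i + M.s₁ := if_pos h

theorem childSize_of_le {n : ℕ} (h : n ≤ M.s) (x : NodeSource b) (i : Fin b) :
    M.childSize x n i = 0 := if_neg (not_lt.2 h)

/-- The truncated subtractions in `thrown` lose nothing, because `s₀ + b * s₁ ≤ s + 1 ≤ n`. -/
theorem thrown_add_retained {n : ℕ} (h : M.s < n) : M.thrown n + (M.s₀ + b * M.s₁) = n := by
  have := M.retained_le
  unfold thrown; omega

/-- The factor `2` makes a child strictly smaller than its parent as soon as `s₁ > 0`. -/
theorem s₁_le : 2 * M.s₁ ≤ b * M.s₁ := Nat.mul_le_mul_right _ M.two_le_arity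

theorem childSize_le (x : NodeSource b) (n : ℕ) (i : Fin b) : M.childSize x n i ≤ n := by
  rcases lt_or_ge M.s n with h | h
  · rw [M.childSize_of_lt h]
    have h1 := multCount_le x (M.thrown n) i
    have h2 := M.thrown_add_retained h
    have h3 := M.s₁_le
    omega
  · rw [M.childSize_of_le h]; omega

theorem measurable_childSize (n : ℕ) (i : Fin b) :
    Measurable fun x : NodeSource b => M.childSize x n i := by
  rcases lt_or_ge M.s n with h | h
  · simp_rw [M.childSize_of_lt h]
    exact (measurable_multCount _ i).add_const _
  · simp_rw [M.childSize_of_le h]; exact measurable_const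

/-- The expected number of children with `k` balls of a node with `n` balls. -/
def trans (n k : ℕ) : ℝ := ∑ i, M.nodeLaw.real {x | M.childSize x n i = k}

/-- The transition operator on functions of the number of balls. -/
def T (g : ℕ → ℝ) (n : ℕ) : ℝ := ∑ k ∈ Finset.range (n + 1), M.trans n k * g k

theorem trans_nonneg (n k : ℕ) : 0 ≤ M.trans n k := Finset.sum_nonneg fun _ _ => measureReal_nonneg

theorem integrable_childSize (g : ℕ → ℝ) (n : ℕ) (i : Fin b) :
    Integrable (fun x => g (M.childSize x n i)) M.nodeLaw :=
  integrable_comp_of_le (M.measurable_childSize n i) (fun x => M.childSize_le x n i) g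

theorem integral_childSize (g : ℕ → ℝ) (n : ℕ) (i : Fin b) :
    ∫ x, g (M.childSize x n i) ∂M.nodeLaw =
      ∑ k ∈ Finset.range (n + 1), M.nodeLaw.real {x | M.childSize x n i = k} * g k :=
  integral_comp_of_le (M.measurable_childSize n i) (fun x => M.childSize_le x n i) g

theorem T_eq_sum_integral (g : ℕ → ℝ) (n : ℕ) :
    M.T g n = ∑ i, ∫ x, g (M.childSize x n i) ∂M.nodeLaw := by
  simp_rw [integral_childSize, T, trans, Finset.sum_mul]
  rw [Finset.sum_comm]

theorem T_mono {g h : ℕ → ℝ} {n : ℕ} (H : ∀ k ≤ n, g k ≤ h k) : M.T g n ≤ M.T h n :=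
  Finset.sum_le_sum fun k hk => mul_le_mul_of_nonneg_left
    (H k (Nat.lt_succ_iff.1 (Finset.mem_range.1 hk))) (M.trans_nonneg n k)

theorem T_nonneg {g : ℕ → ℝ} (H : ∀ k, 0 ≤ g k) (n : ℕ) : 0 ≤ M.T g n :=
  Finset.sum_nonneg fun k _ => mul_nonneg (M.trans_nonneg n k) (H k)

theorem T_of_le {g : ℕ → ℝ} (h0 : g 0 = 0) {n : ℕ} (h : n ≤ M.s) : M.T g n = 0 := by
  rw [T_eq_sum_integral]
  simp [M.childSize_of_le h, h0]

/-- Given the splitters, the deviation is the centred multinomial count plus a term `s₁ - r * v i`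
bounded by `κ`; the former has variance at most the number of thrown balls. -/
theorem integral_sq_dev_le : ∃ C : ℝ, 1 ≤ C ∧ ∀ n, M.s < n → ∀ i : Fin b,
    Integrable (fun x : NodeSource b => ((M.childSize x n i : ℝ) - n * x.1 i) ^ 2) M.nodeLaw ∧
    ∫ x, ((M.childSize x n i : ℝ) - n * x.1 i) ^ 2 ∂M.nodeLaw ≤ C * n := by
  set r : ℝ := ((M.s₀ + b * M.s₁ : ℕ) : ℝ) with hr
  have hr0 : 0 ≤ r := Nat.cast_nonneg _
  set κ : ℝ := M.s₁ + r with hκ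
  have hκ0 : 0 ≤ κ := add_nonneg (Nat.cast_nonneg _) hr0
  refine ⟨2 + 2 * κ ^ 2, by nlinarith [sq_nonneg κ], fun n hn i => ?_⟩
  have hmeas : Measurable fun x : NodeSource b => ((M.childSize x n i : ℝ) - n * x.1 i) :=
    ((measurable_from_nat (f := fun k : ℕ => (k : ℝ))).comp (M.measurable_childSize n i)).sub
      (((measurable_pi_apply i).comp measurable_fst).const_mul _)
  have hle1 : ∀ v : Fin b → ℝ, ((∀ i, 0 ≤ v i) ∧ ∑ i, v i ≤ 1) → v i ≤ 1 := fun v hv =>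
    (Finset.single_le_sum (fun j _ => hv.1 j) (Finset.mem_univ i)).trans hv.2
  have hint : Integrable (fun x : NodeSource b => ((M.childSize x n i : ℝ) - n * x.1 i) ^ 2)
      M.nodeLaw := by
    refine Integrable.of_bound (C := (n : ℝ) ^ 2) (hmeas.pow_const 2).aestronglyMeasurable ?_
    filter_upwards [M.ae_nodeLaw_good] with x hx
    rw [Real.norm_eq_abs, abs_of_nonneg (sq_nonneg _)]
    have h1 : (M.childSize x n i : ℝ) ≤ n := by exact_mod_cast M.childSize_le x n i
    have h2 : (0 : ℝ) ≤ M.childSize x n i := Nat.cast_nonneg _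
    have h3 := hx.1 i
    have h4 := hle1 _ hx
    have h5 : (n : ℝ) * x.1 i ≤ n := mul_le_of_le_one_right (Nat.cast_nonneg _) h4
    have h6 : 0 ≤ (n : ℝ) * x.1 i := mul_nonneg (Nat.cast_nonneg _) h3
    exact sq_le_sq' (by linarith) (by linarith)
  refine ⟨hint, ?_⟩
  have hn1 : (1 : ℝ) ≤ n := by exact_mod_cast (by omega : 1 ≤ n)
  rw [nodeLaw_eq] at hint ⊢
  rw [integral_prod _ hint]
  have hthr : (M.thrown n : ℝ) = n - r := by
    rw [hr, eq_sub_iff_add_eq]; exact_mod_cast M.thrown_add_retained hn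
  calc ∫ v, ∫ y, ((M.childSize (v, y) n i : ℝ) - n * v i) ^ 2 ∂dirLaw ∂M.law
      ≤ ∫ _v, (2 + 2 * κ ^ 2) * n ∂M.law := by
        refine integral_mono_ae hint.integral_prod_left (integrable_const _) ?_
        filter_upwards [M.ae_law_good] with v hv
        have hint2 : Integrable (fun y : ℕ → unitInterval =>
            ((multCount (v, y) (M.thrown n) i : ℝ) - M.thrown n * v i) ^ 2) dirLaw := by
          refine integrable_comp_of_le (N := fun y => multCount (v, y) (M.thrown n) i)
            ((measurable_multCount _ i).comp measurable_prodMk_left)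
            (fun y => multCount_le _ _ i) (fun k => ((k : ℝ) - M.thrown n * v i) ^ 2)
        calc ∫ y, ((M.childSize (v, y) n i : ℝ) - n * v i) ^ 2 ∂dirLaw
            ≤ ∫ y, (2 * ((multCount (v, y) (M.thrown n) i : ℝ) - M.thrown n * v i) ^ 2
                + 2 * κ ^ 2) ∂dirLaw := by
              refine integral_mono_of_nonneg (ae_of_all _ fun y => sq_nonneg _)
                ((hint2.const_mul 2).add (integrable_const _)) (ae_of_all _ fun y => ?_)
              simp only [M.childSize_of_lt hn, Nat.cast_add]
              have e : (multCount (v, y) (M.thrown n) i : ℝ) + M.s₁ - n * v i =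
                  ((multCount (v, y) (M.thrown n) i : ℝ) - M.thrown n * v i)
                    + (M.s₁ - r * v i) := by rw [hthr]; ring
              rw [e]
              have h1 : 0 ≤ r * v i := mul_nonneg hr0 (hv.1 i)
              have h2 : r * v i ≤ r := mul_le_of_le_one_right hr0 (hle1 v hv)
              have h3 : (0 : ℝ) ≤ M.s₁ := Nat.cast_nonneg _
              have h4 : ((M.s₁ : ℝ) - r * v i) ^ 2 ≤ κ ^ 2 :=
                sq_le_sq' (by linarith) (by linarith)
              nlinarith [sq_nonneg (((multCount (v, y) (M.thrown n) i : ℝ) - M.thrown n * v i)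
                - (M.s₁ - r * v i))]
          _ ≤ 2 * M.thrown n + 2 * κ ^ 2 := by
              rw [integral_add (hint2.const_mul 2) (integrable_const _), integral_const_mul]
              have := integral_sq_multCount_sub_le hv.1 hv.2 i (M.thrown n)
              simp only [integral_const, probReal_univ, smul_eq_mul, one_mul]
              linarith
          _ ≤ (2 + 2 * κ ^ 2) * n := by
              rw [hthr]
              nlinarith [sq_nonneg κ]
    _ = (2 + 2 * κ ^ 2) * n := by simp

/-- Jensen's inequality with exponent `γ / 2` for the squared deviation. Since `C ≥ 1`, one constant
serves every `γ`, and the supersolution argument uses it for two exponents at once. -/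
theorem integral_rpow_dev_le : ∃ C : ℝ, 1 ≤ C ∧ ∀ γ : ℝ, 0 < γ → γ ≤ 1 → ∀ n, M.s < n →
    ∀ i : Fin b,
    Integrable (fun x : NodeSource b => |(M.childSize x n i : ℝ) - n * x.1 i| ^ γ) M.nodeLaw ∧
    ∫ x, |(M.childSize x n i : ℝ) - n * x.1 i| ^ γ ∂M.nodeLaw ≤ C * (n : ℝ) ^ (γ / 2) := by
  obtain ⟨C, hC1, hC⟩ := M.integral_sq_dev_le
  refine ⟨C, hC1, fun γ hγ hγ1 n hn i => ?_⟩
  obtain ⟨hi, hle⟩ := hC n hn i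
  have e : ∀ x : NodeSource b, |(M.childSize x n i : ℝ) - n * x.1 i| ^ γ =
      (((M.childSize x n i : ℝ) - n * x.1 i) ^ 2) ^ (γ / 2) := fun x => by
    rw [← sq_abs, ← Real.rpow_natCast, ← Real.rpow_mul (abs_nonneg _)]
    congr 1; push_cast; ring
  have hmeas : Measurable fun x : NodeSource b => ((M.childSize x n i : ℝ) - n * x.1 i) :=
    ((measurable_from_nat (f := fun k : ℕ => (k : ℝ))).comp (M.measurable_childSize n i)).sub
      (((measurable_pi_apply i).comp measurable_fst).const_mul _)
  have hint : Integrable (fun x : NodeSource b =>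
      (((M.childSize x n i : ℝ) - n * x.1 i) ^ 2) ^ (γ / 2)) M.nodeLaw := by
    refine (hi.add (integrable_const (1 : ℝ))).mono'
      ((hmeas.pow_const 2).pow_const _).aestronglyMeasurable (ae_of_all _ fun x => ?_)
    have h0 := sq_nonneg ((M.childSize x n i : ℝ) - n * x.1 i)
    rw [Real.norm_eq_abs, abs_of_nonneg (Real.rpow_nonneg h0 _)]
    simp only [Pi.add_apply]
    rcases le_total (((M.childSize x n i : ℝ) - n * x.1 i) ^ 2) 1 with h | h
    · have := Real.rpow_le_one h0 h (by positivity : 0 ≤ γ / 2)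
      linarith
    · have := Real.rpow_le_rpow_of_exponent_le h (by linarith : γ / 2 ≤ 1)
      rw [Real.rpow_one] at this
      linarith
  simp_rw [e]
  refine ⟨hint, ?_⟩
  calc ∫ x, (((M.childSize x n i : ℝ) - n * x.1 i) ^ 2) ^ (γ / 2) ∂M.nodeLaw
      ≤ (∫ x, ((M.childSize x n i : ℝ) - n * x.1 i) ^ 2 ∂M.nodeLaw) ^ (γ / 2) :=
        integral_rpow_le_rpow_integral (by positivity) (by linarith)
          (ae_of_all _ fun x => sq_nonneg _) hi hint
    _ ≤ (C * n) ^ (γ / 2) := Real.rpow_le_rpow (integral_nonneg fun x => sq_nonneg _) hle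
        (by positivity)
    _ = C ^ (γ / 2) * (n : ℝ) ^ (γ / 2) := Real.mul_rpow (by linarith) (Nat.cast_nonneg _)
    _ ≤ C * (n : ℝ) ^ (γ / 2) := by
      refine mul_le_mul_of_nonneg_right ?_ (Real.rpow_nonneg (Nat.cast_nonneg _) _)
      have := Real.rpow_le_rpow_of_exponent_le hC1 (by linarith : γ / 2 ≤ 1)
      rwa [Real.rpow_one] at this

/-- The coupling: with common splitters and directing numbers, the two nodes differ only by the last
`D` thrown balls. -/
theorem childSize_add_sub {n : ℕ} (hn : M.s < n) (D : ℕ) (x : NodeSource b) (i : Fin b) :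
    (M.childSize x (n + D) i : ℝ) - M.childSize x n i =
      ∑ j ∈ Finset.Ico (M.thrown n) (M.thrown n + D), ballInd x.1 i (x.2 j) := by
  have h : M.thrown (n + D) = M.thrown n + D := by
    have h1 := M.thrown_add_retained hn
    have h2 := M.thrown_add_retained (show M.s < n + D by omega)
    omega
  rw [M.childSize_of_lt hn, M.childSize_of_lt (by omega), h, ← multCount_add_sub]
  push_cast; ring

theorem childSize_le_add {n : ℕ} (hn : M.s < n) (D : ℕ) (x : NodeSource b) (i : Fin b) :
    (M.childSize x n i : ℝ) ≤ M.childSize x (n + D) i := by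
  have := M.childSize_add_sub hn D x i
  have h2 : 0 ≤ ∑ j ∈ Finset.Ico (M.thrown n) (M.thrown n + D), ballInd x.1 i (x.2 j) :=
    Finset.sum_nonneg fun _ _ => ballInd_nonneg _ _ _
  linarith

theorem integrable_sum_rpow {γ : ℝ} (hγ : 0 < γ) :
    Integrable (fun v : Fin b → ℝ => ∑ i, v i ^ γ) M.law := by
  refine integrable_finsetSum _ fun i _ => ?_
  refine Integrable.of_bound (C := 1)
    ((measurable_pi_apply i).pow_const γ).aestronglyMeasurable ?_
  filter_upwards [M.ae_law_good] with v hv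
  rw [Real.norm_eq_abs, abs_of_nonneg (Real.rpow_nonneg (hv.1 i) _)]
  exact Real.rpow_le_one (hv.1 i)
    ((Finset.single_le_sum (fun j _ => hv.1 j) (Finset.mem_univ i)).trans hv.2) hγ.le

/-- Given the splitters, the increment of child `i` has mean `D * v i`, so concavity bounds its
`β`-moment by `(D * v i) ^ β`; the Malthusian equation sums these to `D ^ β`. The constant `1` is
essential, since the estimate is iterated along the tree. -/
theorem sum_integral_rpow_incr_le {β : ℝ} (hβ : M.IsMalthusian β) {n : ℕ} (hn : M.s < n) (D : ℕ) :
    (∀ i : Fin b, Integrable (fun x : NodeSource b =>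
      ((M.childSize x (n + D) i : ℝ) - M.childSize x n i) ^ β) M.nodeLaw) ∧
    ∑ i : Fin b, ∫ x, ((M.childSize x (n + D) i : ℝ) - M.childSize x n i) ^ β ∂M.nodeLaw
      ≤ (D : ℝ) ^ β := by
  obtain ⟨h0, h1, hint1⟩ := hβ
  have hmeas : ∀ i : Fin b, Measurable fun x : NodeSource b =>
      ((M.childSize x (n + D) i : ℝ) - M.childSize x n i) ^ β := fun i =>
    (((measurable_from_nat (f := fun k : ℕ => (k : ℝ))).comp (M.measurable_childSize _ i)).sub
      ((measurable_from_nat (f := fun k : ℕ => (k : ℝ))).comp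
        (M.measurable_childSize _ i))).pow_const β
  have hsumle : ∀ (x : NodeSource b) i,
      ∑ j ∈ Finset.Ico (M.thrown n) (M.thrown n + D), ballInd x.1 i (x.2 j) ≤ D := fun x i => by
    calc ∑ j ∈ Finset.Ico (M.thrown n) (M.thrown n + D), ballInd x.1 i (x.2 j)
        ≤ ∑ j ∈ Finset.Ico (M.thrown n) (M.thrown n + D), (1 : ℝ) :=
          Finset.sum_le_sum fun _ _ => ballInd_le_one _ _ _
      _ = D := by simp
  have hbd : ∀ (x : NodeSource b) i,
      ‖((M.childSize x (n + D) i : ℝ) - M.childSize x n i) ^ β‖ ≤ (D : ℝ) ^ β := fun x i => by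
    have h2 := sub_nonneg.2 (M.childSize_le_add hn D x i)
    rw [Real.norm_eq_abs, abs_of_nonneg (Real.rpow_nonneg h2 _)]
    refine Real.rpow_le_rpow h2 ?_ h0.le
    rw [M.childSize_add_sub hn]
    exact hsumle x i
  have hint : ∀ i : Fin b, Integrable (fun x : NodeSource b =>
      ((M.childSize x (n + D) i : ℝ) - M.childSize x n i) ^ β) M.nodeLaw := fun i =>
    Integrable.of_bound (hmeas i).aestronglyMeasurable _ (ae_of_all _ fun x => hbd x i)
  refine ⟨hint, ?_⟩
  have hvint : ∀ i : Fin b, Integrable (fun v : Fin b → ℝ => (D * v i) ^ β) M.law := fun i => by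
    refine Integrable.of_bound (C := (D : ℝ) ^ β)
      (((measurable_pi_apply i).const_mul _).pow_const β).aestronglyMeasurable ?_
    filter_upwards [M.ae_law_good] with v hv
    have h3 := mul_nonneg (Nat.cast_nonneg (α := ℝ) D) (hv.1 i)
    rw [Real.norm_eq_abs, abs_of_nonneg (Real.rpow_nonneg h3 _)]
    exact Real.rpow_le_rpow h3 (mul_le_of_le_one_right (Nat.cast_nonneg _)
      ((Finset.single_le_sum (fun j _ => hv.1 j) (Finset.mem_univ i)).trans hv.2)) h0.le
  have key : ∀ i : Fin b,
      ∫ x, ((M.childSize x (n + D) i : ℝ) - M.childSize x n i) ^ β ∂M.nodeLaw ≤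
        ∫ v, (D * v i) ^ β ∂M.law := fun i => by
    have hi := hint i
    rw [nodeLaw_eq] at hi ⊢
    rw [integral_prod _ hi]
    refine integral_mono_ae hi.integral_prod_left (hvint i) ?_
    filter_upwards [M.ae_law_good] with v hv
    have hm : Measurable fun y : ℕ → unitInterval =>
        ∑ j ∈ Finset.Ico (M.thrown n) (M.thrown n + D), ballInd v i (y j) :=
      Finset.measurable_sum _ fun j _ => (measurable_ballInd v i).comp (measurable_pi_apply j)
    have hnn : ∀ y : ℕ → unitInterval,
        0 ≤ ∑ j ∈ Finset.Ico (M.thrown n) (M.thrown n + D), ballInd v i (y j) := fun y =>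
      Finset.sum_nonneg fun _ _ => ballInd_nonneg _ _ _
    simp only [M.childSize_add_sub hn]
    have e := integral_sum_ballInd hv.1 hv.2 i (Finset.Ico (M.thrown n) (M.thrown n + D))
    rw [Nat.card_Ico, Nat.add_sub_cancel_left] at e
    rw [← e]
    refine integral_rpow_le_rpow_integral h0.le h1 (ae_of_all _ hnn)
      (integrable_finsetSum _ fun j _ => integrable_ballInd_eval v i j) ?_
    refine Integrable.of_bound (C := (D : ℝ) ^ β) (hm.pow_const β).aestronglyMeasurable
      (ae_of_all _ fun y => ?_)
    rw [Real.norm_eq_abs, abs_of_nonneg (Real.rpow_nonneg (hnn y) _)]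
    exact Real.rpow_le_rpow (hnn y) (hsumle (v, y) i) h0.le
  calc _ ≤ ∑ i : Fin b, ∫ v, (D * v i) ^ β ∂M.law := Finset.sum_le_sum fun i _ => key i
    _ = ∫ v, ∑ i : Fin b, (D * v i) ^ β ∂M.law := (integral_finsetSum _ fun i _ => hvint i).symm
    _ = ∫ v, (D : ℝ) ^ β * ∑ i : Fin b, v i ^ β ∂M.law := by
      refine integral_congr_ae ?_
      filter_upwards [M.ae_law_good] with v hv
      simp only [Finset.mul_sum]
      exact Finset.sum_congr rfl fun i _ => Real.mul_rpow (Nat.cast_nonneg _) (hv.1 i)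
    _ = (D : ℝ) ^ β := by rw [integral_const_mul, hint1, mul_one]

/-- With positive probability all splitters lie strictly between `0` and `1`. -/
theorem exists_pos_set : 0 < M.law {v | ∀ i, 0 < v i ∧ v i < 1} := by
  refine M.min_pos.trans_le (measure_mono_ae ?_)
  filter_upwards [M.ae_law_good] with v hv hpos i
  refine ⟨hpos i, ?_⟩
  have hb := M.two_le_arity
  -- A second positive splitter keeps `v i` below `1`.
  obtain ⟨j, hj⟩ : ∃ j : Fin b, j ≠ i := by
    have : Nontrivial (Fin b) := Fin.nontrivial_iff_two_le.2 hb
    exact exists_ne i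
  have h1 : v i + v j ≤ ∑ l, v l := by
    rw [← Finset.sum_pair hj.symm]
    exact Finset.sum_le_sum_of_subset_of_nonneg (Finset.subset_univ _) fun l _ _ => hv.1 l
  have := hpos j
  linarith [hv.2]

theorem integral_lt_of_lt_on_pos {F G : (Fin b → ℝ) → ℝ} (hF : Integrable F M.law)
    (hG : Integrable G M.law) (hle : ∀ᵐ v ∂M.law, F v ≤ G v)
    (hlt : ∀ v, ∑ i, v i ≤ 1 → (∀ i, 0 < v i ∧ v i < 1) → F v < G v) :
    ∫ v, F v ∂M.law < ∫ v, G v ∂M.law := by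
  have h0 : 0 < ∫ v, (G - F) v ∂M.law := by
    rw [integral_pos_iff_support_of_nonneg_ae (by
      filter_upwards [hle] with v hv; exact sub_nonneg.2 hv) (hG.sub hF)]
    refine M.exists_pos_set.trans_le (measure_mono_ae ?_)
    filter_upwards [M.sum_le_one] with v hv hpos
    exact (sub_pos.2 (hlt v hv hpos)).ne'
  simp only [Pi.sub_apply] at h0
  rw [integral_sub hG hF] at h0
  linarith

/-- On `[0, 1]` lowering the exponent increases the power, strictly on the event of
`exists_pos_set`. The excess over `1` is the gain that drives the supersolution. -/
theorem one_lt_integral_sum_rpow {β γ : ℝ} (hβ : M.IsMalthusian β) (hγ : 0 < γ) (hγβ : γ < β) :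
    1 < ∫ v, ∑ i, v i ^ γ ∂M.law := by
  obtain ⟨h0, h1, hint1⟩ := hβ
  rw [← hint1]
  refine M.integral_lt_of_lt_on_pos (M.integrable_sum_rpow h0) (M.integrable_sum_rpow hγ) ?_ ?_
  · filter_upwards [M.ae_law_good] with v hv
    refine Finset.sum_le_sum fun i _ => ?_
    have h1 := (Finset.single_le_sum (fun j _ => hv.1 j) (Finset.mem_univ i)).trans hv.2
    rcases (hv.1 i).eq_or_lt with h | h
    · rw [← h, Real.zero_rpow h0.ne', Real.zero_rpow hγ.ne']
    · exact Real.rpow_le_rpow_of_exponent_ge h h1 hγβ.le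
  · intro v _ hv
    have hb := M.two_le_arity
    exact Finset.sum_lt_sum_of_nonempty ⟨⟨0, by omega⟩, Finset.mem_univ _⟩ fun i _ =>
      Real.rpow_lt_rpow_of_exponent_gt (hv i).1 (hv i).2 hγβ

/-- A node can pass all its balls to one child only if `s₀ = s₁ = 0`. Then `n > s ≥ 1` means that at
least two balls are thrown, and the probability that all land in one child is at most `E ∑ V_i ^ 2 <
1`. -/
theorem trans_self_lt_one {n : ℕ} (hn : 1 ≤ n) : M.trans n n < 1 := by
  unfold trans
  rcases lt_or_ge M.s n with h | h
  swap
  · have : ∀ i : Fin b, {x : NodeSource b | M.childSize x n i = n} = ∅ := fun i => by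
      ext x; simp [M.childSize_of_le h]; omega
    simp [this]
  have hb := M.two_le_arity
  have hthr := M.thrown_add_retained h
  have hs := M.one_le_s
  rcases Nat.eq_zero_or_pos (M.s₀ + M.s₁) with hz | hz
  swap
  · have : ∀ i : Fin b, {x : NodeSource b | M.childSize x n i = n} = ∅ := fun i => by
      ext x
      simp only [Set.mem_ofPred_eq, Set.mem_empty_iff_false, iff_false, M.childSize_of_lt h]
      have h1 := multCount_le x (M.thrown n) i
      have h3 := M.s₁_le
      omega
    simp [this]
  have hs0 : M.s₀ = 0 := by omega
  have hs1 : M.s₁ = 0 := by omega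
  have hn' : M.thrown n = n := by simpa [hs0, hs1] using hthr
  have hsq : ∀ i : Fin b, Integrable (fun v : Fin b → ℝ => v i ^ 2) M.law := fun i => by
    refine Integrable.of_bound (C := 1) ((measurable_pi_apply i).pow_const 2).aestronglyMeasurable ?_
    filter_upwards [M.ae_law_good] with v hv
    rw [Real.norm_eq_abs, abs_of_nonneg (sq_nonneg _)]
    exact pow_le_one₀ (hv.1 i)
      ((Finset.single_le_sum (fun j _ => hv.1 j) (Finset.mem_univ i)).trans hv.2)
  have key : ∀ i : Fin b, M.nodeLaw.real {x | M.childSize x n i = n} ≤ ∫ v, v i ^ 2 ∂M.law := by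
    intro i
    have hms : MeasurableSet {x : NodeSource b | M.childSize x n i = n} :=
      M.measurable_childSize n i (measurableSet_singleton n)
    have e : M.nodeLaw.real {x | M.childSize x n i = n} =
        ∫ x, Set.indicator {x | M.childSize x n i = n} (1 : NodeSource b → ℝ) x ∂M.nodeLaw := by
      rw [integral_indicator_one hms]
    have hi : Integrable (Set.indicator {x | M.childSize x n i = n} (1 : NodeSource b → ℝ))
        M.nodeLaw := (integrable_const (1 : ℝ)).indicator hms
    rw [e]
    rw [nodeLaw_eq] at hi ⊢
    rw [integral_prod _ hi]
    refine integral_mono_ae hi.integral_prod_left (hsq i) ?_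
    filter_upwards [M.ae_law_good] with v hv
    have e2 : ∀ y, Set.indicator {x | M.childSize x n i = n} (1 : NodeSource b → ℝ) (v, y) =
        Set.indicator {y | multCount (v, y) n i = n} (1 : (ℕ → unitInterval) → ℝ) y := fun y => by
      classical
      simp [Set.indicator_apply, M.childSize_of_lt h, hn', hs1]
    simp only [e2]
    have hms2 : MeasurableSet {y : ℕ → unitInterval | multCount (v, y) n i = n} :=
      ((measurable_multCount n i).comp measurable_prodMk_left) (measurableSet_singleton n)
    rw [integral_indicator_one hms2]
    exact dirLaw_two_balls_le hv.1 hv.2 i (by omega)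
  calc ∑ i, M.nodeLaw.real {x | M.childSize x n i = n}
      ≤ ∑ i : Fin b, ∫ v, v i ^ 2 ∂M.law := Finset.sum_le_sum fun i _ => key i
    _ = ∫ v, ∑ i : Fin b, v i ^ 2 ∂M.law := (integral_finsetSum _ fun i _ => hsq i).symm
    _ < ∫ _v, 1 ∂M.law := by
      refine M.integral_lt_of_lt_on_pos (integrable_finsetSum _ fun i _ => hsq i)
        (integrable_const _) ?_ ?_
      · filter_upwards [M.ae_law_good] with v hv
        refine le_trans (Finset.sum_le_sum fun i _ => ?_) hv.2
        have := (Finset.single_le_sum (fun j _ => hv.1 j) (Finset.mem_univ i)).trans hv.2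
        nlinarith [hv.1 i]
      · intro v hv hpos
        refine lt_of_lt_of_le (Finset.sum_lt_sum_of_nonempty
          ⟨⟨0, by omega⟩, Finset.mem_univ _⟩ fun i _ => ?_) hv
        nlinarith [(hpos i).1, (hpos i).2]
    _ = 1 := by simp

end Model

theorem tendsto_natCast_rpow_neg {p : ℝ} (hp : 0 < p) :
    Tendsto (fun n : ℕ => (n : ℝ) ^ (-p)) atTop (𝓝 0) :=
  (tendsto_rpow_neg_atTop hp).comp tendsto_natCast_atTop_atTop

theorem natCast_rpow_isLittleO {p q : ℝ} (h : p < q) :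
    (fun n : ℕ => (n : ℝ) ^ p) =o[atTop] fun n : ℕ => (n : ℝ) ^ q := by
  have hev : ∀ᶠ n : ℕ in atTop, (0 : ℝ) < n := by
    filter_upwards [eventually_gt_atTop 0] with n hn; exact_mod_cast hn
  refine (isLittleO_iff_tendsto' ?_).2 ?_
  · filter_upwards [hev] with n hn h0
    exact absurd h0 (Real.rpow_pos_of_pos hn _).ne'
  · refine (tendsto_natCast_rpow_neg (sub_pos.2 h)).congr' ?_
    filter_upwards [hev] with n hn
    rw [neg_sub, Real.rpow_sub hn]

/-! ### Sums of powers of the transition operator and their growth. -/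

namespace Model

variable {b : ℕ} (M : Model b)

/-- The sum of the first `L` powers of the transition operator, applied to `g`. -/
def R : ℕ → (ℕ → ℝ) → ℕ → ℝ
  | 0, _, _ => 0
  | L + 1, g, n => g n + M.T (R L g) n

@[simp] theorem R_zero (g : ℕ → ℝ) (n : ℕ) : M.R 0 g n = 0 := rfl

theorem R_succ (L : ℕ) (g : ℕ → ℝ) (n : ℕ) : M.R (L + 1) g n = g n + M.T (M.R L g) n := rfl

theorem R_nonneg {g : ℕ → ℝ} (hg : ∀ n, 0 ≤ g n) (L n : ℕ) : 0 ≤ M.R L g n := by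
  induction L generalizing n with
  | zero => exact le_rfl
  | succ L ih => exact add_nonneg (hg n) (M.T_nonneg ih n)

theorem R_mono {g h : ℕ → ℝ} (H : ∀ n, g n ≤ h n) (L n : ℕ) : M.R L g n ≤ M.R L h n := by
  induction L generalizing n with
  | zero => exact le_rfl
  | succ L ih => exact add_le_add (H n) (M.T_mono fun k _ => ih k)

theorem R_mono_left {g : ℕ → ℝ} (hg : ∀ n, 0 ≤ g n) (n : ℕ) : Monotone fun L => M.R L g n := by
  refine monotone_nat_of_le_succ fun L => ?_
  induction L generalizing n with
  | zero => exact M.R_nonneg hg 1 n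
  | succ L ih => exact add_le_add le_rfl (M.T_mono fun k _ => ih k)

theorem R_at_zero {g : ℕ → ℝ} (hg : g 0 = 0) (L : ℕ) : M.R L g 0 = 0 := by
  induction L with
  | zero => rfl
  | succ L ih => rw [R_succ, hg, zero_add, M.T_of_le ih (Nat.zero_le _)]

/-- Strong induction on `n`: with `p = M.trans n n`, monotonicity in `L` turns the recursion into `x
≤ c + p * x`, where `c` involves smaller sizes only, and `p < 1`. -/
theorem R_bounded {g : ℕ → ℝ} (hg : ∀ n, 0 ≤ g n) (hg0 : g 0 = 0) (n : ℕ) :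
    ∃ K, ∀ L, M.R L g n ≤ K := by
  induction n using Nat.strong_induction_on with
  | _ n ih =>
    rcases Nat.eq_zero_or_pos n with rfl | hn
    · exact ⟨0, fun L => (M.R_at_zero hg0 L).le⟩
    choose! K hK using ih
    have hp := M.trans_self_lt_one hn
    set c := g n + ∑ k ∈ Finset.range n, M.trans n k * K k with hc
    refine ⟨c / (1 - M.trans n n), fun L => ?_⟩
    rw [le_div_iff₀ (by linarith)]
    have h1 : M.R (L + 1) g n ≤ c + M.trans n n * M.R L g n := by
      rw [R_succ, T, Finset.sum_range_succ, hc, add_assoc]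
      gcongr with k hk
      · exact M.trans_nonneg n k
      · exact hK k (Finset.mem_range.1 hk) L
    have h2 := M.R_mono_left hg n (Nat.le_succ L)
    simp only at h2
    nlinarith

/-- The power `n ^ γ`, as a function of the number of balls. -/
def powFun (γ : ℝ) (n : ℕ) : ℝ := (n : ℝ) ^ γ

theorem powFun_nonneg (γ : ℝ) (n : ℕ) : 0 ≤ powFun γ n := Real.rpow_nonneg (Nat.cast_nonneg _) _

theorem powFun_zero {γ : ℝ} (hγ : 0 < γ) : powFun γ 0 = 0 := by
  simp [powFun, Real.zero_rpow hγ.ne']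

/-- Replacing a child size by `n * V_i` costs at most the `γ`-moment of the deviation, by
subadditivity of `x ^ γ`; after the replacement the power is an exact eigenfunction. -/
theorem abs_T_powFun_sub_le : ∃ C : ℝ, 0 ≤ C ∧ ∀ γ : ℝ, 0 < γ → γ ≤ 1 → ∀ n, M.s < n →
    |M.T (powFun γ) n - (∫ v, ∑ i, v i ^ γ ∂M.law) * (n : ℝ) ^ γ| ≤ C * (n : ℝ) ^ (γ / 2) := by
  obtain ⟨C, hC1, hC⟩ := M.integral_rpow_dev_le
  refine ⟨b * C, by positivity, fun γ hγ hγ1 n hn => ?_⟩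
  have hvi : ∀ i : Fin b, Integrable (fun x : NodeSource b => (n * x.1 i) ^ γ) M.nodeLaw := by
    intro i
    refine Integrable.of_bound (C := (n : ℝ) ^ γ)
      ((((measurable_pi_apply i).comp measurable_fst).const_mul _).pow_const γ).aestronglyMeasurable
      ?_
    filter_upwards [M.ae_nodeLaw_good] with x hx
    have h3 := mul_nonneg (Nat.cast_nonneg (α := ℝ) n) (hx.1 i)
    rw [Real.norm_eq_abs, abs_of_nonneg (Real.rpow_nonneg h3 _)]
    exact Real.rpow_le_rpow h3 (mul_le_of_le_one_right (Nat.cast_nonneg _)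
      ((Finset.single_le_sum (fun j _ => hx.1 j) (Finset.mem_univ i)).trans hx.2)) hγ.le
  have e : (∫ v, ∑ i, v i ^ γ ∂M.law) * (n : ℝ) ^ γ =
      ∑ i : Fin b, ∫ x, (n * x.1 i) ^ γ ∂M.nodeLaw := by
    rw [← integral_finsetSum _ fun i _ => hvi i,
      M.integral_fst_nodeLaw fun v => ∑ i, ((n : ℝ) * v i) ^ γ, ← integral_mul_const]
    refine integral_congr_ae ?_
    filter_upwards [M.ae_law_good] with v hv
    rw [Finset.sum_mul]
    exact Finset.sum_congr rfl fun i _ => by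
      rw [Real.mul_rpow (Nat.cast_nonneg _) (hv.1 i), mul_comm]
  rw [T_eq_sum_integral, e, ← Finset.sum_sub_distrib]
  refine (Finset.abs_sum_le_sum_abs _ _).trans ?_
  calc ∑ i : Fin b, |∫ x, powFun γ (M.childSize x n i) ∂M.nodeLaw - ∫ x, (n * x.1 i) ^ γ ∂M.nodeLaw|
      ≤ ∑ _i : Fin b, C * (n : ℝ) ^ (γ / 2) := by
        refine Finset.sum_le_sum fun i _ => ?_
        rw [← integral_sub (M.integrable_childSize _ n i) (hvi i)]
        refine abs_integral_le_integral_abs.trans (le_trans ?_ (hC γ hγ hγ1 n hn i).2)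
        refine integral_mono_ae ((M.integrable_childSize _ n i).sub (hvi i)).abs
          (hC γ hγ hγ1 n hn i).1 ?_
        filter_upwards [M.ae_nodeLaw_good] with x hx
        exact abs_rpow_sub_rpow_le (Nat.cast_nonneg _)
          (mul_nonneg (Nat.cast_nonneg _) (hx.1 i)) hγ.le hγ1
    _ = b * C * (n : ℝ) ^ (γ / 2) := by simp; ring

theorem T_sub_smul (a c : ℝ) (g h : ℕ → ℝ) (n : ℕ) :
    M.T (fun k => a * g k - c * h k) n = a * M.T g n - c * M.T h n := by
  simp only [T, Finset.mul_sum, ← Finset.sum_sub_distrib]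
  exact Finset.sum_congr rfl fun k _ => by ring

/-- A supersolution argument with `2 * B * n ^ β - B * n ^ γ`. -/
theorem R_powFun_le {β γ : ℝ} (hβ : M.IsMalthusian β) (hγ : β / 2 < γ) (hγβ : γ < β) :
    ∃ A : ℝ, 0 ≤ A ∧ ∀ L n, M.R L (powFun γ) n ≤ A * (n : ℝ) ^ β := by
  have hβ0 : 0 < β := hβ.1
  have hβ1 : β ≤ 1 := hβ.2.1
  have hγ0 : 0 < γ := by linarith
  obtain ⟨C, hC0, hC⟩ := M.abs_T_powFun_sub_le
  set c := ∫ v, ∑ i, v i ^ γ ∂M.law with hc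
  have hc1 : 1 < c := M.one_lt_integral_sum_rpow hβ hγ0 hγβ
  have hlit : (fun n : ℕ => (n : ℝ) ^ (β / 2)) =o[atTop] fun n : ℕ => (n : ℝ) ^ γ :=
    natCast_rpow_isLittleO hγ
  -- The errors of `T` on the two powers add up to at most `3 * B * C * n ^ (β / 2)`. The factor `6`
  -- makes this at most half of the gain `B * (c - 1) * n ^ γ` for large `n`.
  have hε : 0 < (c - 1) / (6 * (C + 1)) := by
    have : 0 < c - 1 := by linarith
    positivity
  obtain ⟨n0, hn0⟩ := eventually_atTop.1 (hlit.def hε)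
  choose K hK using fun n => M.R_bounded (powFun_nonneg γ) (powFun_zero hγ0) n
  set N := max n0 (M.s + 1) with hN
  -- The first entry lets the other half of the gain pay for the toll `n ^ γ`; the second makes the
  -- bound hold for the finitely many `n < N`.
  set B := max (2 / (c - 1)) (∑ k ∈ Finset.range N, |K k|) with hB
  have hBpos : 0 < B := lt_of_lt_of_le (by have : 0 < c - 1 := by linarith
                                           positivity) (le_max_left _ _)
  have hBc : 2 ≤ B * (c - 1) := by
    have := le_max_left (2 / (c - 1)) (∑ k ∈ Finset.range N, |K k|)
    rwa [div_le_iff₀ (by linarith)] at this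
  have hpow : ∀ n : ℕ, 1 ≤ n → (n : ℝ) ^ γ ≤ (n : ℝ) ^ β := fun n hn =>
    Real.rpow_le_rpow_of_exponent_le (by exact_mod_cast hn) hγβ.le
  have main : ∀ L n, M.R L (powFun γ) n ≤ 2 * B * powFun β n - B * powFun γ n := by
    intro L
    induction L with
    | zero =>
      intro n
      rcases Nat.eq_zero_or_pos n with rfl | hn
      · simp [powFun_zero hβ0, powFun_zero hγ0]
      · have := hpow n hn
        have h2 := powFun_nonneg β n
        simp only [R_zero, powFun] at *
        nlinarith
    | succ L ih =>
      intro n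
      rcases Nat.eq_zero_or_pos n with rfl | hn
      · simp [powFun_zero hβ0, powFun_zero hγ0, M.R_at_zero (powFun_zero hγ0)]
      rcases lt_or_ge n N with hnN | hnN
      · have h1 : K n ≤ B := (le_abs_self _).trans
          ((Finset.single_le_sum (f := fun k => |K k|) (fun _ _ => abs_nonneg _)
            (Finset.mem_range.2 hnN)).trans (le_max_right _ _))
        have h2 : (1 : ℝ) ≤ (n : ℝ) ^ β := Real.one_le_rpow (by exact_mod_cast hn) hβ0.le
        have h3 := hpow n hn
        have h4 := hK n (L + 1)
        simp only [powFun] at *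
        nlinarith
      · have hs : M.s < n := lt_of_lt_of_le (Nat.lt_succ_self _) ((le_max_right _ _).trans hnN)
        have h1 := hn0 n ((le_max_left _ _).trans hnN)
        have h2 := M.T_mono (n := n) fun k _ => ih k
        rw [T_sub_smul] at h2
        have h3 := (abs_le.1 (hC β hβ0 hβ1 n hs)).2
        have h4 := (abs_le.1 (hC γ hγ0 (by linarith) n hs)).1
        rw [hβ.2.2, one_mul] at h3
        rw [← hc] at h4
        change _ ≤ 2 * B * M.T (powFun β) n - B * M.T (powFun γ) n at h2
        have h5 : (n : ℝ) ^ (γ / 2) ≤ (n : ℝ) ^ (β / 2) :=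
          Real.rpow_le_rpow_of_exponent_le (by exact_mod_cast hn) (by linarith)
        have hX : 0 ≤ (n : ℝ) ^ (β / 2) := Real.rpow_nonneg (Nat.cast_nonneg _) _
        have hY : 0 ≤ (n : ℝ) ^ γ := Real.rpow_nonneg (Nat.cast_nonneg _) _
        rw [Real.norm_eq_abs, Real.norm_eq_abs, abs_of_nonneg hX, abs_of_nonneg hY] at h1
        have h6 : 6 * (C + 1) * (n : ℝ) ^ (β / 2) ≤ (c - 1) * (n : ℝ) ^ γ := by
          rw [div_mul_eq_mul_div, le_div_iff₀ (by positivity)] at h1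
          linarith
        rw [R_succ]
        set X := (n : ℝ) ^ (β / 2)
        set Y := (n : ℝ) ^ γ
        set Z := (n : ℝ) ^ β
        have h7 : C * (n : ℝ) ^ (γ / 2) ≤ C * X := mul_le_mul_of_nonneg_left h5 hC0
        have h8 : M.T (powFun β) n ≤ Z + C * X := by linarith
        have h9 : c * Y - C * X ≤ M.T (powFun γ) n := by linarith
        have h10 : M.T (M.R L (powFun γ)) n ≤ 2 * B * (Z + C * X) - B * (c * Y - C * X) := by
          have a1 := mul_le_mul_of_nonneg_left h8 (by positivity : 0 ≤ 2 * B)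
          have a2 := mul_le_mul_of_nonneg_left h9 hBpos.le
          linarith
        change Y + M.T (M.R L (powFun γ)) n ≤ 2 * B * Z - B * Y
        have h11 : 3 * C * X ≤ (c - 1) * Y / 2 := by nlinarith
        have h12 := mul_le_mul_of_nonneg_left h11 hBpos.le
        have h13 := mul_le_mul_of_nonneg_right hBc hY
        nlinarith
  refine ⟨2 * B, by positivity, fun L n => (main L n).trans ?_⟩
  have := mul_nonneg hBpos.le (powFun_nonneg γ n)
  simp only [powFun] at *
  linarith

/-- The indicator of `k`. -/
def unit (k n : ℕ) : ℝ := if n = k then 1 else 0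

theorem unit_nonneg (k n : ℕ) : 0 ≤ unit k n := by unfold unit; split_ifs <;> norm_num

/-- The unit toll is dominated by `n ^ γ`; the exponent `3 * β / 4` is just some point between `β /
2` and `β`. -/
theorem R_unit_le {β : ℝ} (hβ : M.IsMalthusian β) {k : ℕ} (hk : 1 ≤ k) :
    ∃ A : ℝ, 0 ≤ A ∧ ∀ L n, M.R L (unit k) n ≤ A * (n : ℝ) ^ β := by
  have hβ0 := hβ.1
  obtain ⟨A, hA0, hA⟩ := M.R_powFun_le hβ (γ := 3 * β / 4) (by linarith) (by linarith)
  refine ⟨A, hA0, fun L n => le_trans (M.R_mono (fun j => ?_) L n) (hA L n)⟩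
  unfold unit
  split_ifs with h
  · exact Real.one_le_rpow (by exact_mod_cast h ▸ hk) (by linarith)
  · exact powFun_nonneg _ _

/-- Induction on `L`. For `n > N` the unit toll vanishes at both sizes and the coupling reproduces
the constant `C`. For `n ≤ N` and `D ≥ 1` both sizes are at most `(N + 1) * D`, so the growth bound
suffices. -/
theorem abs_R_unit_sub_le {β : ℝ} (hβ : M.IsMalthusian β) {k : ℕ} (hk : 1 ≤ k) :
    ∃ C : ℝ, 0 ≤ C ∧ ∀ L n D,
      |M.R L (unit k) (n + D) - M.R L (unit k) n| ≤ C * (D : ℝ) ^ β := by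
  have hβ0 := hβ.1
  obtain ⟨A, hA0, hA⟩ := M.R_unit_le hβ hk
  set N := max M.s k with hN
  refine ⟨A * ((N + 1 : ℕ) : ℝ) ^ β, by positivity, fun L => ?_⟩
  induction L with
  | zero => intro n D; simp only [R_zero, sub_zero, abs_zero]; positivity
  | succ L ih =>
    intro n D
    rcases Nat.eq_zero_or_pos D with rfl | hD
    · simp [Real.zero_rpow hβ0.ne']
    rcases le_or_gt n N with hn | hn
    · have hle : ∀ m, m ≤ n + D → M.R (L + 1) (unit k) m ≤ A * ((N + 1 : ℕ) : ℝ) ^ β * (D : ℝ) ^ β := by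
        intro m hm
        rw [mul_assoc, ← Real.mul_rpow (Nat.cast_nonneg _) (Nat.cast_nonneg _)]
        refine (hA _ m).trans (mul_le_mul_of_nonneg_left
          (Real.rpow_le_rpow (Nat.cast_nonneg _) ?_ hβ0.le) hA0)
        have : m ≤ (N + 1) * D := by nlinarith
        exact_mod_cast this
      have h1 := M.R_nonneg (unit_nonneg k) (L + 1) n
      have h2 := M.R_nonneg (unit_nonneg k) (L + 1) (n + D)
      have h3 := hle n (by omega)
      have h4 := hle (n + D) le_rfl
      rw [abs_le]; constructor <;> linarith
    · have hs : M.s < n := lt_of_le_of_lt (le_max_left _ _) hn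
      have hkn : k < n := lt_of_le_of_lt (le_max_right _ _) hn
      have e1 : unit k n = 0 := if_neg hkn.ne'
      have e2 : unit k (n + D) = 0 := if_neg (by omega)
      obtain ⟨hi, hle⟩ := M.sum_integral_rpow_incr_le hβ hs D
      set C := A * ((N + 1 : ℕ) : ℝ) ^ β with hC
      have hC0 : 0 ≤ C := by positivity
      rw [R_succ, R_succ, e1, e2, zero_add, zero_add, T_eq_sum_integral, T_eq_sum_integral,
        ← Finset.sum_sub_distrib]
      refine (Finset.abs_sum_le_sum_abs _ _).trans ?_
      refine le_trans (Finset.sum_le_sum fun i _ => ?_)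
        ((Finset.mul_sum _ _ _).symm.le.trans (mul_le_mul_of_nonneg_left hle hC0))
      rw [← integral_sub (M.integrable_childSize _ _ i) (M.integrable_childSize _ _ i),
        ← integral_const_mul]
      refine abs_integral_le_integral_abs.trans (integral_mono
        ((M.integrable_childSize _ _ i).sub (M.integrable_childSize _ _ i)).abs
        ((hi i).const_mul C) fun x => ?_)
      have hmono : M.childSize x n i ≤ M.childSize x (n + D) i := by
        exact_mod_cast M.childSize_le_add hs D x i
      obtain ⟨E, hE⟩ := Nat.exists_eq_add_of_le hmono
      have := ih (M.childSize x n i) E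
      simp only
      rw [hE]; push_cast; rw [add_sub_cancel_left]
      exact this

/-- The expected number of nodes with `k` balls: existence as a limit, and its properties. -/
theorem exists_limit_R_unit {β : ℝ} (hβ : M.IsMalthusian β) {k : ℕ} (hk : 1 ≤ k) :
    ∃ u : ℕ → ℝ, (∀ n, Tendsto (fun L => M.R L (unit k) n) atTop (𝓝 (u n))) ∧ u 0 = 0 ∧
      (∃ A, 0 ≤ A ∧ ∀ n, |u n| ≤ A * (n : ℝ) ^ β) ∧
      (∃ C, 0 ≤ C ∧ ∀ n m : ℕ, |u n - u m| ≤ C * |(n : ℝ) - m| ^ β) ∧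
      ∀ n, k < n → u n = M.T u n := by
  obtain ⟨A, hA0, hA⟩ := M.R_unit_le hβ hk
  obtain ⟨C, hC0, hC⟩ := M.abs_R_unit_sub_le hβ hk
  have hlim : ∀ n, Tendsto (fun L => M.R L (unit k) n) atTop
      (𝓝 (⨆ L, M.R L (unit k) n)) := fun n =>
    tendsto_atTop_ciSup (M.R_mono_left (unit_nonneg k) n)
      ⟨A * (n : ℝ) ^ β, by rintro _ ⟨L, rfl⟩; exact hA L n⟩
  set u := fun n => ⨆ L, M.R L (unit k) n with hu
  have hlip : ∀ n D : ℕ, |u (n + D) - u n| ≤ C * (D : ℝ) ^ β := fun n D =>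
    le_of_tendsto' ((hlim (n + D)).sub (hlim n)).abs fun L => hC L n D
  refine ⟨u, hlim, ?_, ⟨A, hA0, fun n => ?_⟩, ⟨C, hC0, ?_⟩, fun n hn => ?_⟩
  · refine tendsto_nhds_unique (hlim 0) ?_
    have : unit k 0 = 0 := if_neg (by omega)
    simp [M.R_at_zero this]
  · rw [abs_of_nonneg (ge_of_tendsto' (hlim n) fun L => M.R_nonneg (unit_nonneg k) L n)]
    exact le_of_tendsto' (hlim n) fun L => hA L n
  · intro n m
    rcases le_total m n with h | h
    · obtain ⟨D, rfl⟩ := Nat.exists_eq_add_of_le h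
      have := hlip m D
      push_cast; rwa [add_sub_cancel_left, abs_of_nonneg (Nat.cast_nonneg (α := ℝ) D)]
    · obtain ⟨D, rfl⟩ := Nat.exists_eq_add_of_le h
      have := hlip n D
      rw [abs_sub_comm, abs_sub_comm (n : ℝ)]
      push_cast; rwa [add_sub_cancel_left, abs_of_nonneg (Nat.cast_nonneg (α := ℝ) D)]
  · have h1 := (hlim n).comp (tendsto_add_atTop_nat 1)
    refine tendsto_nhds_unique h1 ?_
    have e : unit k n = 0 := if_neg hn.ne'
    have : ((fun L => M.R L (unit k) n) ∘ fun a => a + 1) = fun L => M.T (M.R L (unit k)) n := by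
      ext L; simp [R_succ, e]
    rw [this]
    exact tendsto_finsetSum _ fun j _ => (hlim j).const_mul _

end Model

/-! ### Approximate renewal equations and a barrier. -/

/-- `f` is a bounded solution of a renewal equation with an exponentially small error, for a step
distribution `μ` on `[0, ∞)` that has an exponential moment and is not concentrated at `0`. -/
structure IsRenewal (μ : Measure ℝ) (η B C : ℝ) (f : ℝ → ℝ) : Prop where
  η_pos : 0 < η
  nonneg : ∀ᵐ x ∂μ, 0 ≤ x
  drift : 0 < ∫ x, min x 1 ∂μ
  integrable_exp : Integrable (fun x => Real.exp (η * x)) μ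
  measurable : Measurable f
  bound : ∀ t, |f t| ≤ B
  eqn : ∀ t, |f t - ∫ x, f (t - x) ∂μ| ≤ C * Real.exp (-η * t)

/-- `f` is uniformly continuous near infinity. -/
def EquicontinuousAtTop (f : ℝ → ℝ) : Prop :=
  ∀ ε > 0, ∃ h > 0, ∃ T, ∀ t ≥ T, ∀ t', |t' - t| ≤ h → |f t' - f t| ≤ ε

open Classical in
/-- A barrier function for the random walk with negative steps. -/
def barrier (ε η L B s : ℝ) : ℝ :=
  if 0 < s then ε - ε / 2 * Real.exp (-η * s) else if -L ≤ s then 0 else B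

theorem measurable_barrier (ε η L B : ℝ) : Measurable (barrier ε η L B) := by
  refine Measurable.ite measurableSet_Ioi (by fun_prop)
    (Measurable.ite measurableSet_Ici measurable_const measurable_const)

section barrier

variable {ε η L B s x : ℝ}

theorem barrier_of_pos (hs : 0 < s) : barrier ε η L B s = ε - ε / 2 * Real.exp (-η * s) := if_pos hs

theorem half_le_barrier (hε : 0 < ε) (hη : 0 < η) (hs : 0 < s) : ε / 2 ≤ barrier ε η L B s := by
  rw [barrier_of_pos hs]
  have : Real.exp (-η * s) ≤ 1 := Real.exp_le_one_iff.2 (by nlinarith)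
  nlinarith

theorem barrier_le (hε : 0 < ε) (hs : 0 < s) : barrier ε η L B s ≤ ε := by
  rw [barrier_of_pos hs]
  have := Real.exp_pos (-η * s)
  nlinarith

theorem barrier_nonneg (hε : 0 < ε) (hη : 0 < η) (hB : 0 ≤ B) (s : ℝ) :
    0 ≤ barrier ε η L B s := by
  by_cases hs : 0 < s
  · exact le_trans (by positivity) (half_le_barrier hε hη hs)
  · unfold barrier
    rw [if_neg hs]
    split_ifs <;> simp [hB]

theorem abs_barrier_le (hε : 0 < ε) (hη : 0 < η) (hB : 0 ≤ B) (s : ℝ) :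
    |barrier ε η L B s| ≤ ε + B := by
  rw [abs_of_nonneg (barrier_nonneg hε hη hB s)]
  by_cases hs : 0 < s
  · have := barrier_le (η := η) (L := L) (B := B) hε hs
    linarith
  · unfold barrier
    rw [if_neg hs]
    split_ifs <;> linarith

/-- Integrated over a step, this makes the barrier a strict supersolution on `s > 0`. A step that
stays positive gains through `exp (η x) - 1 ≥ η x`, and one that ends in `[-L, 0]` gains at least `ε
/ 2`. A step beyond `-L` has `x > s + L`, so `exp (η (x - s - L)) ≥ 1` pays for the height `B`. -/
theorem barrier_drop (hε : 0 < ε) (hη : 0 < η) (hB : 0 ≤ B) (hs : 0 < s) (hx : 0 ≤ x) :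
    Real.exp (-η * s) * (ε / 2 * min η 1 * min x 1 - B * Real.exp (-η * L) * Real.exp (η * x)) ≤
      barrier ε η L B s - barrier ε η L B (s - x) := by
  have he := Real.exp_pos (-η * s)
  have hm : 0 ≤ min η 1 := by positivity
  have hm1 : min η 1 ≤ 1 := min_le_right _ _
  have hx0 : 0 ≤ min x 1 := le_min hx zero_le_one
  have hx1 : min x 1 ≤ 1 := min_le_right _ _
  have hpos : 0 ≤ B * Real.exp (-η * L) * Real.exp (η * x) := by positivity
  have hmm : min η 1 * min x 1 ≤ 1 := by nlinarith
  have he1 : Real.exp (-η * s) ≤ 1 := Real.exp_le_one_iff.2 (by nlinarith)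
  have hhalf := half_le_barrier (L := L) (B := B) hε hη hs
  have hfirst : Real.exp (-η * s) * (ε / 2 * min η 1 * min x 1) ≤ ε / 2 := by
    have h1 : Real.exp (-η * s) * (min η 1 * min x 1) ≤ 1 := by
      have : 0 ≤ min η 1 * min x 1 := mul_nonneg hm hx0
      nlinarith
    nlinarith
  by_cases h1 : 0 < s - x
  · rw [barrier_of_pos hs, barrier_of_pos h1]
    have e : Real.exp (-η * (s - x)) = Real.exp (-η * s) * Real.exp (η * x) := by
      rw [← Real.exp_add]; congr 1; ring
    rw [e]
    have h2 : 1 + η * x ≤ Real.exp (η * x) := by linarith [Real.add_one_le_exp (η * x)]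
    have h3 : min η 1 * min x 1 ≤ η * x :=
      mul_le_mul (min_le_left _ _) (min_le_left _ _) hx0 hη.le
    have h4 : 0 ≤ Real.exp (-η * s) * (B * Real.exp (-η * L) * Real.exp (η * x)) := by positivity
    have h5 : Real.exp (-η * s) * (ε / 2) * (min η 1 * min x 1) ≤
        Real.exp (-η * s) * (ε / 2) * (Real.exp (η * x) - 1) :=
      mul_le_mul_of_nonneg_left (by linarith) (by positivity)
    nlinarith
  · by_cases h2 : -L ≤ s - x
    · have : barrier ε η L B (s - x) = 0 := by unfold barrier; rw [if_neg h1, if_pos h2]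
      rw [this]
      have h4 : 0 ≤ Real.exp (-η * s) * (B * Real.exp (-η * L) * Real.exp (η * x)) := by positivity
      nlinarith
    · have : barrier ε η L B (s - x) = B := by unfold barrier; rw [if_neg h1, if_neg h2]
      rw [this]
      have e : Real.exp (-η * s) * (B * Real.exp (-η * L) * Real.exp (η * x)) =
          B * Real.exp (η * (x - s - L)) := by
        have : Real.exp (η * (x - s - L)) =
            Real.exp (-η * s) * Real.exp (-η * L) * Real.exp (η * x) := by
          rw [← Real.exp_add, ← Real.exp_add]; congr 1; ring
        rw [this]; ring
      have h5 : 1 ≤ Real.exp (η * (x - s - L)) :=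
        Real.one_le_exp (mul_nonneg hη.le (by linarith))
      rw [mul_sub, e]
      nlinarith

end barrier

/-! ### The renewal theorem. -/

section Renewal

variable {μ : Measure ℝ} {η B C : ℝ} {f : ℝ → ℝ}

namespace IsRenewal

theorem bound_nonneg (h : IsRenewal μ η B C f) : 0 ≤ B := (abs_nonneg _).trans (h.bound 0)

theorem support_nonneg (h : IsRenewal μ η B C f) : μ.support ⊆ Set.Ici 0 :=
  Measure.support_subset_of_isClosed isClosed_Ici h.nonneg

variable [IsProbabilityMeasure μ]

theorem integrable_shift (h : IsRenewal μ η B C f) (t : ℝ) :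
    Integrable (fun x => f (t - x)) μ :=
  Integrable.of_bound (C := B)
    (h.measurable.comp (measurable_const.sub measurable_id)).aestronglyMeasurable
    (ae_of_all _ fun _ => h.bound _)

theorem integrable_min (h : IsRenewal μ η B C f) : Integrable (fun x : ℝ => min x 1) μ := by
  refine Integrable.of_bound (C := 1) (measurable_id.min measurable_const).aestronglyMeasurable ?_
  filter_upwards [h.nonneg] with x hx
  rw [Real.norm_eq_abs, abs_of_nonneg (le_min hx zero_le_one)]
  exact min_le_right _ _

/-- A lower bound on a long window persists up to a small error. -/
theorem propagation (h : IsRenewal μ η B C f) {A : Set ℝ}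
    (hA : ∀ t ∈ A, ∀ᵐ x ∂μ, t - x ∈ A) {ε : ℝ} (hε : 0 < ε) :
    ∃ L, 0 ≤ L ∧ ∃ T₀, ∀ T ≥ T₀, ∀ l ≤ B, (∀ t ∈ A, T - L ≤ t → t ≤ T → l ≤ f t) →
      ∀ t ∈ A, T ≤ t → l - ε ≤ f t := by
  have hη := h.η_pos
  have hB := h.bound_nonneg
  set E := ∫ x, Real.exp (η * x) ∂μ with hE
  set a := ε / 2 * min η 1 * ∫ x, min x 1 ∂μ with ha
  have ha0 : 0 < a := by
    have := h.drift
    have : 0 < min η 1 := lt_min hη zero_lt_one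
    positivity
  have hexp : Tendsto (fun y : ℝ => Real.exp (-η * y)) atTop (𝓝 0) :=
    Real.tendsto_exp_atBot.comp (tendsto_id.const_mul_atTop_of_neg (by linarith))
  -- Jumps over the window cost a quarter of the drift gain `a`, and the error of the equation past
  -- `T₀` another quarter, which leaves the slack `a / 2`.
  have hL : ∀ᶠ y : ℝ in atTop, 2 * B * E * Real.exp (-η * y) < a / 4 :=
    (hexp.const_mul (2 * B * E)).eventually_lt_const (by rw [mul_zero]; positivity)
  have hT : ∀ᶠ y : ℝ in atTop, C * Real.exp (-η * y) < a / 4 :=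
    (hexp.const_mul C).eventually_lt_const (by rw [mul_zero]; positivity)
  obtain ⟨L, hL1, hL0⟩ := (hL.and (eventually_ge_atTop 0)).exists
  obtain ⟨T₀, hT₀⟩ := eventually_atTop.1 hT
  refine ⟨L, hL0, T₀, fun T hTT l hl hwin t₁ ht₁ hTt₁ => ?_⟩
  rcases hTt₁.eq_or_lt with rfl | hTt₁
  · have := hwin T ht₁ (by linarith) le_rfl
    linarith
  -- The height `2 * B` covers the largest possible value of `l - f` below the window, where nothing
  -- is assumed about `f`.
  set ψ := barrier ε η L (2 * B) with hψ
  set g : ℝ → ℝ := fun t => f t - l + ψ (t - T) with hg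
  suffices hs : 0 ≤ g t₁ by
    have := barrier_le (η := η) (L := L) (B := 2 * B) hε (sub_pos.2 hTt₁)
    simp only [hg] at hs
    linarith
  by_contra hneg
  push Not at hneg
  have hlow : ∀ t ∈ A, t ≤ T → 0 ≤ g t := by
    intro t ht htT
    by_cases hw : T - L ≤ t
    · have h1 := hwin t ht hw htT
      have h2 := barrier_nonneg (L := L) hε hη (by linarith : 0 ≤ 2 * B) (t - T)
      simp only [hg]; linarith
    · have h1 : ψ (t - T) = 2 * B := by
        simp only [hψ, barrier]
        rw [if_neg (by linarith), if_neg (by linarith)]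
      have h2 := (abs_le.1 (h.bound t)).1
      simp only [hg]; linarith
  have hψint : ∀ s : ℝ, Integrable (fun x => ψ (s - x)) μ := fun s =>
    Integrable.of_bound (C := ε + 2 * B)
      ((measurable_barrier _ _ _ _).comp (measurable_const.sub measurable_id)).aestronglyMeasurable
      (ae_of_all _ fun x => abs_barrier_le hε hη (by linarith) _)
  have hslack : ∀ t, T < t → ∫ x, g (t - x) ∂μ + a / 2 * Real.exp (-η * (t - T)) ≤ g t := by
    intro t ht
    have hs : 0 < t - T := sub_pos.2 ht
    have e1 : ∫ x, g (t - x) ∂μ = ∫ x, f (t - x) ∂μ - l + ∫ x, ψ (t - T - x) ∂μ := by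
      simp only [hg]
      have e0 : ∀ x, t - x - T = t - T - x := fun x => by ring
      simp_rw [e0]
      have i3 : Integrable (fun x => f (t - x) - l) μ :=
        (h.integrable_shift t).sub (integrable_const l)
      rw [integral_add i3 (hψint _),
        integral_sub (h.integrable_shift t) (integrable_const l)]
      simp
    have e2 : Real.exp (-η * (t - T)) * (a - 2 * B * Real.exp (-η * L) * E) ≤
        ψ (t - T) - ∫ x, ψ (t - T - x) ∂μ := by
      have i1 : Integrable (fun x => Real.exp (-η * (t - T)) *
          (ε / 2 * min η 1 * min x 1 - 2 * B * Real.exp (-η * L) * Real.exp (η * x))) μ :=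
        ((h.integrable_min.const_mul _).sub (h.integrable_exp.const_mul _)).const_mul _
      have i2 := integral_mono_ae i1 ((integrable_const (ψ (t - T))).sub (hψint (t - T))) (by
        filter_upwards [h.nonneg] with x hx
        exact barrier_drop hε hη (by linarith : 0 ≤ 2 * B) hs hx)
      rw [integral_const_mul, integral_sub (h.integrable_min.const_mul _)
        (h.integrable_exp.const_mul _), integral_const_mul, integral_const_mul] at i2
      simp only [Pi.sub_apply] at i2
      rw [integral_sub (integrable_const _) (hψint _)] at i2
      simpa using i2
    have e3 := (abs_le.1 (h.eqn t)).1
    have e4 : C * Real.exp (-η * t) ≤ a / 4 * Real.exp (-η * (t - T)) := by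
      have : Real.exp (-η * t) = Real.exp (-η * T) * Real.exp (-η * (t - T)) := by
        rw [← Real.exp_add]; congr 1; ring
      rw [this, ← mul_assoc]
      exact mul_le_mul_of_nonneg_right (hT₀ T hTT).le (Real.exp_pos _).le
    have e5 : Real.exp (-η * (t - T)) * (3 * a / 4) ≤
        Real.exp (-η * (t - T)) * (a - 2 * B * Real.exp (-η * L) * E) :=
      mul_le_mul_of_nonneg_left (by linarith) (Real.exp_pos _).le
    rw [e1]
    simp only [hg]
    linarith
  have hgint : ∀ t, Integrable (fun x => g (t - x)) μ := fun t => by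
    have e0 : ∀ x, t - x - T = t - T - x := fun x => by ring
    simp only [hg, e0]
    exact ((h.integrable_shift t).sub (integrable_const l)).add (hψint _)
  -- The infimum need not be attained. On this bounded range the slack is at least `c`, so a point
  -- within `c` of the infimum already gives a contradiction; nonnegative steps never leave the
  -- range to the right.
  set W := g '' {t | t ∈ A ∧ T < t ∧ t ≤ t₁} with hW
  have hWbdd : BddBelow W := by
    refine ⟨-B - l, ?_⟩
    rintro _ ⟨t, _, rfl⟩
    have h1 := (abs_le.1 (h.bound t)).1
    have h2 := barrier_nonneg (L := L) hε hη (by linarith : 0 ≤ 2 * B) (t - T)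
    simp only [hg]; linarith
  have hWmem : g t₁ ∈ W := ⟨t₁, ⟨ht₁, hTt₁, le_rfl⟩, rfl⟩
  have hm : sInf W < 0 := (csInf_le hWbdd hWmem).trans_lt hneg
  set c := a / 2 * Real.exp (-η * (t₁ - T)) with hc
  have hc0 : 0 < c := by positivity
  obtain ⟨_, ⟨t, ⟨htA, htT, htt₁⟩, rfl⟩, hlt⟩ :=
    exists_lt_of_csInf_lt ⟨_, hWmem⟩ (lt_add_of_pos_right (sInf W) hc0)
  have h1 : sInf W ≤ ∫ x, g (t - x) ∂μ := by
    have : ∫ _x, sInf W ∂μ ≤ ∫ x, g (t - x) ∂μ := by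
      refine integral_mono_ae (integrable_const _) (hgint t) ?_
      filter_upwards [h.nonneg, hA t htA] with x hx hxA
      by_cases hxT : T < t - x
      · exact csInf_le hWbdd ⟨t - x, ⟨hxA, hxT, by linarith⟩, rfl⟩
      · exact hm.le.trans (hlow _ hxA (not_lt.1 hxT))
    simpa using this
  have h2 := hslack t htT
  have h3 : c ≤ a / 2 * Real.exp (-η * (t - T)) :=
    mul_le_mul_of_nonneg_left (Real.exp_le_exp.2 (by nlinarith)) (by positivity)
  linarith

/-- Where `f` is close to its upper limit, so are its translates by points of the support. -/
theorem tendsto_sub_of_mem_support (h : IsRenewal μ η B C f) (hf : EquicontinuousAtTop f)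
    {A : Set ℝ} (hA : ∀ t ∈ A, ∀ x ∈ μ.support, t - x ∈ A) {S : ℝ}
    (hS : ∀ ε > 0, ∀ᶠ t in atTop ⊓ 𝓟 A, f t < S + ε) {y : ℝ} (hy : y ∈ μ.support) :
    Tendsto (fun t => t - y) (atTop ⊓ 𝓟 A ⊓ comap f (𝓝 S)) (atTop ⊓ 𝓟 A ⊓ comap f (𝓝 S)) := by
  have hη := h.η_pos
  set F := atTop ⊓ 𝓟 A ⊓ comap f (𝓝 S) with hF
  have hF1 : F ≤ atTop := inf_le_left.trans inf_le_left
  have hF2 : F ≤ 𝓟 A := inf_le_left.trans inf_le_right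
  have hFf : Tendsto f F (𝓝 S) := tendsto_comap.mono_left inf_le_right
  have hFA : ∀ᶠ t in F, t ∈ A := hF2 (mem_principal_self A)
  have t1 : Tendsto (fun t => t - y) F (atTop ⊓ 𝓟 A) := by
    refine tendsto_inf.2 ⟨?_, tendsto_principal.2 ?_⟩
    · exact (tendsto_atTop_add_const_right atTop (-y) tendsto_id).mono_left hF1
    · filter_upwards [hFA] with t ht; exact hA t ht y hy
  refine tendsto_inf.2 ⟨t1, tendsto_comap_iff.2 ?_⟩
  refine tendsto_order.2 ⟨fun l hl => ?_, fun u hu => ?_⟩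
  swap
  · have := t1.eventually (hS (u - S) (sub_pos.2 hu))
    filter_upwards [this] with t ht
    simpa using ht
  set ε := S - l with hε
  have hε0 : 0 < ε := sub_pos.2 hl
  obtain ⟨r, hr, T₁, hT₁⟩ := hf (ε / 2) (by positivity)
  set p := μ.real (Metric.ball y r) with hp
  have hp0 : 0 < p := by
    have := (Measure.mem_support_iff_forall y).1 hy _ (Metric.ball_mem_nhds y hr)
    exact ENNReal.toReal_pos this.ne' (measure_ne_top _ _)
  -- If `f (t - y) ≤ S - ε`, then `f ≤ S - ε / 2` on the translate of a ball of mass `p`. The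
  -- average falls to `S - p * ε / 2` plus two errors of `p * ε / 8`, against `f t > S - p * ε / 8`.
  have hpe : 0 < p * ε / 8 := by positivity
  obtain ⟨T₂, hT₂⟩ : ∃ T₂, ∀ t ≥ T₂, t ∈ A → f t < S + p * ε / 8 := by
    have := hS _ hpe
    rw [eventually_inf_principal] at this
    exact eventually_atTop.1 this
  set E := ∫ x, Real.exp (η * x) ∂μ with hE
  set K := B + |S| + ε with hK
  have hK0 : 0 ≤ K := by have := h.bound_nonneg; positivity
  have hexp : Tendsto (fun t : ℝ => Real.exp (-η * t)) F (𝓝 0) :=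
    (Real.tendsto_exp_atBot.comp (tendsto_id.const_mul_atTop_of_neg (by linarith))).mono_left hF1
  have hsmall : ∀ᶠ t in F,
      (K * E * Real.exp (η * T₂) + C) * Real.exp (-η * t) < p * ε / 8 :=
    (hexp.const_mul _).eventually_lt_const (by rwa [mul_zero])
  filter_upwards [hsmall, hFA, hF1 (eventually_ge_atTop (T₁ + y)),
    hFf.eventually (lt_mem_nhds (sub_lt_self S hpe))] with t ht1 htA ht2 ht3
  by_contra hcon
  have hcon' : f (t - y) ≤ S - ε := by simp only [Function.comp, not_lt] at hcon; linarith
  -- The exponential term takes care of steps that go back beyond `T₂`, where only the global bound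
  -- on `f` is available.
  have hpt : ∀ᵐ x ∂μ, f (t - x) ≤ (S + p * ε / 8) -
      Set.indicator (Metric.ball y r) (fun _ => ε / 2) x +
      K * Real.exp (-η * (t - T₂)) * Real.exp (η * x) := by
    filter_upwards [h.nonneg, Measure.support_mem_ae (μ := μ)] with x hx hxs
    have hpos : 0 ≤ K * Real.exp (-η * (t - T₂)) * Real.exp (η * x) := by positivity
    by_cases hxT : T₂ ≤ t - x
    · by_cases hxb : x ∈ Metric.ball y r
      · rw [Set.indicator_of_mem hxb]
        have := hT₁ (t - y) (by linarith) (t - x) (by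
          have := Metric.mem_ball.1 hxb
          rw [Real.dist_eq] at this
          rw [show t - x - (t - y) = -(x - y) by ring, abs_neg]; exact this.le)
        have := (abs_le.1 this).2
        linarith
      · rw [Set.indicator_of_notMem hxb]
        have := hT₂ (t - x) hxT (hA t htA x hxs)
        linarith
    · have h1 : Set.indicator (Metric.ball y r) (fun _ => ε / 2) x ≤ ε / 2 :=
        Set.indicator_le' (fun _ _ => le_rfl) (fun _ _ => by positivity) x
      have h2 : 1 ≤ Real.exp (-η * (t - T₂)) * Real.exp (η * x) := by
        rw [← Real.exp_add]
        exact Real.one_le_exp (by nlinarith)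
      have h3 : K ≤ K * Real.exp (-η * (t - T₂)) * Real.exp (η * x) := by
        rw [mul_assoc]; exact le_mul_of_one_le_right hK0 h2
      have h4 := (abs_le.1 (h.bound (t - x))).2
      have h5 := neg_abs_le S
      linarith
  have iind : Integrable (Set.indicator (Metric.ball y r) (fun _ : ℝ => ε / 2)) μ :=
    (integrable_const _).indicator Metric.isOpen_ball.measurableSet
  have hint := integral_mono_ae (h.integrable_shift t)
    (((integrable_const (S + p * ε / 8)).sub iind).add
      (h.integrable_exp.const_mul (K * Real.exp (-η * (t - T₂))))) hpt
  simp only [Pi.add_apply, Pi.sub_apply] at hint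
  have i3 : Integrable (fun x => S + p * ε / 8 -
      Set.indicator (Metric.ball y r) (fun _ => ε / 2) x) μ := (integrable_const _).sub iind
  rw [integral_add i3 (h.integrable_exp.const_mul _),
    integral_sub (integrable_const _) iind, integral_const_mul,
    integral_indicator_const _ Metric.isOpen_ball.measurableSet] at hint
  simp only [integral_const, probReal_univ, smul_eq_mul, one_mul] at hint
  rw [← hp, ← hE] at hint
  have e1 : Real.exp (-η * (t - T₂)) = Real.exp (η * T₂) * Real.exp (-η * t) := by
    rw [← Real.exp_add]; congr 1; ring
  rw [e1] at hint
  have e2 := (abs_le.1 (h.eqn t)).2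
  nlinarith

end IsRenewal

/-- Two points of an additive monoid at distance `z` generate a set that meets all intervals of
length `z` far away from the origin. -/
theorem exists_finset_cover {P : AddSubmonoid ℝ} {g₁ g₂ : ℝ} (h₁ : g₁ ∈ P) (h₂ : g₂ ∈ P)
    (h0 : 0 ≤ g₂) (hlt : g₂ < g₁) :
    ∃ r, ∀ X, ∃ Y : Finset ℝ, (∀ y ∈ Y, y ∈ P) ∧
      ∀ x, r ≤ x → x ≤ X → ∃ y ∈ Y, y ≤ x ∧ x < y + (g₁ - g₂) := by
  set z := g₁ - g₂ with hz
  have hz0 : 0 < z := sub_pos.2 hlt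
  have hg1 : 0 < g₁ := lt_of_le_of_lt h0 hlt
  refine ⟨g₁ * g₂ / z, fun X => ?_⟩
  set N := ⌊X / g₁⌋₊ + 2 with hN
  refine ⟨(Finset.range N ×ˢ Finset.range N).image fun q => q.1 • g₂ + q.2 • g₁, ?_, ?_⟩
  · intro y hy
    obtain ⟨q, _, rfl⟩ := Finset.mem_image.1 hy
    exact add_mem (nsmul_mem h₂ _) (nsmul_mem h₁ _)
  · intro x hx hxX
    have hx0 : 0 ≤ x := le_trans (by positivity) hx
    rw [div_le_iff₀ hz0] at hx
    -- This `k` satisfies `k * g₂ ≤ x < k * g₁`, the left part because `x ≥ g₁ * g₂ / z`. Sums of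
    -- `k` terms, each `g₁` or `g₂`, run from `k * g₂` to `k * g₁` with spacing `z`.
    set k := ⌊x / g₁⌋₊ + 1 with hk
    have hk1 : x < k * g₁ := by
      have := Nat.lt_floor_add_one (x / g₁)
      rw [div_lt_iff₀ hg1] at this
      simpa [hk] using this
    have hk2 : (k : ℝ) * g₂ ≤ x := by
      have h3 : ((⌊x / g₁⌋₊ : ℕ) : ℝ) * g₁ ≤ x := by
        have := Nat.floor_le (div_nonneg hx0 hg1.le)
        rwa [le_div_iff₀ hg1] at this
      have h4 : (k : ℝ) * g₁ ≤ x + g₁ := by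
        rw [hk]; push_cast; linarith
      have h5 : (k : ℝ) * g₂ * g₁ ≤ x * g₁ := by
        calc (k : ℝ) * g₂ * g₁ = k * g₁ * g₂ := by ring
          _ ≤ (x + g₁) * g₂ := mul_le_mul_of_nonneg_right h4 h0
          _ = x * g₂ + g₁ * g₂ := by ring
          _ ≤ x * g₂ + x * z := by linarith
          _ = x * g₁ := by rw [hz]; ring
      exact le_of_mul_le_mul_right h5 hg1
    set i := ⌊(x - k * g₂) / z⌋₊ with hi
    have hi1 : (i : ℝ) * z ≤ x - k * g₂ := by
      have := Nat.floor_le (div_nonneg (sub_nonneg.2 hk2) hz0.le)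
      rwa [le_div_iff₀ hz0] at this
    have hi2 : x - k * g₂ < (i + 1) * z := by
      have := Nat.lt_floor_add_one ((x - k * g₂) / z)
      rwa [div_lt_iff₀ hz0] at this
    have hik : i < k := by
      have h3 : (i : ℝ) * z < k * z := by
        have : (k : ℝ) * z = k * g₁ - k * g₂ := by rw [hz]; ring
        linarith
      exact_mod_cast lt_of_mul_lt_mul_right h3 hz0.le
    have hkN : k < N := by
      have : ⌊x / g₁⌋₊ ≤ ⌊X / g₁⌋₊ := Nat.floor_mono (div_le_div_of_nonneg_right hxX hg1.le)
      omega
    have e : (k - i : ℕ) • g₂ + i • g₁ = k * g₂ + i * z := by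
      rw [nsmul_eq_mul, nsmul_eq_mul, Nat.cast_sub hik.le, hz]; ring
    refine ⟨(k - i : ℕ) • g₂ + i • g₁, Finset.mem_image.2 ⟨(k - i, i), ?_, rfl⟩, ?_, ?_⟩
    · simp only [Finset.mem_product, Finset.mem_range]; omega
    · rw [e]; linarith
    · rw [e]; linarith

theorem exists_sub_of_mem_addSubgroup_closure {s : Set ℝ} {z : ℝ}
    (hz : z ∈ AddSubgroup.closure s) :
    ∃ g₁ ∈ AddSubmonoid.closure s, ∃ g₂ ∈ AddSubmonoid.closure s, z = g₁ - g₂ := by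
  induction hz using AddSubgroup.closure_induction with
  | mem x hx => exact ⟨x, AddSubmonoid.subset_closure hx, 0, zero_mem _, by simp⟩
  | zero => exact ⟨0, zero_mem _, 0, zero_mem _, by simp⟩
  | add x y _ _ hx hy =>
    obtain ⟨a, ha, c, hc, rfl⟩ := hx
    obtain ⟨a', ha', c', hc', rfl⟩ := hy
    exact ⟨a + a', add_mem ha ha', c + c', add_mem hc hc', by ring⟩
  | neg x _ hx =>
    obtain ⟨a, ha, c, hc, rfl⟩ := hx
    exact ⟨c, hc, a, ha, by ring⟩

variable [IsProbabilityMeasure μ]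

namespace IsRenewal

/-- The renewal theorem, on a set that is invariant under the steps. -/
theorem exists_tendsto (h : IsRenewal μ η B C f) (hf : EquicontinuousAtTop f)
    {A : Set ℝ} (hA : ∀ t ∈ A, ∀ x ∈ μ.support, t - x ∈ A) [NeBot (atTop ⊓ 𝓟 A)]
    (hz : ∀ ε > 0, ∃ z ∈ AddSubgroup.closure μ.support, 0 < z ∧
      ∃ T, ∀ t ∈ A, ∀ t' ∈ A, T ≤ t → t ≤ t' → t' < t + z → |f t' - f t| ≤ ε) :
    ∃ S, Tendsto f (atTop ⊓ 𝓟 A) (𝓝 S) := by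
  set S := limsup f (atTop ⊓ 𝓟 A) with hSdef
  have hbdd : IsBoundedUnder (· ≤ ·) (atTop ⊓ 𝓟 A) f :=
    isBoundedUnder_of ⟨B, fun t => (abs_le.1 (h.bound t)).2⟩
  have hbdd' : IsBoundedUnder (· ≥ ·) (atTop ⊓ 𝓟 A) f :=
    isBoundedUnder_of ⟨-B, fun t => (abs_le.1 (h.bound t)).1⟩
  have hS : ∀ ε > 0, ∀ᶠ t in atTop ⊓ 𝓟 A, f t < S + ε := fun ε hε =>
    eventually_lt_of_limsup_lt (lt_add_of_pos_right S hε) hbdd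
  have hS' : ∀ ε > 0, ∃ᶠ t in atTop ⊓ 𝓟 A, S - ε < f t := fun ε hε =>
    frequently_lt_of_lt_limsup hbdd'.isCoboundedUnder_flip (sub_lt_self S hε)
  set F := atTop ⊓ 𝓟 A ⊓ comap f (𝓝 S) with hF
  -- The limsup is a cluster value along `A`.
  have hNe : NeBot F := by
    rw [hF, inf_neBot_iff_frequently_right]
    intro p hp
    obtain ⟨V, hV, hVp⟩ := mem_comap.1 hp
    obtain ⟨ε, hε, hball⟩ := Metric.mem_nhds_iff.1 hV
    refine ((hS' ε hε).and_eventually (hS ε hε)).mono fun t ht => hVp (hball ?_)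
    rw [Metric.mem_ball, Real.dist_eq, abs_lt]
    constructor <;> linarith [ht.1, ht.2]
  have hF1 : F ≤ atTop := inf_le_left.trans inf_le_left
  have hFf : Tendsto f F (𝓝 S) := tendsto_comap.mono_left inf_le_right
  have hFA : Tendsto id F (𝓟 A) := tendsto_id.mono_left (inf_le_left.trans inf_le_right)
  have hmon : ∀ y ∈ AddSubmonoid.closure μ.support, Tendsto (fun t => t - y) F F := by
    intro y hy
    induction hy using AddSubmonoid.closure_induction with
    | mem x hx => exact h.tendsto_sub_of_mem_support hf hA hS hx
    | zero => simp only [sub_zero]; exact tendsto_id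
    | add x y _ _ hx hy =>
      have := hy.comp hx
      refine this.congr fun t => ?_
      simp only [Function.comp]; ring
  refine ⟨S, tendsto_order.2 ⟨fun l hl => ?_, fun u hu => ?_⟩⟩
  swap
  · simpa using hS (u - S) (sub_pos.2 hu)
  set ε := S - l with hε
  have hε0 : 0 < ε := sub_pos.2 hl
  obtain ⟨L, hL0, T₀, hprop⟩ := h.propagation (A := A) (ε := ε / 4) (fun t ht => by
    filter_upwards [Measure.support_mem_ae (μ := μ)] with x hx
    exact hA t ht x hx) (by positivity)
  obtain ⟨z, hzΓ, hz0, T₂, hT₂⟩ := hz (ε / 4) (by positivity)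
  obtain ⟨g₁, hg₁, g₂, hg₂, rfl⟩ := exists_sub_of_mem_addSubgroup_closure hzΓ
  have hg₂0 : 0 ≤ g₂ := by
    have : AddSubmonoid.closure μ.support ≤ AddSubmonoid.nonneg ℝ :=
      AddSubmonoid.closure_le.2 h.support_nonneg
    exact this hg₂
  obtain ⟨r, hr⟩ := exists_finset_cover hg₁ hg₂ hg₂0 (sub_pos.1 hz0)
  -- The window `[t₀ - r - L, t₀ - r]` lies at distances between `r` and `r + L` behind `t₀`, where
  -- semigroup points have gaps at most `z`. Only finitely many are used, so a single `t₀` is good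
  -- for all of them.
  obtain ⟨Y, hYP, hY⟩ := hr (r + L)
  have hev : ∀ᶠ t in F, ∀ y ∈ Y, S - ε / 4 < f (t - y) ∧ t - y ∈ A := by
    rw [eventually_all_finset]
    intro y hy
    have h1 := hFf.comp (hmon y (hYP y hy))
    have h2 := hFA.comp (hmon y (hYP y hy))
    exact (h1.eventually (lt_mem_nhds (by linarith))).and (tendsto_principal.1 h2)
  obtain ⟨t₀, ht1, ht2, ht3, ht4⟩ := (hev.and (((eventually_ge_atTop (T₀ + r)).filter_mono hF1).and
    (((eventually_ge_atTop (T₂ + r + L)).filter_mono hF1).and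
    (hFf.eventually (lt_mem_nhds (show S - ε / 2 < S by linarith)))))).exists
  have hB : S - ε / 2 ≤ B := ht4.le.trans (abs_le.1 (h.bound t₀)).2
  have hfin := hprop (t₀ - r) (by simp only [ge_iff_le]; have : T₀ + r ≤ t₀ := ht2; linarith)
    (S - ε / 2) hB ?_
  · rw [eventually_inf_principal]
    filter_upwards [eventually_ge_atTop (t₀ - r)] with t ht htA
    have := hfin t htA ht
    linarith
  · intro t htA hta htb
    obtain ⟨y, hyY, hy1, hy2⟩ := hY (t₀ - t) (by linarith) (by linarith)
    obtain ⟨h1, h2⟩ := ht1 y hyY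
    have ht3' : T₂ + r + L ≤ t₀ := ht3
    have h3 := hT₂ t htA (t₀ - y) h2 (by linarith) (by linarith) (by linarith)
    have := (abs_le.1 h3).2
    linarith

/-- The nonlattice renewal theorem. -/
theorem exists_tendsto_of_dense (h : IsRenewal μ η B C f) (hf : EquicontinuousAtTop f)
    (hd : Dense (AddSubgroup.closure μ.support : Set ℝ)) : ∃ S, Tendsto f atTop (𝓝 S) := by
  have : NeBot (atTop ⊓ 𝓟 (Set.univ : Set ℝ)) := by simp only [principal_univ, inf_top_eq]; infer_instance
  have := h.exists_tendsto hf (A := Set.univ) (fun _ _ _ _ => trivial) fun ε hε => by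
    obtain ⟨r, hr, T, hT⟩ := hf ε hε
    obtain ⟨z, hzΓ, hz⟩ := hd.exists_between hr
    refine ⟨z, hzΓ, hz.1, T, fun t _ t' _ hTt htt' htz => hT t hTt t' ?_⟩
    rw [abs_of_nonneg (by linarith)]
    linarith [hz.2]
  simpa using this

/-- The lattice renewal theorem. -/
theorem exists_periodic (h : IsRenewal μ η B C f) (hf : EquicontinuousAtTop f) {d : ℝ}
    (hd : 0 < d) (hΓ : AddSubgroup.closure μ.support = AddSubgroup.zmultiples d) :
    ∃ w : ℝ → ℝ, (∀ t, |w t| ≤ B) ∧ Continuous w ∧ Function.Periodic w d ∧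
      Tendsto (fun t => f t - w t) atTop (𝓝 0) := by
  -- Each coset is invariant under the steps. Its points at distance below `d` coincide, so `z = d`
  -- trivially satisfies the oscillation condition.
  set A : ℝ → Set ℝ := fun a => {t | t - a ∈ AddSubgroup.zmultiples d} with hAdef
  have hseq : ∀ a, Tendsto (fun n : ℕ => a + n * d) atTop (atTop ⊓ 𝓟 (A a)) := fun a => by
    refine tendsto_inf.2 ⟨tendsto_atTop_add_const_left _ _
      (tendsto_natCast_atTop_atTop.atTop_mul_const hd), tendsto_principal.2 ?_⟩
    refine Eventually.of_forall fun n => ?_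
    exact AddSubgroup.mem_zmultiples_iff.2 ⟨n, by simp⟩
  have hne : ∀ a, NeBot (atTop ⊓ 𝓟 (A a)) := fun a => (hseq a).neBot
  have hlim : ∀ a, ∃ S, Tendsto f (atTop ⊓ 𝓟 (A a)) (𝓝 S) := fun a => by
    have := hne a
    refine h.exists_tendsto hf (fun t ht x hx => ?_) fun ε hε => ?_
    · have : x ∈ AddSubgroup.zmultiples d := hΓ ▸ AddSubgroup.subset_closure hx
      have := sub_mem (show t - a ∈ AddSubgroup.zmultiples d from ht) this
      rwa [sub_right_comm] at this
    · refine ⟨d, hΓ ▸ AddSubgroup.mem_zmultiples d, hd, 0, fun t ht t' ht' _ h1 h2 => ?_⟩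
      have h3 := sub_mem (show t' - a ∈ AddSubgroup.zmultiples d from ht')
        (show t - a ∈ AddSubgroup.zmultiples d from ht)
      obtain ⟨k, hk⟩ := AddSubgroup.mem_zmultiples_iff.1 h3
      have hk' : (k : ℝ) * d = t' - t := by rw [← zsmul_eq_mul, hk]; ring
      have hk0 : k = 0 := by
        have a1 : (0 : ℝ) ≤ k := by by_contra hc; push Not at hc; nlinarith
        have a2 : (k : ℝ) < 1 := by by_contra hc; push Not at hc; nlinarith
        have a1' : 0 ≤ k := by exact_mod_cast a1
        have a2' : k < 1 := by exact_mod_cast a2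
        omega
      have : t' = t := by rw [hk0] at hk'; simp at hk'; linarith
      rw [this]; simpa using hε.le
  choose w hw using hlim
  have hwseq : ∀ a, Tendsto (fun n : ℕ => f (a + n * d)) atTop (𝓝 (w a)) := fun a =>
    (hw a).comp (hseq a)
  have hbd : ∀ t, |w t| ≤ B := fun t => le_of_tendsto' (hwseq t).abs fun n => h.bound _
  have hper : Function.Periodic w d := fun t => by
    refine tendsto_nhds_unique (hwseq (t + d)) ?_
    refine ((hwseq t).comp (tendsto_add_atTop_nat 1)).congr fun n => ?_
    simp only [Function.comp]; push_cast; congr 1; ring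
  have hcont : ∀ ε > 0, ∃ r > 0, ∀ t t', |t' - t| ≤ r → |w t' - w t| ≤ ε := by
    intro ε hε
    obtain ⟨r, hr, T, hT⟩ := hf ε hε
    refine ⟨r, hr, fun t t' htt' => ?_⟩
    refine le_of_tendsto ((hwseq t').sub (hwseq t)).abs ?_
    have : Tendsto (fun n : ℕ => t + n * d) atTop atTop :=
      (hseq t).mono_right inf_le_left
    filter_upwards [this.eventually_ge_atTop T] with n hn
    exact hT _ hn _ (by simpa using htt')
  refine ⟨w, hbd, ?_, hper, ?_⟩
  · refine Metric.continuous_iff.2 fun t ε hε => ?_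
    obtain ⟨r, hr, hrr⟩ := hcont (ε / 2) (by positivity)
    refine ⟨r, hr, fun t' ht' => ?_⟩
    have := hrr t t' (by rw [← Real.dist_eq]; exact ht'.le)
    rw [Real.dist_eq]; linarith
  · refine Metric.tendsto_atTop.2 fun ε hε => ?_
    obtain ⟨r, hr, hrr⟩ := hcont (ε / 4) (by positivity)
    obtain ⟨r', hr', T, hT⟩ := hf (ε / 4) (by positivity)
    set m := min r r' with hm
    have hm0 : 0 < m := lt_min hr hr'
    -- Convergence on the `N` cosets of a net of mesh `d / N ≤ m` in one period becomes uniform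
    -- through the equicontinuity of `f` and `w`.
    obtain ⟨N, hN⟩ := exists_nat_gt (d / m)
    have hN0 : (0 : ℝ) < N := lt_trans (by positivity) hN
    set e := d / N with he
    have he0 : 0 < e := by positivity
    have hem : e ≤ m := by
      rw [div_lt_iff₀ hm0] at hN
      rw [he, div_le_iff₀ hN0]; linarith
    have hnet : ∀ᶠ n : ℕ in atTop, ∀ j ∈ Finset.range N,
        |f (j * e + n * d) - w (j * e)| < ε / 4 ∧ T ≤ j * e + n * d := by
      rw [eventually_all_finset]
      intro j _
      have h1 := Metric.tendsto_nhds.1 (hwseq (j * e)) (ε / 4) (by positivity)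
      have h2 : Tendsto (fun n : ℕ => (j : ℝ) * e + n * d) atTop atTop :=
        (hseq (j * e)).mono_right inf_le_left
      exact h1.and (h2.eventually_ge_atTop T)
    obtain ⟨n₀, hn₀⟩ := eventually_atTop.1 hnet
    refine ⟨n₀ * d, fun t ht => ?_⟩
    have ht0 : 0 ≤ t := le_trans (by positivity) ht
    set k := ⌊t / e⌋₊ with hk
    have hk1 : (k : ℝ) * e ≤ t := by
      have := Nat.floor_le (div_nonneg ht0 he0.le)
      rwa [le_div_iff₀ he0] at this
    have hk2 : t < (k + 1) * e := by
      have := Nat.lt_floor_add_one (t / e)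
      rwa [div_lt_iff₀ he0] at this
    have hNpos : 0 < N := by exact_mod_cast hN0
    have hdN : (N : ℝ) * e = d := by rw [he]; field_simp
    set q := k / N with hq
    set j := k % N with hj
    have hkqj : (k : ℝ) * e = j * e + q * d := by
      have : k = N * q + j := (Nat.div_add_mod k N).symm
      rw [this]; push_cast; rw [← hdN]; ring
    have hqn : n₀ ≤ q := by
      rw [hq, Nat.le_div_iff_mul_le hNpos]
      rw [hk, Nat.le_floor_iff (by positivity), le_div_iff₀ he0]
      push_cast
      rw [mul_assoc, hdN]; exact ht
    obtain ⟨h1, h2⟩ := hn₀ q hqn j (Finset.mem_range.2 (Nat.mod_lt _ hNpos))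
    have hdist : |t - (j * e + q * d)| ≤ m := by
      rw [← hkqj, abs_of_nonneg (by linarith)]; linarith
    have h3 := hT _ h2 t (hdist.trans (min_le_right _ _))
    have h4 := hrr (j * e + q * d) t (hdist.trans (min_le_left _ _))
    have h5 : w (j * e + q * d) = w (j * e) := hper.nat_mul q _
    rw [h5] at h4
    rw [Real.dist_eq, sub_zero]
    rw [abs_le] at h3 h4
    rw [abs_lt] at h1 ⊢
    constructor <;> linarith [h1.1, h1.2, h3.1, h3.2, h4.1, h4.2]

end IsRenewal

end Renewal

/-! ### The size-biased step law, the span and the renewal equation. -/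

namespace Model

variable {b : ℕ} (M : Model b)

/-- The size-biased law of `-log V`: the step distribution of the associated random walk. -/
def stepLaw (β : ℝ) : Measure ℝ :=
  ∑ i, (M.law.withDensity fun v => ENNReal.ofReal (v i ^ β)).map fun v => -Real.log (v i)

theorem measurable_density (β : ℝ) (i : Fin b) :
    Measurable fun v : Fin b → ℝ => ENNReal.ofReal (v i ^ β) :=
  ((measurable_pi_apply i).pow_const β).ennreal_ofReal

theorem measurable_neg_log (i : Fin b) : Measurable fun v : Fin b → ℝ => -Real.log (v i) :=
  (Real.measurable_log.comp (measurable_pi_apply i)).neg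

theorem integrable_stepLaw {β : ℝ} {g : ℝ → ℝ} (hg : Measurable g)
    (hi : ∀ i, Integrable (fun v => v i ^ β * g (-Real.log (v i))) M.law) :
    Integrable g (M.stepLaw β) ∧
      ∫ x, g x ∂M.stepLaw β = ∫ v, ∑ i, v i ^ β * g (-Real.log (v i)) ∂M.law := by
  have e : ∀ i, (fun v : Fin b → ℝ => (ENNReal.ofReal (v i ^ β)).toReal • g (-Real.log (v i)))
      =ᵐ[M.law] fun v => v i ^ β * g (-Real.log (v i)) := fun i => by
    filter_upwards [M.nonneg] with v hv
    rw [ENNReal.toReal_ofReal (Real.rpow_nonneg (hv i) _), smul_eq_mul]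
  have h1 : ∀ i, Integrable g ((M.law.withDensity fun v => ENNReal.ofReal (v i ^ β)).map
      fun v => -Real.log (v i)) := fun i => by
    rw [integrable_map_measure hg.aestronglyMeasurable (measurable_neg_log i).aemeasurable,
      integrable_withDensity_iff_integrable_smul' (measurable_density β i)
        (ae_of_all _ fun _ => ENNReal.ofReal_lt_top)]
    exact (hi i).congr (e i).symm
  refine ⟨integrable_finsetSum_measure.2 fun i _ => h1 i, ?_⟩
  rw [stepLaw, integral_finsetSum_measure fun i _ => h1 i, integral_finsetSum _ fun i _ => hi i]
  refine Finset.sum_congr rfl fun i _ => ?_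
  rw [integral_map (measurable_neg_log i).aemeasurable hg.aestronglyMeasurable,
    integral_withDensity_eq_integral_toReal_smul (measurable_density β i)
      (ae_of_all _ fun _ => ENNReal.ofReal_lt_top)]
  exact integral_congr_ae (e i)

/-- Zero splitters have weight `0 ^ β = 0`, so the conventional value `Real.log 0 = 0` never enters.
-/
theorem ae_stepLaw_iff {β : ℝ} {p : ℝ → Prop} (hp : MeasurableSet {x | p x}) (hβ : 0 < β) :
    (∀ᵐ x ∂M.stepLaw β, p x) ↔ ∀ᵐ v ∂M.law, ∀ i, 0 < v i → p (-Real.log (v i)) := by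
  have h1 : (∀ᵐ x ∂M.stepLaw β, p x) ↔
      ∀ i, ∀ᵐ x ∂(M.law.withDensity fun v => ENNReal.ofReal (v i ^ β)).map
        (fun v => -Real.log (v i)), p x := by
    simp only [ae_iff, stepLaw, Measure.finsetSum_apply, Finset.sum_eq_zero_iff, Finset.mem_univ,
      true_imp_iff]
  rw [h1, ae_all_iff]
  refine forall_congr' fun i => ?_
  rw [ae_map_iff (measurable_neg_log i).aemeasurable hp,
    ae_withDensity_iff (measurable_density β i)]
  refine eventually_congr ?_
  filter_upwards [M.nonneg] with v hv
  have : ENNReal.ofReal (v i ^ β) ≠ 0 ↔ 0 < v i := by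
    rw [Ne, ENNReal.ofReal_eq_zero, not_le]
    constructor
    · intro h
      refine (hv i).lt_of_ne fun h0 => ?_
      rw [← h0, Real.zero_rpow hβ.ne'] at h
      exact lt_irrefl _ h
    · exact fun h => Real.rpow_pos_of_pos h _
  rw [this]

theorem le_one_of_good {v : Fin b → ℝ} (hv : (∀ i, 0 ≤ v i) ∧ ∑ i, v i ≤ 1) (i : Fin b) :
    v i ≤ 1 :=
  (Finset.single_le_sum (fun j _ => hv.1 j) (Finset.mem_univ i)).trans hv.2

theorem integrable_bounded_step {β : ℝ} (hβ : 0 < β) {g : ℝ → ℝ} (hg : Measurable g) {K : ℝ}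
    (hK : ∀ x, 0 ≤ x → |g x| ≤ K) (i : Fin b) :
    Integrable (fun v => v i ^ β * g (-Real.log (v i))) M.law := by
  refine Integrable.of_bound (C := K) (((measurable_pi_apply i).pow_const β).mul
    (hg.comp (measurable_neg_log i))).aestronglyMeasurable ?_
  filter_upwards [M.ae_law_good] with v hv
  have h1 := le_one_of_good hv i
  have h2 := hK _ (neg_nonneg.2 (Real.log_nonpos (hv.1 i) h1))
  rw [Real.norm_eq_abs, abs_mul, abs_of_nonneg (Real.rpow_nonneg (hv.1 i) _)]
  exact (mul_le_mul (Real.rpow_le_one (hv.1 i) h1 hβ.le) h2 (abs_nonneg _) zero_le_one).trans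
    (one_mul K).le

/-- The total mass is `E ∑ V_i ^ β`, so this is the Malthusian equation. -/
theorem isProbabilityMeasure_stepLaw {β : ℝ} (hβ : M.IsMalthusian β) :
    IsProbabilityMeasure (M.stepLaw β) := by
  constructor
  have h1 : M.stepLaw β Set.univ = ∑ i, ∫⁻ v, ENNReal.ofReal (v i ^ β) ∂M.law := by
    rw [stepLaw, Measure.finsetSum_apply]
    refine Finset.sum_congr rfl fun i _ => ?_
    rw [Measure.map_apply (measurable_neg_log i) MeasurableSet.univ, Set.preimage_univ,
      withDensity_apply _ MeasurableSet.univ, Measure.restrict_univ]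
  have h2 : ∀ᵐ v ∂M.law, 0 ≤ ∑ i, v i ^ β := by
    filter_upwards [M.nonneg] with v hv
    exact Finset.sum_nonneg fun i _ => Real.rpow_nonneg (hv i) _
  rw [h1, ← lintegral_finsetSum _ fun i _ => measurable_density β i, ← ENNReal.ofReal_one,
    ← hβ.2.2, ofReal_integral_eq_lintegral_ofReal (M.integrable_sum_rpow hβ.1) h2]
  refine lintegral_congr_ae ?_
  filter_upwards [M.nonneg] with v hv
  exact (ENNReal.ofReal_sum_of_nonneg fun i _ => Real.rpow_nonneg (hv i) _).symm

theorem ae_stepLaw_nonneg {β : ℝ} (hβ : 0 < β) : ∀ᵐ x ∂M.stepLaw β, 0 ≤ x := by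
  rw [M.ae_stepLaw_iff measurableSet_Ici hβ]
  filter_upwards [M.ae_law_good] with v hv i _
  exact neg_nonneg.2 (Real.log_nonpos (hv.1 i) (le_one_of_good hv i))

theorem drift_stepLaw {β : ℝ} (hβ : 0 < β) : 0 < ∫ x, min x 1 ∂M.stepLaw β := by
  have hg : Measurable fun x : ℝ => min x 1 := measurable_id.min measurable_const
  have hi := M.integrable_bounded_step hβ hg (K := 1) fun x hx => by
    rw [abs_of_nonneg (le_min hx zero_le_one)]; exact min_le_right _ _
  rw [(M.integrable_stepLaw hg hi).2]
  have h0 : ∫ _v, (0 : ℝ) ∂M.law = 0 := by simp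
  rw [← h0]
  refine M.integral_lt_of_lt_on_pos (integrable_const _)
    (integrable_finsetSum _ fun i _ => hi i) ?_ ?_
  · filter_upwards [M.ae_law_good] with v hv
    exact Finset.sum_nonneg fun i _ => mul_nonneg (Real.rpow_nonneg (hv.1 i) _)
      (le_min (neg_nonneg.2 (Real.log_nonpos (hv.1 i) (le_one_of_good hv i))) zero_le_one)
  · intro v _ hv
    have hb := M.two_le_arity
    exact Finset.sum_pos (fun i _ => mul_pos (Real.rpow_pos_of_pos (hv i).1 _)
      (lt_min (neg_pos.2 (Real.log_neg (hv i).1 (hv i).2)) zero_lt_one))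
      ⟨⟨0, by omega⟩, Finset.mem_univ _⟩

/-- The bias `v ^ β` turns the integrand into `v ^ (β / 2) ≤ 1`; the rate `β / 2` is also that of
the error in the renewal equation. -/
theorem integrable_exp_stepLaw {β : ℝ} (hβ : 0 < β) :
    Integrable (fun x => Real.exp (β / 2 * x)) (M.stepLaw β) := by
  refine (M.integrable_stepLaw (by fun_prop) fun i => ?_).1
  refine Integrable.of_bound (C := 1) ((((measurable_pi_apply i).pow_const β).mul
    (Real.measurable_exp.comp ((measurable_neg_log i).const_mul _))).aestronglyMeasurable) ?_
  filter_upwards [M.ae_law_good] with v hv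
  rw [Real.norm_eq_abs, abs_of_nonneg (mul_nonneg (Real.rpow_nonneg (hv.1 i) _)
    (Real.exp_pos _).le)]
  rcases (hv.1 i).eq_or_lt with h | h
  · rw [← h, Real.zero_rpow hβ.ne']; simp
  · rw [Real.rpow_def_of_pos h, ← Real.exp_add, Real.exp_le_one_iff]
    have := Real.log_nonpos h.le (le_one_of_good hv i)
    nlinarith

/-! ### The span -/

/-- Since `d ℤ` is closed, lying in it almost surely is the same as containing the support. -/
theorem mem_spans_iff {β d : ℝ} (hβ : 0 < β) :
    d ∈ M.spans ↔ 0 < d ∧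
      AddSubgroup.closure (M.stepLaw β).support ≤ AddSubgroup.zmultiples d := by
  have hcl : IsClosed ((AddSubgroup.zmultiples d : AddSubgroup ℝ) : Set ℝ) :=
    AddSubgroup.isClosed_of_discrete
  have h1 : (∀ᵐ v ∂M.law, ∀ i, 0 < v i → ∃ k : ℤ, Real.log (v i) = k * d) ↔
      ∀ᵐ x ∂M.stepLaw β, x ∈ AddSubgroup.zmultiples d := by
    rw [M.ae_stepLaw_iff (p := fun x => x ∈ AddSubgroup.zmultiples d) hcl.measurableSet hβ]
    refine eventually_congr (ae_of_all _ fun v => forall_congr' fun i => imp_congr_right fun _ => ?_)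
    rw [neg_mem_iff, AddSubgroup.mem_zmultiples_iff]
    exact exists_congr fun k => by rw [zsmul_eq_mul, eq_comm]
  change 0 < d ∧ _ ↔ _
  rw [h1]
  refine and_congr_right fun _ => ⟨fun h => ?_, fun h => ?_⟩
  · exact (AddSubgroup.closure_le _).2 (Measure.support_subset_of_isClosed hcl h)
  · filter_upwards [Measure.support_mem_ae (μ := M.stepLaw β)] with x hx
    exact h (AddSubgroup.subset_closure hx)

/-- A subgroup of `ℝ` is dense or cyclic. A generator `a` is nonzero because of the drift, and `|a|`
is the largest span because every span divides it. -/
theorem lattice_cases {β : ℝ} (hβ : M.IsMalthusian β) :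
    (¬ M.IsLattice ∧ M.span = 0 ∧
      Dense (AddSubgroup.closure (M.stepLaw β).support : Set ℝ)) ∨
    (M.IsLattice ∧ 0 < M.span ∧
      AddSubgroup.closure (M.stepLaw β).support = AddSubgroup.zmultiples M.span) := by
  have hβ0 := hβ.1
  have := M.isProbabilityMeasure_stepLaw hβ
  rcases AddSubgroup.dense_or_cyclic (AddSubgroup.closure (M.stepLaw β).support) with hd | ⟨a, ha⟩
  · left
    have hno : ¬ M.IsLattice := by
      rintro ⟨d, hdm⟩
      obtain ⟨hd0, hle⟩ := (M.mem_spans_iff hβ0).1 hdm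
      obtain ⟨x, hx, hx0, hxd⟩ := hd.exists_between hd0
      obtain ⟨k, hk⟩ := AddSubgroup.mem_zmultiples_iff.1 (hle hx)
      rw [zsmul_eq_mul] at hk
      have h1 : (0 : ℝ) < k := by by_contra hc; push Not at hc; nlinarith
      have h2 : (k : ℝ) < 1 := by by_contra hc; push Not at hc; nlinarith
      have h1' : 0 < k := by exact_mod_cast h1
      have h2' : k < 1 := by exact_mod_cast h2
      omega
    refine ⟨hno, ?_, hd⟩
    rw [span, Set.not_nonempty_iff_eq_empty.1 hno, Real.sSup_empty]
  · right
    rw [← AddSubgroup.zmultiples_eq_closure] at ha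
    have ha' : AddSubgroup.closure (M.stepLaw β).support = AddSubgroup.zmultiples |a| := by
      rw [ha]
      rcases abs_choice a with h | h <;> rw [h]
      exact AddSubgroup.zmultiples_neg.symm
    have hane : a ≠ 0 := by
      rintro rfl
      have h0 : ∀ᵐ x ∂M.stepLaw β, min x 1 = 0 := by
        filter_upwards [Measure.support_mem_ae (μ := M.stepLaw β)] with x hx
        have : x ∈ AddSubgroup.zmultiples (0 : ℝ) := ha ▸ AddSubgroup.subset_closure hx
        simp only [AddSubgroup.zmultiples_zero_eq_bot, AddSubgroup.mem_bot] at this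
        simp [this]
      have := M.drift_stepLaw hβ0
      rw [integral_congr_ae h0] at this
      simp at this
    have hapos : 0 < |a| := abs_pos.2 hane
    have hmem : |a| ∈ M.spans := (M.mem_spans_iff hβ0).2 ⟨hapos, ha'.le⟩
    have hgreatest : IsGreatest M.spans |a| := by
      refine ⟨hmem, fun d hd => ?_⟩
      obtain ⟨hd0, hle⟩ := (M.mem_spans_iff hβ0).1 hd
      rw [ha'] at hle
      obtain ⟨k, hk⟩ := AddSubgroup.mem_zmultiples_iff.1 (hle (AddSubgroup.mem_zmultiples |a|))
      rw [zsmul_eq_mul] at hk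
      have h1 : (0 : ℝ) < k := by by_contra hc; push Not at hc; nlinarith
      have h1' : 0 < k := by exact_mod_cast h1
      have h2 : (1 : ℝ) ≤ k := by exact_mod_cast h1'
      nlinarith
    have hspan : M.span = |a| := hgreatest.csSup_eq
    rw [hspan]
    exact ⟨⟨_, hmem⟩, hapos, ha'⟩

/-! ### The renewal equation for the number of nodes with `k` balls -/

/-- The Hölder bound turns the deviation of a child size into an error of order `y ^ (β / 2)`. The
summand `2` in the constant absorbs the rounding of `y` and of `y * v i`. -/
theorem abs_sub_sum_floor_le {β : ℝ} (hβ0 : 0 < β) (hβ1 : β ≤ 1) {u : ℕ → ℝ} {k : ℕ} {C : ℝ}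
    (hC0 : 0 ≤ C) (hC : ∀ n m : ℕ, |u n - u m| ≤ C * |(n : ℝ) - m| ^ β)
    (hT : ∀ n, k < n → u n = M.T u n) :
    ∃ K, ∀ y : ℝ, ((max M.s k + 1 : ℕ) : ℝ) ≤ y →
      (∀ i : Fin b, Integrable (fun v : Fin b → ℝ => u ⌊y * v i⌋₊) M.law) ∧
      |u ⌊y⌋₊ - ∫ v, ∑ i : Fin b, u ⌊y * v i⌋₊ ∂M.law| ≤ K * y ^ (β / 2) := by
  obtain ⟨C', hC'1, hC'⟩ := M.integral_rpow_dev_le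
  refine ⟨b * (C * (C' + 2)), fun y hy => ?_⟩
  have hy1 : (1 : ℝ) ≤ y := le_trans (by exact_mod_cast Nat.le_add_left _ _) hy
  have hy0 : 0 ≤ y := by linarith
  have hn : max M.s k + 1 ≤ ⌊y⌋₊ := Nat.le_floor hy
  set n := ⌊y⌋₊ with hndef
  have hs : M.s < n := lt_of_lt_of_le (Nat.lt_succ_of_le (le_max_left _ _)) hn
  have hk : k < n := lt_of_lt_of_le (Nat.lt_succ_of_le (le_max_right _ _)) hn
  have hny : (n : ℝ) ≤ y := Nat.floor_le hy0
  have hyn : y < n + 1 := Nat.lt_floor_add_one y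
  have hmeas : ∀ i : Fin b, Measurable fun v : Fin b → ℝ => u ⌊y * v i⌋₊ := fun i =>
    measurable_from_nat.comp
      (Nat.measurable_floor.comp (measurable_const.mul (measurable_pi_apply i)))
  have hbd : ∀ i : Fin b, ∀ v : Fin b → ℝ, ((∀ i, 0 ≤ v i) ∧ ∑ i, v i ≤ 1) →
      |u ⌊y * v i⌋₊| ≤ ∑ j ∈ Finset.range (n + 1), |u j| := fun i v hv =>
    Finset.single_le_sum (f := fun j => |u j|) (fun _ _ => abs_nonneg _)
      (Finset.mem_range.2 (Nat.lt_succ_of_le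
        (Nat.floor_mono (mul_le_of_le_one_right hy0 (le_one_of_good hv i)))))
  have hint : ∀ i : Fin b, Integrable (fun v : Fin b → ℝ => u ⌊y * v i⌋₊) M.law := fun i => by
    refine Integrable.of_bound (hmeas i).aestronglyMeasurable
      (∑ j ∈ Finset.range (n + 1), |u j|) ?_
    filter_upwards [M.ae_law_good] with v hv using hbd i v hv
  have hint' : ∀ i : Fin b, Integrable (fun x : NodeSource b => u ⌊y * x.1 i⌋₊) M.nodeLaw := by
    intro i
    refine Integrable.of_bound ((hmeas i).comp measurable_fst).aestronglyMeasurable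
      (∑ j ∈ Finset.range (n + 1), |u j|) ?_
    filter_upwards [M.ae_nodeLaw_good] with x hx using hbd i x.1 hx
  refine ⟨hint, ?_⟩
  rw [hT n hk, T_eq_sum_integral, integral_finsetSum _ fun i _ => hint i, ← Finset.sum_sub_distrib]
  refine (Finset.abs_sum_le_sum_abs _ _).trans ?_
  calc _ ≤ ∑ _i : Fin b, C * (C' + 2) * y ^ (β / 2) := by
        refine Finset.sum_le_sum fun i _ => ?_
        obtain ⟨hd, hdle⟩ := hC' β hβ0 hβ1 n hs i
        rw [← M.integral_fst_nodeLaw fun v => u ⌊y * v i⌋₊,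
          ← integral_sub (M.integrable_childSize _ _ i) (hint' i)]
        refine abs_integral_le_integral_abs.trans ?_
        calc ∫ x, |u (M.childSize x n i) - u ⌊y * x.1 i⌋₊| ∂M.nodeLaw
            ≤ ∫ x, C * (|(M.childSize x n i : ℝ) - n * x.1 i| ^ β + 2) ∂M.nodeLaw := by
              refine integral_mono_ae ((M.integrable_childSize _ _ i).sub (hint' i)).abs
                ((hd.add (integrable_const _)).const_mul C) ?_
              filter_upwards [M.ae_nodeLaw_good] with x hx
              refine (hC _ _).trans (mul_le_mul_of_nonneg_left ?_ hC0)
              have h1 := hx.1 i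
              have h2 := le_one_of_good hx i
              have h3 := Nat.floor_le (mul_nonneg hy0 h1)
              have h4 := Nat.lt_floor_add_one (y * x.1 i)
              have h5 : |(M.childSize x n i : ℝ) - (⌊y * x.1 i⌋₊ : ℕ)| ≤
                  |(M.childSize x n i : ℝ) - n * x.1 i| + 2 := by
                have h6 : |(n : ℝ) * x.1 i - (⌊y * x.1 i⌋₊ : ℕ)| ≤ 2 := by
                  rw [abs_le]; constructor <;> nlinarith
                exact (abs_sub_le _ ((n : ℝ) * x.1 i) _).trans (by linarith)
              refine (Real.rpow_le_rpow (abs_nonneg _) h5 hβ0.le).trans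
                ((Real.rpow_add_le_add_rpow (abs_nonneg _) zero_le_two hβ0.le hβ1).trans ?_)
              have : (2 : ℝ) ^ β ≤ 2 := by
                have := Real.rpow_le_rpow_of_exponent_le one_le_two hβ1
                rwa [Real.rpow_one] at this
              linarith
          _ = C * (∫ x, |(M.childSize x n i : ℝ) - n * x.1 i| ^ β ∂M.nodeLaw + 2) := by
              rw [integral_const_mul, integral_add hd (integrable_const _)]; simp
          _ ≤ C * (C' + 2) * y ^ (β / 2) := by
              rw [mul_assoc]
              refine mul_le_mul_of_nonneg_left ?_ hC0
              have h1 : (n : ℝ) ^ (β / 2) ≤ y ^ (β / 2) :=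
                Real.rpow_le_rpow (Nat.cast_nonneg _) hny (by positivity)
              have h2 : 1 ≤ y ^ (β / 2) := Real.one_le_rpow hy1 (by positivity)
              nlinarith
    _ = b * (C * (C' + 2)) * y ^ (β / 2) := by simp; ring

/-- The rescaled function `e ^ (-β t) u (⌊e ^ t⌋)`. -/
def rescale (β : ℝ) (u : ℕ → ℝ) (t : ℝ) : ℝ := u ⌊Real.exp t⌋₊ * Real.exp (-β * t)

theorem rescale_log {β : ℝ} (u : ℕ → ℝ) {n : ℕ} (hn : 1 ≤ n) :
    rescale β u (Real.log n) = u n / (n : ℝ) ^ β := by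
  have hn0 : (0 : ℝ) < n := by exact_mod_cast hn
  rw [rescale, Real.exp_log hn0, Nat.floor_natCast, div_eq_mul_inv, ← Real.rpow_neg hn0.le,
    Real.rpow_def_of_pos hn0, mul_comm (-β)]

theorem measurable_rescale (β : ℝ) (u : ℕ → ℝ) : Measurable (rescale β u) :=
  (measurable_from_nat.comp (Nat.measurable_floor.comp Real.measurable_exp)).mul
    (Real.measurable_exp.comp (measurable_const.mul measurable_id))

theorem abs_rescale_le {β : ℝ} (hβ : 0 ≤ β) {u : ℕ → ℝ} {A : ℝ} (hA0 : 0 ≤ A)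
    (hA : ∀ n : ℕ, |u n| ≤ A * (n : ℝ) ^ β) (t : ℝ) : |rescale β u t| ≤ A := by
  rw [rescale, abs_mul, abs_of_pos (Real.exp_pos _)]
  have h1 : ((⌊Real.exp t⌋₊ : ℕ) : ℝ) ^ β ≤ Real.exp (β * t) := by
    rw [mul_comm, Real.exp_mul]
    exact Real.rpow_le_rpow (Nat.cast_nonneg _) (Nat.floor_le (Real.exp_pos t).le) hβ
  calc |u ⌊Real.exp t⌋₊| * Real.exp (-β * t) ≤ A * Real.exp (β * t) * Real.exp (-β * t) :=
        mul_le_mul_of_nonneg_right ((hA _).trans (mul_le_mul_of_nonneg_left h1 hA0))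
          (Real.exp_pos _).le
    _ = A := by rw [mul_assoc, ← Real.exp_add]; simp

/-- The scaling `e ^ (-β t)` matches the Hölder exponent, so the modulus depends on `t' - t` only,
up to a rounding error `C * e ^ (-β t')` that vanishes at infinity. -/
theorem equicontinuousAtTop_rescale {β : ℝ} (hβ0 : 0 < β) (hβ1 : β ≤ 1) {u : ℕ → ℝ} {A C : ℝ}
    (hA0 : 0 ≤ A) (hC0 : 0 ≤ C) (hA : ∀ n : ℕ, |u n| ≤ A * (n : ℝ) ^ β)
    (hC : ∀ n m : ℕ, |u n - u m| ≤ C * |(n : ℝ) - m| ^ β) :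
    EquicontinuousAtTop (rescale β u) := by
  intro ε hε
  have hcont : Tendsto (fun x : ℝ => C * |1 - Real.exp (-x)| ^ β + A * |Real.exp (-β * x) - 1|)
      (𝓝 0) (𝓝 0) := by
    have h1 : Continuous fun x : ℝ => |1 - Real.exp (-x)| := by fun_prop
    have h2 : Continuous fun x : ℝ => C * |1 - Real.exp (-x)| ^ β + A * |Real.exp (-β * x) - 1| :=
      ((h1.rpow_const fun _ => Or.inr hβ0.le).const_mul C |>.add (by fun_prop))
    have h3 := h2.tendsto 0
    simpa [Real.zero_rpow hβ0.ne'] using h3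
  obtain ⟨r, hr, hr'⟩ := Metric.eventually_nhds_iff.1 (hcont.eventually_lt_const (half_pos hε))
  have hexp : ∀ᶠ t : ℝ in atTop, C * Real.exp (-β * t) < ε / 2 := by
    have : Tendsto (fun t : ℝ => Real.exp (-β * t)) atTop (𝓝 0) :=
      Real.tendsto_exp_atBot.comp (tendsto_id.const_mul_atTop_of_neg (by linarith))
    exact (this.const_mul C).eventually_lt_const (by rw [mul_zero]; positivity)
  obtain ⟨T, hT⟩ := eventually_atTop.1 hexp
  refine ⟨r / 2, by positivity, T + r, fun t ht t' htt' => ?_⟩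
  have h1 := hr' (y := t' - t) (by rw [dist_zero_right, Real.norm_eq_abs]; linarith)
  have h2 := hT t' (by have := (abs_le.1 htt').1; linarith)
  set n := ⌊Real.exp t⌋₊ with hn
  set n' := ⌊Real.exp t'⌋₊ with hn'
  have e : rescale β u t' - rescale β u t =
      (u n' - u n) * Real.exp (-β * t') + rescale β u t * (Real.exp (-β * (t' - t)) - 1) := by
    have : Real.exp (-β * t') = Real.exp (-β * t) * Real.exp (-β * (t' - t)) := by
      rw [← Real.exp_add]; congr 1; ring
    simp only [rescale, ← hn, ← hn']
    rw [this]; ring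
  have h3 : |(n' : ℝ) - n| ≤ |Real.exp t' - Real.exp t| + 1 := by
    have a1 := Nat.floor_le (Real.exp_pos t).le
    have a2 := Nat.lt_floor_add_one (Real.exp t)
    have a3 := Nat.floor_le (Real.exp_pos t').le
    have a4 := Nat.lt_floor_add_one (Real.exp t')
    have a5 := le_abs_self (Real.exp t' - Real.exp t)
    have a6 := neg_abs_le (Real.exp t' - Real.exp t)
    rw [abs_le]; constructor <;> linarith
  have h4 : |(n' : ℝ) - n| ^ β ≤ |Real.exp t' - Real.exp t| ^ β + 1 := by
    refine (Real.rpow_le_rpow (abs_nonneg _) h3 hβ0.le).trans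
      ((Real.rpow_add_le_add_rpow (abs_nonneg _) zero_le_one hβ0.le hβ1).trans ?_)
    rw [Real.one_rpow]
  have h5 : |Real.exp t' - Real.exp t| ^ β * Real.exp (-β * t') =
      |1 - Real.exp (-(t' - t))| ^ β := by
    have a1 : Real.exp t' - Real.exp t = Real.exp t' * (1 - Real.exp (-(t' - t))) := by
      rw [mul_sub, ← Real.exp_add]; simp
    rw [a1, abs_mul, abs_of_pos (Real.exp_pos _), Real.mul_rpow (Real.exp_pos _).le (abs_nonneg _),
      ← Real.exp_mul, mul_right_comm, ← Real.exp_add]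
    simp [mul_comm]
  rw [e]
  refine (abs_add_le _ _).trans ?_
  rw [abs_mul, abs_mul, abs_of_pos (Real.exp_pos _)]
  have h6 : |u n' - u n| * Real.exp (-β * t') ≤
      C * |1 - Real.exp (-(t' - t))| ^ β + C * Real.exp (-β * t') := by
    calc |u n' - u n| * Real.exp (-β * t')
        ≤ C * (|Real.exp t' - Real.exp t| ^ β + 1) * Real.exp (-β * t') :=
          mul_le_mul_of_nonneg_right ((hC _ _).trans (mul_le_mul_of_nonneg_left h4 hC0))
            (Real.exp_pos _).le
      _ = _ := by rw [← h5]; ring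
  have h7 := mul_le_mul_of_nonneg_right (abs_rescale_le hβ0.le hA0 hA t)
    (abs_nonneg (Real.exp (-β * (t' - t)) - 1))
  linarith

theorem isRenewal_rescale {β : ℝ} (hβ : M.IsMalthusian β) {u : ℕ → ℝ} {k : ℕ} {A C : ℝ}
    (hA0 : 0 ≤ A) (hC0 : 0 ≤ C) (hu0 : u 0 = 0) (hA : ∀ n : ℕ, |u n| ≤ A * (n : ℝ) ^ β)
    (hC : ∀ n m : ℕ, |u n - u m| ≤ C * |(n : ℝ) - m| ^ β) (hT : ∀ n, k < n → u n = M.T u n) :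
    ∃ K, IsRenewal (M.stepLaw β) (β / 2) A K (rescale β u) := by
  have hβ0 := hβ.1
  have hprob := M.isProbabilityMeasure_stepLaw hβ
  obtain ⟨K, hK⟩ := M.abs_sub_sum_floor_le hβ0 hβ.2.1 hC0 hC hT
  have hbound := abs_rescale_le hβ0.le hA0 hA
  set N : ℝ := ((max M.s k + 1 : ℕ) : ℝ) with hN
  have hN1 : 1 ≤ N := by rw [hN]; exact_mod_cast Nat.le_add_left _ _
  have hN0 : 0 < N := by linarith
  refine ⟨|K| + 2 * A * N ^ (β / 2), by positivity, M.ae_stepLaw_nonneg hβ0, M.drift_stepLaw hβ0,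
    M.integrable_exp_stepLaw hβ0, measurable_rescale β u, hbound, fun t => ?_⟩
  have hNpow : 0 ≤ 2 * A * N ^ (β / 2) := by positivity
  -- Below `N` the recursion is not available, but the two sides differ by at most `2 * A`, which
  -- the constant absorbs.
  rcases lt_or_ge (Real.exp t) N with hlt | hge
  · have h1 : |∫ x, rescale β u (t - x) ∂M.stepLaw β| ≤ A := by
      have := norm_integral_le_of_norm_le_const (μ := M.stepLaw β)
        (f := fun x => rescale β u (t - x)) (ae_of_all _ fun x => hbound (t - x))
      simpa using this
    have h2 : 1 ≤ N ^ (β / 2) * Real.exp (-(β / 2) * t) := by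
      rw [← Real.exp_log hN0, ← Real.exp_mul, ← Real.exp_add]
      refine Real.one_le_exp ?_
      have : t ≤ Real.log N := by
        rw [← Real.log_exp t]; exact Real.log_le_log (Real.exp_pos t) hlt.le
      nlinarith
    have h3 : 2 * A ≤ 2 * A * N ^ (β / 2) * Real.exp (-(β / 2) * t) := by
      rw [mul_assoc]; exact le_mul_of_one_le_right (by positivity) h2
    have h4 : 0 ≤ |K| * Real.exp (-(β / 2) * t) := by positivity
    have h5 := abs_sub (rescale β u t) (∫ x, rescale β u (t - x) ∂M.stepLaw β)
    have h6 := hbound t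
    rw [add_mul]
    linarith
  · obtain ⟨hi, hle⟩ := hK (Real.exp t) hge
    have hmeas : Measurable fun x : ℝ => rescale β u (t - x) :=
      (measurable_rescale β u).comp (measurable_const.sub measurable_id)
    have e1 := (M.integrable_stepLaw hmeas
      (M.integrable_bounded_step hβ0 hmeas fun x _ => hbound (t - x))).2
    have e2 : ∫ v, ∑ i, v i ^ β * rescale β u (t - -Real.log (v i)) ∂M.law =
        (∫ v, ∑ i : Fin b, u ⌊Real.exp t * v i⌋₊ ∂M.law) * Real.exp (-β * t) := by
      rw [← integral_mul_const]
      refine integral_congr_ae ?_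
      filter_upwards [M.nonneg] with v hv
      rw [Finset.sum_mul]
      refine Finset.sum_congr rfl fun i _ => ?_
      rcases (hv i).eq_or_lt with h | h
      -- A zero splitter contributes nothing to either side because `u 0 = 0`.
      · rw [← h, Real.zero_rpow hβ0.ne']; simp [hu0]
      · rw [rescale, sub_neg_eq_add, Real.exp_add, Real.exp_log h, mul_add, Real.exp_add,
          Real.rpow_def_of_pos h]
        have : Real.exp (Real.log (v i) * β) * Real.exp (-β * Real.log (v i)) = 1 := by
          rw [← Real.exp_add]; simp [mul_comm]
        linear_combination (u ⌊Real.exp t * v i⌋₊ * Real.exp (-β * t)) * this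
    rw [e1, e2, rescale, ← sub_mul, abs_mul, abs_of_pos (Real.exp_pos _)]
    have e3 : Real.exp t ^ (β / 2) * Real.exp (-β * t) = Real.exp (-(β / 2) * t) := by
      rw [← Real.exp_mul, ← Real.exp_add]; congr 1; ring
    calc _ ≤ K * Real.exp t ^ (β / 2) * Real.exp (-β * t) :=
          mul_le_mul_of_nonneg_right hle (Real.exp_pos _).le
      _ = K * Real.exp (-(β / 2) * t) := by rw [mul_assoc, e3]
      _ ≤ _ := mul_le_mul_of_nonneg_right (by linarith [le_abs_self K]) (Real.exp_pos _).le

/-- The asymptotics of the expected number of nodes with `k` balls. -/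
theorem exists_limit_function {β : ℝ} (hβ : M.IsMalthusian β) {u : ℕ → ℝ} {k : ℕ} {A C : ℝ}
    (hA0 : 0 ≤ A) (hC0 : 0 ≤ C) (hu0 : u 0 = 0) (hA : ∀ n : ℕ, |u n| ≤ A * (n : ℝ) ^ β)
    (hC : ∀ n m : ℕ, |u n - u m| ≤ C * |(n : ℝ) - m| ^ β) (hT : ∀ n, k < n → u n = M.T u n) :
    ∃ w : ℝ → ℝ, (∃ K, ∀ t, |w t| ≤ K) ∧ Continuous w ∧ Function.Periodic w M.span ∧
      (¬ M.IsLattice → ∃ c, ∀ t, w t = c) ∧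
      Tendsto (fun n : ℕ => u n / (n : ℝ) ^ β - w (Real.log n)) atTop (𝓝 0) := by
  obtain ⟨K, hren⟩ := M.isRenewal_rescale hβ hA0 hC0 hu0 hA hC hT
  have heq := equicontinuousAtTop_rescale hβ.1 hβ.2.1 hA0 hC0 hA hC
  have hprob := M.isProbabilityMeasure_stepLaw hβ
  have hlog : Tendsto (fun n : ℕ => Real.log n) atTop atTop :=
    Real.tendsto_log_atTop.comp tendsto_natCast_atTop_atTop
  have htrans : ∀ w : ℝ → ℝ, Tendsto (fun t => rescale β u t - w t) atTop (𝓝 0) →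
      Tendsto (fun n : ℕ => u n / (n : ℝ) ^ β - w (Real.log n)) atTop (𝓝 0) := fun w hw => by
    refine (hw.comp hlog).congr' ?_
    filter_upwards [eventually_ge_atTop 1] with n hn
    simp only [Function.comp, rescale_log u hn]
  rcases M.lattice_cases hβ with ⟨hno, hspan, hd⟩ | ⟨hl, hspan, hΓ⟩
  · obtain ⟨S, hS⟩ := hren.exists_tendsto_of_dense heq hd
    refine ⟨fun _ => S, ⟨|S|, fun _ => le_rfl⟩, continuous_const, fun _ => rfl,
      fun _ => ⟨S, fun _ => rfl⟩, htrans (fun _ => S) ?_⟩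
    simpa using hS.sub_const S
  · obtain ⟨w, h1, h2, h3, h4⟩ := hren.exists_periodic heq hspan hΓ
    exact ⟨w, ⟨A, h1⟩, h2, h3, fun h => absurd hl h, htrans w h4⟩

end Model

/-! ### The additive functional as a sum over words. -/

open Classical in
/-- The contribution of the node `v` to the additive functional of `φ`. -/
def nodeToll {b : ℕ} (φ : BallTree b → ℝ) (v : Node b) (t : BallTree b) : ℝ :=
  if v ∈ t.nodes then φ (t.fringe v) else 0

/-- The words of length less than `L`. -/
def wordsLT (b : ℕ) : ℕ → Finset (Node b)
  | 0 => ∅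
  | L + 1 => insert [] ((Finset.univ ×ˢ wordsLT b L).image fun p => p.1 :: p.2)

theorem mem_wordsLT {b L : ℕ} {v : Node b} : v ∈ wordsLT b L ↔ v.length < L := by
  induction L generalizing v with
  | zero => simp [wordsLT]
  | succ L ih =>
    cases v with
    | nil => simp [wordsLT]
    | cons i w => simp [wordsLT, ih]

theorem tendsto_wordsLT (b : ℕ) : Tendsto (wordsLT b) atTop atTop := by
  refine tendsto_atTop_finset_of_monotone (fun L L' h v hv => ?_) fun v => ?_
  · rw [mem_wordsLT] at *; omega
  · exact ⟨v.length + 1, mem_wordsLT.2 (Nat.lt_succ_self _)⟩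

namespace Model

variable {b : ℕ} (M : Model b)

instance : IsProbabilityMeasure M.sourceLaw := by unfold sourceLaw; infer_instance

theorem measurable_split (i : Fin b) :
    Measurable fun ω : Source b => ((ω [], fun w => ω (i :: w)) : NodeSource b × Source b) :=
  (measurable_pi_apply _).prodMk (measurable_pi_lambda _ fun _ => measurable_pi_apply _)

/-- The randomness at the root is independent of the randomness at the descendants of a child. -/
theorem measurePreserving_split (i : Fin b) :
    MeasurePreserving (fun ω : Source b => ((ω [], fun w => ω (i :: w)) : NodeSource b × Source b))
      M.sourceLaw (M.nodeLaw.prod M.sourceLaw) := by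
  classical
  refine ⟨measurable_split i, ?_⟩
  -- Both laws are compared as product measures indexed by `Option (Node b)`, with `none` for the
  -- root and `some w` for `i :: w`; they agree on boxes.
  let e : Option (Node b) → Node b := fun o => o.elim [] (fun w => i :: w)
  have he : Function.Injective e := by
    rintro (_ | w) (_ | w') h <;> simp_all [e]
  let Ψ : Source b → (Option (Node b) → NodeSource b) := fun ω o => ω (e o)
  let Θ : NodeSource b × Source b → (Option (Node b) → NodeSource b) := fun p o =>
    o.elim p.1 p.2
  let Ξ : (Option (Node b) → NodeSource b) → NodeSource b × Source b := fun g =>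
    (g none, fun w => g (some w))
  have hΨ : Measurable Ψ := measurable_pi_lambda _ fun _ => measurable_pi_apply _
  have hΘ : Measurable Θ := measurable_pi_lambda _ fun o => by
    cases o with
    | none => exact measurable_fst
    | some w => exact (measurable_pi_apply w).comp measurable_snd
  have hΞ : Measurable Ξ :=
    (measurable_pi_apply _).prodMk (measurable_pi_lambda _ fun _ => measurable_pi_apply _)
  have h1 : M.sourceLaw.map Ψ = Measure.infinitePi fun _ : Option (Node b) => M.nodeLaw := by
    refine Measure.eq_infinitePi _ fun s t ht => ?_
    rw [Measure.map_apply hΨ (MeasurableSet.pi s.countable_toSet fun o _ => ht o)]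
    have : Ψ ⁻¹' (s : Set (Option (Node b))).pi t =
        ((s.image e : Finset (Node b)) : Set (Node b)).pi
          fun v => t (Function.invFun e v) := by
      ext ω
      simp only [Set.mem_preimage, Set.mem_pi, Finset.coe_image, Set.forall_mem_image]
      refine forall₂_congr fun o _ => ?_
      rw [Function.leftInverse_invFun he o]
    rw [this, sourceLaw, Measure.infinitePi_pi _ fun v _ => ht _,
      Finset.prod_image fun x _ y _ h => he h]
    exact Finset.prod_congr rfl fun o _ => by rw [Function.leftInverse_invFun he o]
  have h2 : (M.nodeLaw.prod M.sourceLaw).map Θ =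
      Measure.infinitePi fun _ : Option (Node b) => M.nodeLaw := by
    refine Measure.eq_infinitePi _ fun s t ht => ?_
    rw [Measure.map_apply hΘ (MeasurableSet.pi s.countable_toSet fun o _ => ht o)]
    -- Unconstrained coordinates get `Set.univ`, so `none ∈ s` needs no case distinction.
    set t' : Option (Node b) → Set (NodeSource b) := fun o => if o ∈ s then t o else Set.univ
      with ht'
    have hmt' : ∀ o, MeasurableSet (t' o) := fun o => by
      simp only [ht']; split_ifs
      · exact ht o
      · exact MeasurableSet.univ
    have hset : Θ ⁻¹' (s : Set (Option (Node b))).pi t =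
        t' none ×ˢ ((Finset.eraseNone s : Finset (Node b)) : Set (Node b)).pi
          fun w => t' (some w) := by
      ext p
      simp only [Set.mem_preimage, Set.mem_pi, Set.mem_prod, Finset.mem_coe, Finset.mem_eraseNone,
        ht', Option.forall, Θ, Option.elim]
      refine and_congr ?_ (forall_congr' fun w => ?_)
      · by_cases h : none ∈ s <;> simp [h]
      · by_cases h : some w ∈ s <;> simp [h]
    rw [hset, Measure.prod_prod, sourceLaw, Measure.infinitePi_pi _ fun w _ => hmt' _]
    have h3 : ∏ o ∈ s, M.nodeLaw (t o) =
        ∏ o ∈ Finset.insertNone (Finset.eraseNone s), M.nodeLaw (t' o) := by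
      rw [Finset.insertNone_eraseNone]
      rw [Finset.prod_congr rfl fun o ho => (by simp only [ht', if_pos ho] :
        M.nodeLaw (t o) = M.nodeLaw (t' o))]
      refine Finset.prod_subset (Finset.subset_insert _ _) fun o _ ho => ?_
      simp only [ht', if_neg ho, measure_univ]
    rw [h3, Finset.prod_insertNone]
  calc M.sourceLaw.map (fun ω : Source b => (ω [], fun w => ω (i :: w)))
      = (M.sourceLaw.map Ψ).map Ξ := (Measure.map_map hΞ hΨ).symm
    _ = ((M.nodeLaw.prod M.sourceLaw).map Θ).map Ξ := by rw [h1, h2]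
    _ = (M.nodeLaw.prod M.sourceLaw).map id := Measure.map_map hΞ hΘ
    _ = _ := Measure.map_id

theorem nodeToll_nil (φ : BallTree b → ℝ) (n : ℕ) (ω : Source b) :
    nodeToll φ [] (M.tree n ω) = if n = 0 then 0 else φ (M.tree n ω) := by
  have h : ([] : Node b) ∈ (M.tree n ω).nodes ↔ n ≠ 0 := Nat.pos_iff_ne_zero
  unfold nodeToll
  by_cases hn : n = 0
  · rw [if_neg (by rw [h]; simpa using hn), if_pos hn]
  · rw [if_pos (h.2 hn), if_neg hn]; rfl

theorem nodeToll_cons (φ : BallTree b → ℝ) (i : Fin b) (w : Node b) (n : ℕ) (ω : Source b) :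
    nodeToll φ (i :: w) (M.tree n ω) =
      nodeToll φ w (M.tree (M.childSize (ω []) n i) fun v => ω (i :: v)) := rfl

/-- The expected contribution of the node `v` of a tree with `n` balls to an additive functional
whose toll function has expectation `g k` on a tree with `k` balls. -/
def visit : Node b → (ℕ → ℝ) → ℕ → ℝ
  | [], g, n => g n
  | i :: w, g, n =>
    ∑ k ∈ Finset.range (n + 1), M.nodeLaw.real {x | M.childSize x n i = k} * visit w g k

/-- The expected toll of a tree with `n` balls, where an empty tree has toll `0`. -/
def tollFun (φ : BallTree b → ℝ) (n : ℕ) : ℝ := if n = 0 then 0 else M.meanToll φ n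

theorem tollFun_zero (φ : BallTree b → ℝ) : M.tollFun φ 0 = 0 := if_pos rfl

/-- Induction on the word. Given that the first child on the path has `k` balls, its subtree is a
tree `T_k` built from randomness independent of the root, and only the finitely many values `k ≤ n`
occur. -/
theorem integrable_nodeToll {φ : BallTree b → ℝ}
    (hφ : ∀ n : ℕ, 1 ≤ n → Integrable (fun ω => φ (M.tree n ω)) M.sourceLaw) (v : Node b) (n : ℕ) :
    Integrable (fun ω => nodeToll φ v (M.tree n ω)) M.sourceLaw ∧
      ∫ ω, nodeToll φ v (M.tree n ω) ∂M.sourceLaw = M.visit v (M.tollFun φ) n := by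
  induction v generalizing n with
  | nil =>
    simp_rw [nodeToll_nil]
    rcases Nat.eq_zero_or_pos n with rfl | hn
    · simp [visit, tollFun]
    · simp only [hn.ne', if_false, visit, tollFun]
      exact ⟨hφ n hn, rfl⟩
  | cons i w ih =>
    have hm : ∀ k, MeasurableSet {x : NodeSource b | M.childSize x n i = k} := fun k =>
      M.measurable_childSize n i (measurableSet_singleton k)
    set G : NodeSource b × Source b → ℝ := fun p => ∑ k ∈ Finset.range (n + 1),
      Set.indicator {x | M.childSize x n i = k} (1 : NodeSource b → ℝ) p.1 *
        nodeToll φ w (M.tree k p.2) with hG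
    have hGi : ∀ k, Integrable (fun p : NodeSource b × Source b =>
        Set.indicator {x | M.childSize x n i = k} (1 : NodeSource b → ℝ) p.1 *
        nodeToll φ w (M.tree k p.2)) (M.nodeLaw.prod M.sourceLaw) := fun k =>
      Integrable.mul_prod ((integrable_const (1 : ℝ)).indicator (hm k)) (ih k).1
    have hGint : Integrable G (M.nodeLaw.prod M.sourceLaw) := integrable_finsetSum _ fun k _ => hGi k
    have hGeq : (fun ω => nodeToll φ (i :: w) (M.tree n ω)) = fun ω : Source b =>
        G (ω [], fun w => ω (i :: w)) := by
      ext ω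
      classical
      rw [nodeToll_cons]
      simp only [hG, Set.indicator_apply, Set.mem_ofPred_eq, Pi.one_apply, ite_mul, one_mul, zero_mul]
      rw [Finset.sum_ite_eq,
        if_pos (Finset.mem_range.2 (Nat.lt_succ_of_le (M.childSize_le _ n i)))]
    have hmp := M.measurePreserving_split i
    rw [hGeq]
    refine ⟨hmp.integrable_comp_of_integrable hGint, ?_⟩
    have h1 : ∫ ω : Source b, G (ω [], fun w => ω (i :: w)) ∂M.sourceLaw =
        ∫ p, G p ∂M.nodeLaw.prod M.sourceLaw := by
      rw [← hmp.map_eq, integral_map hmp.measurable.aemeasurable]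
      rw [hmp.map_eq]; exact hGint.aestronglyMeasurable
    rw [h1, hG, integral_finsetSum _ fun k _ => hGi k, visit]
    refine Finset.sum_congr rfl fun k _ => ?_
    have h2 := integral_prod_mul (μ := M.nodeLaw) (ν := M.sourceLaw)
      (Set.indicator {x | M.childSize x n i = k} (1 : NodeSource b → ℝ))
      (fun ω => nodeToll φ w (M.tree k ω))
    rw [(ih k).2, integral_indicator_one (hm k)] at h2
    exact h2

theorem visit_nonneg {g : ℕ → ℝ} (hg : ∀ n, 0 ≤ g n) (v : Node b) (n : ℕ) : 0 ≤ M.visit v g n := by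
  induction v generalizing n with
  | nil => exact hg n
  | cons i w ih => exact Finset.sum_nonneg fun k _ => mul_nonneg measureReal_nonneg (ih k)

theorem sum_visit_wordsLT (g : ℕ → ℝ) (L n : ℕ) : ∑ v ∈ wordsLT b L, M.visit v g n = M.R L g n := by
  induction L generalizing n with
  | zero => simp [wordsLT]
  | succ L ih =>
    rw [wordsLT, Finset.sum_insert (by simp), Finset.sum_image (by
      rintro ⟨i, w⟩ _ ⟨j, w'⟩ _ h; simpa using h), Finset.sum_product, R_succ]
    simp only [visit]
    congr 1
    simp only [T, trans, Finset.sum_mul]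
    rw [Finset.sum_comm (s := Finset.range (n + 1))]
    refine Finset.sum_congr rfl fun i _ => ?_
    rw [Finset.sum_comm]
    refine Finset.sum_congr rfl fun k _ => ?_
    rw [← Finset.mul_sum, ih]

theorem summable_visit_of_nonneg {g : ℕ → ℝ} (hg : ∀ n, 0 ≤ g n) (hg0 : g 0 = 0) (n : ℕ) :
    Summable fun v => M.visit v g n := by
  obtain ⟨K, hK⟩ := M.R_bounded hg hg0 n
  refine summable_of_sum_le (c := K) (fun v => M.visit_nonneg hg v n) fun s => ?_
  obtain ⟨L, hL⟩ := ((tendsto_wordsLT b).eventually_ge_atTop s).exists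
  refine (Finset.sum_le_sum_of_subset_of_nonneg hL fun v _ _ => M.visit_nonneg hg v n).trans ?_
  rw [sum_visit_wordsLT]; exact hK L

/-- The expected number of nodes is the functional of the toll `1`, finite by `R_bounded`;
Borel–Cantelli over the words does the rest. -/
theorem ae_finite_nodes (n : ℕ) : ∀ᵐ ω ∂M.sourceLaw, (M.tree n ω).nodes.Finite := by
  have hone : ∀ n : ℕ, 1 ≤ n → Integrable (fun ω => (fun _ => 1 : BallTree b → ℝ) (M.tree n ω))
      M.sourceLaw := fun n _ => integrable_const _
  have hg : ∀ n, 0 ≤ M.tollFun (fun _ => 1) n := fun n => by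
    unfold tollFun meanToll; split_ifs <;> simp
  have hsum := M.summable_visit_of_nonneg hg (M.tollFun_zero _) n
  have hle : ∀ v : Node b, M.sourceLaw {ω | v ∈ (M.tree n ω).nodes} ≤
      ENNReal.ofReal (M.visit v (M.tollFun fun _ => 1) n) := fun v => by
    obtain ⟨hi, he⟩ := M.integrable_nodeToll (φ := fun _ => 1) hone v n
    have h0 : ∀ ω, 0 ≤ nodeToll (fun _ => 1) v (M.tree n ω) := fun ω => by
      unfold nodeToll; split_ifs <;> norm_num
    have hmk := mul_meas_ge_le_integral_of_nonneg (ae_of_all _ h0) hi 1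
    rw [one_mul, he] at hmk
    have hs : {ω | v ∈ (M.tree n ω).nodes} ⊆ {ω | 1 ≤ nodeToll (fun _ => 1) v (M.tree n ω)} :=
      fun ω (hω : v ∈ (M.tree n ω).nodes) => by
        change 1 ≤ nodeToll _ _ _
        rw [nodeToll, if_pos hω]
    refine (measure_mono hs).trans ?_
    rw [← ENNReal.ofReal_toReal (measure_ne_top M.sourceLaw _)]
    exact ENNReal.ofReal_le_ofReal hmk
  refine ae_finite_setOfPred_mem (s := fun v : Node b => {ω | v ∈ (M.tree n ω).nodes}) ?_
  refine ne_top_of_le_ne_top ?_ (ENNReal.tsum_le_tsum hle)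
  exact hsum.tsum_ofReal_ne_top

/-- The visits weighted by `|φ|` are summable, so sum and expectation may be exchanged and evaluated
by levels. -/
theorem integrable_X {φ : BallTree b → ℝ}
    (hφ : ∀ n : ℕ, 1 ≤ n → Integrable (fun ω => φ (M.tree n ω)) M.sourceLaw) (n : ℕ) :
    Integrable (M.X φ n) M.sourceLaw ∧
      Tendsto (fun L => M.R L (M.tollFun φ) n) atTop (𝓝 (∫ ω, M.X φ n ω ∂M.sourceLaw)) := by
  have hX : M.X φ n = fun ω => ∑' v, nodeToll φ v (M.tree n ω) := rfl
  have habs : ∀ (v : Node b) (t : BallTree b), ‖nodeToll φ v t‖ = nodeToll (fun t => |φ t|) v t :=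
    fun v t => by
      rw [Real.norm_eq_abs]; unfold nodeToll; split_ifs <;> simp
  have hi := fun v => (M.integrable_nodeToll hφ v n).1
  have hnorm : ∀ v, ∫ ω, ‖nodeToll φ v (M.tree n ω)‖ ∂M.sourceLaw =
      M.visit v (M.tollFun fun t => |φ t|) n := fun v => by
    simp_rw [habs]
    exact (M.integrable_nodeToll (fun n hn => (hφ n hn).abs) v n).2
  have hg : ∀ n, 0 ≤ M.tollFun (fun t => |φ t|) n := fun n => by
    unfold tollFun meanToll
    split_ifs
    · exact le_rfl
    · exact integral_nonneg fun _ => abs_nonneg _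
  have hsum : Summable fun v => ∫ ω, ‖nodeToll φ v (M.tree n ω)‖ ∂M.sourceLaw := by
    simp_rw [hnorm]
    exact M.summable_visit_of_nonneg hg (M.tollFun_zero _) n
  constructor
  -- Almost sure finiteness makes the level sums converge pointwise.
  · have hmeas : AEStronglyMeasurable (M.X φ n) M.sourceLaw := by
      refine aestronglyMeasurable_of_tendsto_ae atTop
        (f := fun L ω => ∑ v ∈ wordsLT b L, nodeToll φ v (M.tree n ω))
        (fun L => (integrable_finsetSum _ fun v _ => hi v).aestronglyMeasurable) ?_
      filter_upwards [M.ae_finite_nodes n] with ω hω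
      have hs : Summable fun v => nodeToll φ v (M.tree n ω) :=
        summable_of_hasFiniteSupport (hω.subset fun v hv => by
          by_contra hc
          exact hv (if_neg hc))
      exact hs.hasSum.comp (tendsto_wordsLT b)
    refine ⟨hmeas, ?_⟩
    rw [HasFiniteIntegral]
    have h1 : ∫⁻ ω, ‖M.X φ n ω‖ₑ ∂M.sourceLaw ≤
        ∫⁻ ω, ∑' v, ‖nodeToll φ v (M.tree n ω)‖ₑ ∂M.sourceLaw :=
      lintegral_mono fun ω => enorm_tsum_le_tsum_enorm
    refine h1.trans_lt ?_
    rw [lintegral_tsum fun v => (hi v).1.enorm]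
    have h2 : ∀ v, ∫⁻ ω, ‖nodeToll φ v (M.tree n ω)‖ₑ ∂M.sourceLaw =
        ENNReal.ofReal (∫ ω, ‖nodeToll φ v (M.tree n ω)‖ ∂M.sourceLaw) := fun v =>
      (ofReal_integral_norm_eq_lintegral_enorm (hi v)).symm
    simp_rw [h2]
    exact lt_top_iff_ne_top.2 hsum.tsum_ofReal_ne_top
  · have h1 := hasSum_integral_of_summable_integral_norm hi hsum
    refine (h1.comp (tendsto_wordsLT b)).congr fun L => ?_
    rw [← sum_visit_wordsLT]
    exact Finset.sum_congr rfl fun v _ => (M.integrable_nodeToll hφ v n).2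

end Model

/-! ### Uniqueness, tail estimate and the series. -/

namespace Model

variable {b : ℕ} (M : Model b)

/-- Child sizes never exceed `n`, so only the values of `g` up to `N` matter. -/
theorem R_eq_sum_unit {g : ℕ → ℝ} (hg0 : g 0 = 0) (L : ℕ) {n N : ℕ} (hn : n ≤ N) :
    M.R L g n = ∑ k ∈ Finset.Icc 1 N, g k * M.R L (unit k) n := by
  induction L generalizing n with
  | zero => simp
  | succ L ih =>
    simp only [R_succ, mul_add, Finset.sum_add_distrib]
    congr 1
    · simp only [unit, mul_ite, mul_one, mul_zero]
      rw [Finset.sum_ite_eq]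
      split_ifs with h
      · rfl
      · have : n = 0 := by simp only [Finset.mem_Icc, not_and_or] at h; omega
        rw [this, hg0]
    · simp only [T, Finset.mul_sum]
      rw [Finset.sum_comm]
      refine Finset.sum_congr rfl fun j hj => ?_
      rw [ih (by have := Finset.mem_range.1 hj; omega), Finset.mul_sum]
      exact Finset.sum_congr rfl fun k _ => by ring

theorem isLittleO_iff_tendsto_div {β : ℝ} {a c : ℕ → ℝ} :
    (fun n : ℕ => a n - c n * (n : ℝ) ^ β) =o[atTop] (fun n : ℕ => (n : ℝ) ^ β) ↔
      Tendsto (fun n : ℕ => a n / (n : ℝ) ^ β - c n) atTop (𝓝 0) := by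
  have hpos : ∀ᶠ n : ℕ in atTop, (0 : ℝ) < (n : ℝ) ^ β := by
    filter_upwards [eventually_gt_atTop 0] with n hn
    exact Real.rpow_pos_of_pos (by exact_mod_cast hn) _
  rw [isLittleO_iff_tendsto' (by
    filter_upwards [hpos] with n hn h0; exact absurd h0 hn.ne')]
  refine tendsto_congr' ?_
  filter_upwards [hpos] with n hn
  rw [sub_div, mul_div_cancel_right₀ _ hn.ne']

/-- Take `⌊exp (t + j * p)⌋`. One sequence serves all functions of period `p`, so asymptotics at the
integers determine the limit functions at `t` simultaneously. -/
theorem exists_log_sequence {p : ℝ} (hp : 0 < p) (t : ℝ) :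
    ∃ N : ℕ → ℕ, Tendsto N atTop atTop ∧ ∀ w : ℝ → ℝ, Continuous w → Function.Periodic w p →
      Tendsto (fun j => w (Real.log (N j))) atTop (𝓝 (w t)) := by
  have hs : Tendsto (fun j : ℕ => t + j * p) atTop atTop :=
    tendsto_atTop_add_const_left _ _ (tendsto_natCast_atTop_atTop.atTop_mul_const hp)
  have he : Tendsto (fun j : ℕ => Real.exp (t + j * p)) atTop atTop :=
    Real.tendsto_exp_atTop.comp hs
  refine ⟨fun j => ⌊Real.exp (t + j * p)⌋₊, tendsto_nat_floor_atTop.comp he, fun w hw hwp => ?_⟩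
  have h1 := ((Real.continuousAt_log one_ne_zero).tendsto.comp
    (tendsto_nat_floor_div_atTop (R := ℝ))).comp he
  rw [Real.log_one] at h1
  have h2 : Tendsto (fun j : ℕ => Real.log (⌊Real.exp (t + j * p)⌋₊ : ℕ) - j * p) atTop (𝓝 t) := by
    have h3 := h1.add_const t
    rw [zero_add] at h3
    refine h3.congr' ?_
    filter_upwards [he.eventually_ge_atTop 1] with j hj
    have : (1 : ℝ) ≤ (⌊Real.exp (t + j * p)⌋₊ : ℕ) := by
      exact_mod_cast Nat.le_floor (by simpa using hj)
    simp only [Function.comp]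
    rw [Real.log_div (by positivity) (Real.exp_pos _).ne', Real.log_exp]
    ring
  refine ((hw.tendsto t).comp h2).congr fun j => ?_
  exact hwp.sub_nat_mul_eq j

/-- In the nonlattice case the span is `0` and periodicity is void; constancy supplies the period
`1`. -/
theorem exists_period {β : ℝ} (hβ : M.IsMalthusian β) :
    ∃ p > 0, ∀ (φ : BallTree b → ℝ) (w : ℝ → ℝ), M.IsLimitFunction β φ w →
      Function.Periodic w p := by
  rcases M.lattice_cases hβ with ⟨hno, _, _⟩ | ⟨_, hspan, _⟩
  · refine ⟨1, one_pos, fun φ w hw => ?_⟩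
    obtain ⟨c, hc⟩ := hw.constant hno
    intro t; rw [hc, hc]
  · exact ⟨M.span, hspan, fun φ w hw => hw.periodic⟩

theorem IsLimitFunction.tendsto_mean {β : ℝ} {φ : BallTree b → ℝ} {w : ℝ → ℝ}
    (h : M.IsLimitFunction β φ w) :
    Tendsto (fun n : ℕ => (∫ ω, M.X φ n ω ∂M.sourceLaw) / (n : ℝ) ^ β - w (Real.log n)) atTop
      (𝓝 0) :=
  isLittleO_iff_tendsto_div.1 h.mean

theorem IsLimitFunction.unique {β : ℝ} (hβ : M.IsMalthusian β) {φ : BallTree b → ℝ} {w w' : ℝ → ℝ}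
    (h : M.IsLimitFunction β φ w) (h' : M.IsLimitFunction β φ w') : w = w' := by
  obtain ⟨p, hp, hper⟩ := M.exists_period hβ
  ext t
  obtain ⟨N, hN, hNw⟩ := exists_log_sequence hp t
  have h1 := ((h'.tendsto_mean).sub (h.tendsto_mean)).comp hN
  have h2 := (hNw w h.continuous (hper φ w h)).sub (hNw w' h'.continuous (hper φ w' h'))
  have h3 : w t - w' t = 0 - 0 := by
    refine tendsto_nhds_unique h2 (h1.congr fun j => ?_)
    simp only [Function.comp]; ring
  linarith

theorem limitFunction_spec {β : ℝ} {φ : BallTree b → ℝ} (h : ∃ w, M.IsLimitFunction β φ w) :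
    M.IsLimitFunction β φ (M.limitFunction β φ) := by
  rw [limitFunction, dif_pos h]; exact h.choose_spec

theorem sizeToll_tree (k n : ℕ) (ω : Source b) : sizeToll b k (M.tree n ω) = unit k n := rfl

theorem tollFun_sizeToll {k : ℕ} (hk : 1 ≤ k) : M.tollFun (sizeToll b k) = unit k := by
  ext n
  unfold tollFun meanToll
  simp only [sizeToll_tree]
  rcases Nat.eq_zero_or_pos n with rfl | hn
  · rw [if_pos rfl, unit, if_neg (by omega)]
  · simp [hn.ne']

theorem integrable_sizeToll (k n : ℕ) :
    Integrable (fun ω => sizeToll b k (M.tree n ω)) M.sourceLaw := by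
  simp only [sizeToll_tree]; exact integrable_const _

/-- The expected number of nodes with `k` balls in a tree with `n` balls. -/
def meanCount (k n : ℕ) : ℝ := ∫ ω, M.X (sizeToll b k) n ω ∂M.sourceLaw

theorem tendsto_R_unit {k : ℕ} (hk : 1 ≤ k) (n : ℕ) :
    Tendsto (fun L => M.R L (unit k) n) atTop (𝓝 (M.meanCount k n)) := by
  have := (M.integrable_X (fun n _ => M.integrable_sizeToll k n) n).2
  rwa [M.tollFun_sizeToll hk] at this

theorem meanCount_nonneg {k : ℕ} (hk : 1 ≤ k) (n : ℕ) : 0 ≤ M.meanCount k n :=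
  ge_of_tendsto' (M.tendsto_R_unit hk n) fun L => M.R_nonneg (unit_nonneg k) L n

theorem tendsto_R_sum {g : ℕ → ℝ} (hg0 : g 0 = 0) {n N : ℕ} (hn : n ≤ N) :
    Tendsto (fun L => M.R L g n) atTop (𝓝 (∑ k ∈ Finset.Icc 1 N, g k * M.meanCount k n)) := by
  simp_rw [M.R_eq_sum_unit hg0 _ hn]
  exact tendsto_finsetSum _ fun k hk =>
    (M.tendsto_R_unit (Finset.mem_Icc.1 hk).1 n).const_mul _

theorem integral_X_eq_sum {φ : BallTree b → ℝ}
    (hφ : ∀ n : ℕ, 1 ≤ n → Integrable (fun ω => φ (M.tree n ω)) M.sourceLaw) {n N : ℕ}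
    (hn : n ≤ N) :
    ∫ ω, M.X φ n ω ∂M.sourceLaw = ∑ k ∈ Finset.Icc 1 N, M.meanToll φ k * M.meanCount k n := by
  rw [tendsto_nhds_unique (M.integrable_X hφ n).2 (M.tendsto_R_sum (M.tollFun_zero φ) hn)]
  refine Finset.sum_congr rfl fun k hk => ?_
  have := (Finset.mem_Icc.1 hk).1
  rw [tollFun, if_neg (by omega)]

theorem exists_isLimitFunction_sizeToll {β : ℝ} (hβ : M.IsMalthusian β) {k : ℕ} (hk : 1 ≤ k) :
    ∃ w, M.IsLimitFunction β (sizeToll b k) w := by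
  obtain ⟨u, hu, hu0, ⟨A, hA0, hA⟩, ⟨C, hC0, hC⟩, hT⟩ := M.exists_limit_R_unit hβ hk
  obtain ⟨w, h1, h2, h3, h4, h5⟩ := M.exists_limit_function hβ hA0 hC0 hu0 hA hC hT
  refine ⟨w, h1, h2, h3, h4,
    fun n => (M.integrable_X (fun n _ => M.integrable_sizeToll k n) n).1, ?_⟩
  have : ∀ n, ∫ ω, M.X (sizeToll b k) n ω ∂M.sourceLaw = u n := fun n =>
    tendsto_nhds_unique (M.tendsto_R_unit hk n) (hu n)
  simp_rw [this]
  exact isLittleO_iff_tendsto_div.2 h5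

theorem exists_meanToll_le {β δ : ℝ} {φ : BallTree b → ℝ}
    (hO : (fun n : ℕ => M.meanToll φ n) =O[atTop] fun n : ℕ => (n : ℝ) ^ (β - δ)) {γ : ℝ}
    (hγ : β - δ ≤ γ) (hγ0 : 0 ≤ γ) :
    ∃ C, 0 ≤ C ∧ ∀ k : ℕ, 1 ≤ k → |M.meanToll φ k| ≤ C * (k : ℝ) ^ γ := by
  obtain ⟨c, hc⟩ := hO.bound
  obtain ⟨n₀, hn₀⟩ := eventually_atTop.1 hc
  refine ⟨|c| + ∑ j ∈ Finset.range n₀, |M.meanToll φ j|, by positivity, fun k hk => ?_⟩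
  have hk1 : (1 : ℝ) ≤ k := by exact_mod_cast hk
  have hk0 : (0 : ℝ) ≤ k := by linarith
  have h1 : 1 ≤ (k : ℝ) ^ γ := Real.one_le_rpow hk1 hγ0
  have hS : 0 ≤ ∑ j ∈ Finset.range n₀, |M.meanToll φ j| :=
    Finset.sum_nonneg fun _ _ => abs_nonneg _
  rw [add_mul]
  have hp1 : 0 ≤ |c| * (k : ℝ) ^ γ := by positivity
  have hp2 : 0 ≤ (∑ j ∈ Finset.range n₀, |M.meanToll φ j|) * (k : ℝ) ^ γ := by positivity
  rcases lt_or_ge k n₀ with h | h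
  · have h2 := Finset.single_le_sum (f := fun j => |M.meanToll φ j|) (fun _ _ => abs_nonneg _)
      (Finset.mem_range.2 h)
    nlinarith
  · have h2 := hn₀ k h
    rw [Real.norm_eq_abs, Real.norm_eq_abs, abs_of_nonneg (Real.rpow_nonneg hk0 _)] at h2
    have h3 : (k : ℝ) ^ (β - δ) ≤ (k : ℝ) ^ γ := Real.rpow_le_rpow_of_exponent_le hk1 hγ
    have h4 : c * (k : ℝ) ^ (β - δ) ≤ |c| * (k : ℝ) ^ γ :=
      mul_le_mul (le_abs_self c) h3 (Real.rpow_nonneg hk0 _) (abs_nonneg _)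
    linarith

/-- Trees with more than `K` balls contribute little to the additive functional. -/
theorem exists_tail_bound {β δ : ℝ} (hβ : M.IsMalthusian β) (hδ : 0 < δ) {φ : BallTree b → ℝ}
    (hO : (fun n : ℕ => M.meanToll φ n) =O[atTop] fun n : ℕ => (n : ℝ) ^ (β - δ)) :
    ∃ ε : ℕ → ℝ, Tendsto ε atTop (𝓝 0) ∧ ∀ K K' n : ℕ, 1 ≤ n →
      ∑ k ∈ Finset.Ioc K K', |M.meanToll φ k| * (M.meanCount k n / (n : ℝ) ^ β) ≤ ε K := by
  have hβ0 := hβ.1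
  -- The exponent is raised so that the midpoint `γ₁` of `γ₀` and `β` lies in the range of
  -- `R_powFun_le`; for `k > K` the toll is then a factor `(K + 1) ^ (-(γ₁ - γ₀))` below `k ^ γ₁`.
  set γ₀ := max (β - δ) (3 * β / 4) with hγ₀
  have hγ₀β : γ₀ < β := max_lt (by linarith) (by linarith)
  have hγ₀0 : 3 * β / 4 ≤ γ₀ := le_max_right _ _
  set γ₁ := (γ₀ + β) / 2 with hγ₁
  obtain ⟨C, hC0, hC⟩ := M.exists_meanToll_le hO (le_max_left _ _ : β - δ ≤ γ₀) (by linarith)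
  obtain ⟨A, hA0, hA⟩ := M.R_powFun_le hβ (γ := γ₁) (by linarith) (by linarith)
  refine ⟨fun K => C * A * ((K + 1 : ℕ) : ℝ) ^ (-(γ₁ - γ₀)), ?_, fun K K' n hn => ?_⟩
  · have := (tendsto_natCast_rpow_neg (p := γ₁ - γ₀) (by linarith)).comp (tendsto_add_atTop_nat 1)
    simpa using this.const_mul (C * A)
  · have hn0 : (0 : ℝ) < (n : ℝ) ^ β := Real.rpow_pos_of_pos (by exact_mod_cast hn) _
    have hgood : ∑ k ∈ Finset.Icc 1 (max n K'), powFun γ₁ k * M.meanCount k n ≤ A * (n : ℝ) ^ β :=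
      le_of_tendsto' (M.tendsto_R_sum (powFun_zero (by linarith)) (le_max_left _ _)) fun L => hA L n
    have hsub : Finset.Ioc K K' ⊆ Finset.Icc 1 (max n K') := fun k hk => by
      simp only [Finset.mem_Ioc, Finset.mem_Icc] at *; omega
    set e := ((K + 1 : ℕ) : ℝ) ^ (-(γ₁ - γ₀)) with he
    have he0 : 0 ≤ e := Real.rpow_nonneg (Nat.cast_nonneg _) _
    have hterm : ∀ k ∈ Finset.Ioc K K',
        |M.meanToll φ k| * M.meanCount k n ≤ C * e * (powFun γ₁ k * M.meanCount k n) := by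
      intro k hk
      have hk' : K + 1 ≤ k := (Finset.mem_Ioc.1 hk).1
      have hk0 : (0 : ℝ) < k := by exact_mod_cast (by omega : 0 < k)
      rw [← mul_assoc]
      refine mul_le_mul_of_nonneg_right ?_ (M.meanCount_nonneg (by omega) n)
      refine (hC k (by omega)).trans ?_
      rw [mul_assoc]
      refine mul_le_mul_of_nonneg_left ?_ hC0
      have h1 : (k : ℝ) ^ γ₀ = (k : ℝ) ^ (-(γ₁ - γ₀)) * (k : ℝ) ^ γ₁ := by
        rw [← Real.rpow_add hk0]; congr 1; ring
      rw [h1, powFun]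
      refine mul_le_mul_of_nonneg_right ?_ (Real.rpow_nonneg hk0.le _)
      exact Real.rpow_le_rpow_of_nonpos (by positivity) (by exact_mod_cast hk') (by linarith)
    calc ∑ k ∈ Finset.Ioc K K', |M.meanToll φ k| * (M.meanCount k n / (n : ℝ) ^ β)
        = (∑ k ∈ Finset.Ioc K K', |M.meanToll φ k| * M.meanCount k n) / (n : ℝ) ^ β := by
          rw [Finset.sum_div]; exact Finset.sum_congr rfl fun k _ => (mul_div_assoc _ _ _).symm
      _ ≤ C * e * (A * (n : ℝ) ^ β) / (n : ℝ) ^ β := by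
          refine div_le_div_of_nonneg_right ?_ hn0.le
          refine (Finset.sum_le_sum hterm).trans ?_
          rw [← Finset.mul_sum]
          refine mul_le_mul_of_nonneg_left (le_trans ?_ hgood) (mul_nonneg hC0 he0)
          exact Finset.sum_le_sum_of_subset_of_nonneg hsub fun k hk _ =>
            mul_nonneg (powFun_nonneg _ _) (M.meanCount_nonneg (Finset.mem_Icc.1 hk).1 n)
      _ = C * A * e := by field_simp

/-- The limit function of `φ` is the uniform limit of the partial sums of the series. -/
theorem exists_isLimitFunction {β δ : ℝ} (hβ : M.IsMalthusian β) (hδ : 0 < δ)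
    {φ : BallTree b → ℝ}
    (hφ : ∀ n : ℕ, 1 ≤ n → Integrable (fun ω => φ (M.tree n ω)) M.sourceLaw)
    (hO : (fun n : ℕ => M.meanToll φ n) =O[atTop] fun n : ℕ => (n : ℝ) ^ (β - δ)) :
    ∃ w, M.IsLimitFunction β φ w ∧ TendstoUniformly
      (fun (K : ℕ) (t : ℝ) => ∑ k ∈ Finset.Icc 1 K,
        M.limitFunction β (sizeToll b k) t * M.meanToll φ k) w atTop := by
  obtain ⟨ε, hε, htail⟩ := M.exists_tail_bound hβ hδ hO
  obtain ⟨p, hp, hper⟩ := M.exists_period hβ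
  set c := M.meanToll φ with hc
  set v : ℕ → ℝ → ℝ := fun k => M.limitFunction β (sizeToll b k) with hv
  have hvspec : ∀ k, 1 ≤ k → M.IsLimitFunction β (sizeToll b k) (v k) := fun k hk =>
    M.limitFunction_spec (M.exists_isLimitFunction_sizeToll hβ hk)
  have hvlim : ∀ k, 1 ≤ k →
      Tendsto (fun n : ℕ => M.meanCount k n / (n : ℝ) ^ β - v k (Real.log n)) atTop (𝓝 0) :=
    fun k hk => (hvspec k hk).tendsto_mean
  set W : ℕ → ℝ → ℝ := fun K t => ∑ k ∈ Finset.Icc 1 K, v k t * c k with hW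
  have hdiff : ∀ K K', K ≤ K' → ∀ t, W K' t - W K t = ∑ k ∈ Finset.Ioc K K', v k t * c k := by
    intro K K' h t
    have hIoc : ∀ m, Finset.Icc 1 m = Finset.Ioc 0 m := fun m => by
      ext k; simp [Nat.one_le_iff_ne_zero, Nat.pos_iff_ne_zero]
    simp only [hW, hIoc]
    rw [sub_eq_iff_eq_add', Finset.sum_Ioc_consecutive _ (Nat.zero_le _) h]
  -- The tail bound at `n = N j` passes to the limit, uniformly in `t`. No cancellation is lost in
  -- it, since every `v k t` is nonnegative as a limit of expected counts.
  have hW' : ∀ K K', K ≤ K' → ∀ t, |W K' t - W K t| ≤ ε K := by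
    intro K K' h t
    obtain ⟨N, hN, hNw⟩ := exists_log_sequence hp t
    have hk : ∀ k ∈ Finset.Ioc K K',
        Tendsto (fun j => |c k| * (M.meanCount k (N j) / (N j : ℝ) ^ β)) atTop
          (𝓝 (|c k| * v k t)) := fun k hk => by
      have hk1 : 1 ≤ k := by have := (Finset.mem_Ioc.1 hk).1; omega
      have h1 := ((hvlim k hk1).comp hN).add
        (hNw (v k) (hvspec k hk1).continuous (hper _ _ (hvspec k hk1)))
      simp only [Function.comp, sub_add_cancel, zero_add] at h1
      exact h1.const_mul _
    have hvnn : ∀ k ∈ Finset.Ioc K K', |v k t * c k| = |c k| * v k t := fun k hk' => by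
      have hk1 : 1 ≤ k := by have := (Finset.mem_Ioc.1 hk').1; omega
      have h1 : 0 ≤ |c k| * v k t := ge_of_tendsto' (hk k hk') fun j =>
        mul_nonneg (abs_nonneg _) (div_nonneg (M.meanCount_nonneg hk1 _)
          (Real.rpow_nonneg (Nat.cast_nonneg _) _))
      rw [← abs_of_nonneg h1, abs_mul, abs_mul, abs_abs, mul_comm]
    rw [hdiff K K' h]
    refine (Finset.abs_sum_le_sum_abs _ _).trans ?_
    rw [Finset.sum_congr rfl hvnn]
    refine le_of_tendsto (tendsto_finsetSum _ hk) ?_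
    filter_upwards [hN.eventually_ge_atTop 1] with j hj
    exact htail K K' (N j) hj
  have hcauchy : ∀ t, CauchySeq fun K => W K t := fun t => by
    refine cauchySeq_of_le_tendsto_0 (fun K => 2 * ε K) (fun n m K hn hm => ?_)
      (by simpa using hε.const_mul 2)
    have h1 := hW' K n hn t
    have h2 := hW' K m hm t
    rw [Real.dist_eq]
    rw [abs_le] at *
    constructor <;> linarith [h1.1, h1.2, h2.1, h2.2]
  choose w hw using fun t => cauchySeq_tendsto_of_complete (hcauchy t)
  have hwW : ∀ K t, |w t - W K t| ≤ ε K := fun K t => by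
    refine le_of_tendsto ((hw t).sub_const (W K t)).abs ?_
    filter_upwards [eventually_ge_atTop K] with K' hK' using hW' K K' hK' t
  have hunif : TendstoUniformly W w atTop := by
    refine Metric.tendstoUniformly_iff.2 fun e he => ?_
    filter_upwards [hε.eventually_lt_const he] with K hK t
    rw [Real.dist_eq]
    exact (hwW K t).trans_lt hK
  refine ⟨w, ⟨⟨ε 0, fun t => ?_⟩, ?_, ?_, ?_, fun n => (M.integrable_X hφ n).1, ?_⟩, hunif⟩
  -- The empty partial sum is `0`, so `ε 0` bounds `w`.
  · have := hwW 0 t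
    simpa [hW] using this
  · refine hunif.continuous (Eventually.frequently (Eventually.of_forall fun K => ?_))
    exact continuous_finsetSum _ fun k hk =>
      (hvspec k (Finset.mem_Icc.1 hk).1).continuous.mul continuous_const
  · intro t
    refine tendsto_nhds_unique (hw (t + M.span)) ((hw t).congr fun K => ?_)
    refine Finset.sum_congr rfl fun k hk => ?_
    rw [(hvspec k (Finset.mem_Icc.1 hk).1).periodic t]
  · intro hno
    refine ⟨w 0, fun t => tendsto_nhds_unique (hw t) ((hw 0).congr fun K => ?_)⟩
    refine Finset.sum_congr rfl fun k hk => ?_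
    obtain ⟨a, ha⟩ := (hvspec k (Finset.mem_Icc.1 hk).1).constant hno
    rw [ha, ha]
  -- With `K` fixed, the first `K` terms converge, while the tails of the finite sum at `n` and of
  -- the series are each at most `ε K`.
  · refine isLittleO_iff_tendsto_div.2 (Metric.tendsto_atTop'.2 fun e he => ?_)
    obtain ⟨K, hK⟩ := (hε.eventually_lt_const (show 0 < e / 3 by positivity)).exists
    have h1 : Tendsto (fun n : ℕ => ∑ k ∈ Finset.Icc 1 K,
        c k * (M.meanCount k n / (n : ℝ) ^ β - v k (Real.log n))) atTop (𝓝 0) := by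
      have := tendsto_finsetSum (Finset.Icc 1 K) fun k hk =>
        (hvlim k (Finset.mem_Icc.1 hk).1).const_mul (c k)
      simpa using this
    obtain ⟨n₀, hn₀⟩ := Metric.tendsto_atTop.1 h1 (e / 3) (by positivity)
    refine ⟨max n₀ (max 1 K), fun n hn => ?_⟩
    have hnn₀ : n₀ ≤ n := ((le_max_left _ _).trans_lt hn).le
    have hn1 : 1 ≤ n := (((le_max_left _ _).trans (le_max_right _ _)).trans_lt hn).le
    have hnK : K ≤ n := (((le_max_right _ _).trans (le_max_right _ _)).trans_lt hn).le
    have h2 := hn₀ n hnn₀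
    rw [Real.dist_eq, sub_zero] at h2
    have h3 := hwW K (Real.log n)
    have h4 := htail K n n hn1
    have hsplit : (∫ ω, M.X φ n ω ∂M.sourceLaw) / (n : ℝ) ^ β - w (Real.log n) =
        ∑ k ∈ Finset.Icc 1 K, c k * (M.meanCount k n / (n : ℝ) ^ β - v k (Real.log n)) +
        ∑ k ∈ Finset.Ioc K n, c k * (M.meanCount k n / (n : ℝ) ^ β) -
        (w (Real.log n) - W K (Real.log n)) := by
      have hIoc : ∀ m, Finset.Icc 1 m = Finset.Ioc 0 m := fun m => by
        ext k; simp [Nat.one_le_iff_ne_zero, Nat.pos_iff_ne_zero]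
      have e1 : (∫ ω, M.X φ n ω ∂M.sourceLaw) / (n : ℝ) ^ β =
          ∑ k ∈ Finset.Icc 1 K, c k * (M.meanCount k n / (n : ℝ) ^ β) +
          ∑ k ∈ Finset.Ioc K n, c k * (M.meanCount k n / (n : ℝ) ^ β) := by
        rw [M.integral_X_eq_sum hφ le_rfl, Finset.sum_div, hIoc, hIoc,
          Finset.sum_Ioc_consecutive _ (Nat.zero_le _) hnK]
        exact Finset.sum_congr rfl fun k _ => mul_div_assoc _ _ _
      have e2 : W K (Real.log n) = ∑ k ∈ Finset.Icc 1 K, c k * v k (Real.log n) :=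
        Finset.sum_congr rfl fun k _ => mul_comm _ _
      simp only [mul_sub, Finset.sum_sub_distrib]
      rw [e1, e2]; ring
    have h5 : |∑ k ∈ Finset.Ioc K n, c k * (M.meanCount k n / (n : ℝ) ^ β)| ≤ ε K := by
      refine (Finset.abs_sum_le_sum_abs _ _).trans (le_trans (le_of_eq ?_) h4)
      refine Finset.sum_congr rfl fun k hk => ?_
      have hk1 : 1 ≤ k := by have := (Finset.mem_Ioc.1 hk).1; omega
      rw [abs_mul, abs_of_nonneg (div_nonneg (M.meanCount_nonneg hk1 _)
        (Real.rpow_nonneg (Nat.cast_nonneg _) _))]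
    rw [Real.dist_eq, sub_zero, hsplit]
    rw [abs_lt] at h2 ⊢
    rw [abs_le] at h3 h5
    constructor <;> linarith [h2.1, h2.2, h3.1, h3.2, h5.1, h5.2]

end Model

end FractionalSplit

end

theorem proposition5 {b : ℕ} (M : FractionalSplit.Model b) (β : ℝ) (hβ : M.IsMalthusian β)
    (φ : FractionalSplit.BallTree b → ℝ)
    (hφ : ∀ n : ℕ, 1 ≤ n → Integrable (fun ω => φ (M.tree n ω)) M.sourceLaw)
    (δ : ℝ) (hδ : 0 < δ)
    (hO : (fun n : ℕ => M.meanToll φ n) =O[atTop] fun n : ℕ => (n : ℝ) ^ (β - δ)) :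
    -- the random trees are finite, and the limit functions exist and are unique
    (∀ n : ℕ, ∀ᵐ ω ∂M.sourceLaw, (M.tree n ω).nodes.Finite) ∧
    (∃! w : ℝ → ℝ, M.IsLimitFunction β φ w) ∧
    (∀ k : ℕ, 1 ≤ k →
      ∃! w : ℝ → ℝ, M.IsLimitFunction β (FractionalSplit.sizeToll b k) w) ∧
    -- the series converges to the limit function
    (∀ t : ℝ, Tendsto
      (fun K : ℕ => ∑ k ∈ Finset.Icc 1 K,
        M.limitFunction β (FractionalSplit.sizeToll b k) t * M.meanToll φ k)
      atTop (𝓝 (M.limitFunction β φ t))) ∧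
    -- in the lattice case, it converges uniformly
    (M.IsLattice → TendstoUniformly
      (fun (K : ℕ) (t : ℝ) => ∑ k ∈ Finset.Icc 1 K,
        M.limitFunction β (FractionalSplit.sizeToll b k) t * M.meanToll φ k)
      (M.limitFunction β φ) atTop) := by
  obtain ⟨w, hw, hunif⟩ := M.exists_isLimitFunction hβ hδ hφ hO
  have heq : M.limitFunction β φ = w := (M.limitFunction_spec ⟨w, hw⟩).unique M hβ hw
  refine ⟨M.ae_finite_nodes, ⟨w, hw, fun w' hw' => hw'.unique M hβ hw⟩, fun k hk => ?_, ?_, ?_⟩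
  · obtain ⟨w', hw'⟩ := M.exists_isLimitFunction_sizeToll hβ hk
    exact ⟨w', hw', fun w'' hw'' => hw''.unique M hβ hw'⟩
  · rw [heq]; exact hunif.tendsto_at
  · rw [heq]; exact fun _ => hunif
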